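/- Let $\alpha,\beta,\lambda>0$. There is a constant $\eta_0>0$, depending only on $\alpha,\beta,\lambda$, such that the following holds. Let $d\ge 0$ be an integer, let $A,B:\mathbf R^d\to\mathbf R^d$ be Lipschitz with constants $C_A,C_B\ge 0$, let $B$ be odd, and assume $C_A+C_B<\eta_0$. Let $\rho_0$ be a probability measure on $\mathbf R^{3d}$ with finite second moment. Let $(W^i)_i$ be independent standard Brownian motions in $\mathbf R^d$ and let $X^i_0=(Q^i_0,P^i_0,Z^i_0)$ be independent $\mathbf R^{3d}$-valued random vectors with law $\rho_0$, independent of $(W^i)_i$. Let $X^{i,N}_t=(Q^{i,N}_t,P^{i,N}_t,Z^{i,N}_t)$, $1\le i\le N$, be the continuous solution of the interacting system $$dQ^{i,N}_t=P^{i,N}_t\,dt,$$ $$dP^{i,N}_t=-\beta Q^{i,N}_t\,dt-A(Q^{i,N}_t)\,dt-\frac1N\sum_{j=1}^N B(Q^{i,N}_t-Q^{j,N}_t)\,dt+\lambda Z^{i,N}_t\,dt,$$ $$dZ^{i,N}_t=-\lambda P^{i,N}_t\,dt-\alpha Z^{i,N}_t\,dt+\sqrt2\,dW^i_t,\qquad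 X^{i,N}_0=X^i_0,$$ and let $\tilde X^i_t=(\tilde Q^i_t,\tilde P^i_t,\tilde Z^i_t)$ be the continuous solution of the McKean–Vlasov equation $$d\tilde Q^i_t=\tilde P^i_t\,dt,$$ $$d\tilde P^i_t=-\beta\tilde Q^i_t\,dt-A(\tilde Q^i_t)\,dt-(B*\mu_t)(\tilde Q^i_t)\,dt+\lambda\tilde Z^i_t\,dt,$$ $$d\tilde Z^i_t=-\lambda\tilde P^i_t\,dt-\alpha\tilde Z^i_t\,dt+\sqrt2\,dW^i_t,\qquad \tilde X^i_0=X^i_0,$$ where $\mu_t$ is the law of $\tilde X^i_t$ (it does not depend on $i$) and $(B*\mu_t)(q)=\int_{\mathbf R^{3d}}B(q-q')\,\mu_t(dq'\,dp'\,dz')$. Then there is a constant $C>0$, independent of $N$ (it depends only on $\alpha,\beta,\lambda,d,A,B$ and on an upper bound for the second moment of $\rho_0$), such that for all $N\ge 1$ and all $i=1,\dots,N$ $$\sup_{t\ge0}\mathbb E\Big(|Q^{i,N}_t-\tilde Q^i_t|^2+|P^{i,N}_t-\tilde P^i_t|^2+|Z^{i,N}_t-\tilde Z^i_t|^2\Big)\le\frac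 CN.$$ As a consequence, the particle system has the property of propagation of chaos: for every $t\ge 0$ and $k\ge1$, the joint law at time $t$ of any $k$ distinct particles $X^{i_1,N}_t,\dots,X^{i_k,N}_t$ (the choice of which may vary with $N\ge k$) converges narrowly to $\mu_t^{\otimes k}$ as $N\to\infty$. In addition, the law $\rho^{(1,N)}_t$ of any one particle $X^{i,N}_t$ converges to $\mu_t$ uniformly in $t$ in the Wasserstein distance: $$\sup_{t\ge0}W_2\big(\rho^{(1,N)}_t,\mu_t\big)^2\le\frac CN,$$ where $W_2(\mu,\nu)^2$ is the infimum of $\mathbb E\big(|Q-\tilde Q|^2+|P-\tilde P|^2+|Z-\tilde Z|^2\big)$ over all couplings of $(Q,P,Z)\sim\mu$ and $(\tilde Q,\tilde P,\tilde Z)\sim\nu$. -/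

import Mathlib

open MeasureTheory ProbabilityTheory
open scoped NNReal ENNReal BoundedContinuousFunction

namespace GenVlasov

noncomputable section

/-- Euclidean space `ℝ^d`. -/
abbrev Space (d : ℕ) : Type := EuclideanSpace ℝ (Fin d)

/-- The phase space `ℝ^{3d}` of triples `(q, p, z)`. Only its topology and its Borel sets are used;
its Euclidean norm is written out in `sqNorm`. -/
abbrev State (d : ℕ) : Type := Space d × Space d × Space d

/-- `|q|² + |p|² + |z|²`. -/
def sqNorm {d : ℕ} (x : State d) : ℝ := ‖x.1‖ ^ 2 + ‖x.2.1‖ ^ 2 + ‖x.2.2‖ ^ 2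

/-- The second moment of a measure on the phase space. -/
def secondMoment {d : ℕ} (μ : Measure (State d)) : ℝ≥0∞ :=
  ∫⁻ x, ENNReal.ofReal (sqNorm x) ∂μ

/-- The quadratic Wasserstein distance on the phase space. A coupling, that is, a joint law of two
random variables with laws `μ` and `ν`, is a measure on the product with marginals `μ`, `ν`. -/
def W₂ {d : ℕ} (μ ν : Measure (State d)) : ℝ≥0∞ :=
  (⨅ π : {π : Measure (State d × State d) // π.map Prod.fst = μ ∧ π.map Prod.snd = ν},
    ∫⁻ x, ENNReal.ofReal (sqNorm (x.1 - x.2)) ∂π.1) ^ (1 / 2 : ℝ)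

/-- The convolution `B ∗ μ (q) = ∫ B (q - q') μ(dq' dp' dz')`. -/
def conv {d : ℕ} (B : Space d → Space d) (μ : Measure (State d)) (q : Space d) : Space d :=
  ∫ x, B (q - x.1) ∂μ

variable {Ω : Type*} [MeasurableSpace Ω]

/-- `W` is a standard Brownian motion in `ℝ^d`: its coordinates are independent standard real
Brownian motions. -/
structure IsBrownian {d : ℕ} (W : ℝ≥0 → Ω → Space d) (P : Measure Ω) : Prop where
  measurable : ∀ t, Measurable (W t)
  coord : ∀ k : Fin d, IsBrownianReal (fun t ω => W t ω k) P
  indep : iIndepFun (fun (k : Fin d) (ω : Ω) (t : ℝ≥0) => W t ω k) P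

/-- The random inputs: independent Brownian motions `W i` and independent initial states `X₀ i` with
law `ρ₀`, the family of initial states being independent of the family of Brownian motions. -/
structure IsDrivingData {ι : Type*} {d : ℕ} (P : Measure Ω) (ρ₀ : Measure (State d))
    (W : ι → ℝ≥0 → Ω → Space d) (X₀ : ι → Ω → State d) : Prop where
  brownian : ∀ i, IsBrownian (W i) P
  indep_brownian : iIndepFun (fun (i : ι) (ω : Ω) (t : ℝ≥0) => W i t ω) P
  measurable_init : ∀ i, Measurable (X₀ i)
  law_init : ∀ i, HasLaw (X₀ i) ρ₀ P
  indep_init : iIndepFun X₀ P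
  indep_init_brownian :
    IndepFun (fun (ω : Ω) (i : ι) => X₀ i ω) (fun (ω : Ω) (i : ι) (t : ℝ≥0) => W i t ω) P

/-- The continuous process `X = (Q, P, Z)` starts from `X₀` and solves
`dQ = P dt`, `dP = (-β Q - A(Q) - F + λ Z) dt`, `dZ = (-λ P - α Z) dt + √2 dW`,
where `F` is a given random, time-dependent interaction force. The noise being additive, the
equation is an integral equation along almost every path. -/
structure SolvesSDE {d : ℕ} (α β lam : ℝ) (A : Space d → Space d) (P : Measure Ω)
    (W : ℝ≥0 → Ω → Space d) (X₀ : Ω → State d) (F : ℝ≥0 → Ω → Space d)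
    (X : ℝ≥0 → Ω → State d) : Prop where
  measurable : ∀ t, Measurable (X t)
  continuous : ∀ᵐ ω ∂P, Continuous fun t => X t ω
  integrable_force : ∀ᵐ ω ∂P, ∀ t : ℝ≥0,
    IntervalIntegrable (fun s : ℝ => F s.toNNReal ω) volume 0 t
  eq_q : ∀ᵐ ω ∂P, ∀ t : ℝ≥0,
    (X t ω).1 = (X₀ ω).1 + ∫ s in (0 : ℝ)..t, (X s.toNNReal ω).2.1
  eq_p : ∀ᵐ ω ∂P, ∀ t : ℝ≥0,
    (X t ω).2.1 = (X₀ ω).2.1 + ∫ s in (0 : ℝ)..t,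
      (-(β • (X s.toNNReal ω).1) - A (X s.toNNReal ω).1 - F s.toNNReal ω
        + lam • (X s.toNNReal ω).2.2)
  eq_z : ∀ᵐ ω ∂P, ∀ t : ℝ≥0,
    (X t ω).2.2 = (X₀ ω).2.2 + (∫ s in (0 : ℝ)..t,
      (-(lam • (X s.toNNReal ω).2.1) - α • (X s.toNNReal ω).2.2)) + √2 • W t ω

/-- The interacting particle system: particle `i` feels the force
`(1/N) ∑ j, B (Q^i - Q^j)`, with `N` the number of particles. -/
def IsParticleSystem {ι : Type*} [Fintype ι] {d : ℕ} (α β lam : ℝ) (A B : Space d → Space d)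
    (P : Measure Ω) (W : ι → ℝ≥0 → Ω → Space d) (X₀ : ι → Ω → State d)
    (X : ι → ℝ≥0 → Ω → State d) : Prop :=
  ∀ i, SolvesSDE α β lam A P (W i) (X₀ i)
    (fun t ω => (Fintype.card ι : ℝ)⁻¹ • ∑ j, B ((X i t ω).1 - (X j t ω).1)) (X i)

/-- The McKean–Vlasov equation: the interaction force is `(B ∗ μ_t)(Q_t)`, with `μ_t` the law of the
solution itself at time `t`. The first clause says that `B ∗ μ_t` is well defined. -/
def IsMcKeanVlasov {d : ℕ} (α β lam : ℝ) (A B : Space d → Space d) (P : Measure Ω)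
    (W : ℝ≥0 → Ω → Space d) (X₀ : Ω → State d) (X : ℝ≥0 → Ω → State d) : Prop :=
  (∀ t q, Integrable (fun x : State d => B (q - x.1)) (P.map (X t))) ∧
  SolvesSDE α β lam A P W X₀ (fun t ω => conv B (P.map (X t)) (X t ω).1) X

/-- The joint law of all the particles at time `t`. -/
def jointLaw {N d : ℕ} (P : Measure Ω) (X : Fin N → ℝ≥0 → Ω → State d) (t : ℝ≥0) :
    Measure (Fin N → State d) :=
  P.map fun ω i => X i t ω

/-- The `(i₁, …, i_k)`-marginal of a law on `N` particles. -/
def marginal {N k d : ℕ} (ρ : Measure (Fin N → State d)) (i : Fin k → Fin N) :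
    Measure (Fin k → State d) :=
  ρ.map fun x j => x (i j)

/-- Propagation of chaos with respect to `μ`: at each time and for each `k ≥ 1`, the marginals of the
`N`-particle law along any `k` distinct particles, which may vary with `N ≥ k`, converge narrowly to
`μ_t^{⊗k}` as `N → ∞`. The number of particles is written `k + n`. -/
def PropagationOfChaos {d : ℕ} (P : Measure Ω) (X : (N : ℕ) → Fin N → ℝ≥0 → Ω → State d)
    (μ : ℝ≥0 → Measure (State d)) : Prop :=
  ∀ (t : ℝ≥0) (k : ℕ), 1 ≤ k → ∀ (i : (n : ℕ) → Fin k ↪ Fin (k + n))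
    (φ : (Fin k → State d) →ᵇ ℝ),
    Filter.Tendsto (fun n => ∫ x, φ x ∂(marginal (jointLaw P (X (k + n)) t) (i n)))
      Filter.atTop (nhds (∫ x, φ x ∂(Measure.pi fun _ : Fin k => μ t)))

end

end GenVlasov

/-! The particle system and the McKean–Vlasov processes are driven by the same Brownian motions and
start from the same points, so the noise, being additive, cancels in `X i - Y i`. What remains is an
ordinary differential equation: linear drift plus a force. The linear part dissipates directly only
in `z`, but the couplings `λ` and `β` transmit the damping to `p` and then to `q`. Adding small
multiples of `⟨p, z⟩` and `⟨q, p⟩` to the energy `β|q|² + |p|² + |z|²` gives a quadratic Lyapunov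
function that decays in all directions (`exists_lyapunov`). Forces with small Lipschitz constants
are absorbed by this decay, so errors do not accumulate in time.

The source term left in the equation for `X i - Y i` is the fluctuation of the empirical force
`(1/N) ∑ j, B (Q i - Q j)` of the mean-field processes about its conditional mean `B ∗ μ`. The `Y j`
being independent with common law, its summands are orthogonal and its mean square is `O(1/N)`
(`lintegral_fluctuation_sq_le`). Summing the Lyapunov inequality over all particles bounds the total
mean square position error independently of `N`. Inserting this in the inequality of a single
particle gives `O(1/N)` for each one, without any appeal to exchangeability of the particle system
(`IsParticleSystem.lintegral_sqNorm_sub_le`).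

The fluctuation bound is uniform in time because `E|Q|²` is bounded uniformly in time for the
McKean–Vlasov process (`IsMcKeanVlasov.lintegral_fst_sq_le`). This uses the same Lyapunov function
with no Itô formula: subtracting from `Z` the noise `√2 (W_t - ∫_{t-1}^t W)`, whose variance is
bounded, leaves a differentiable path.

Independence and equality in law of the `Y j` have to be proved, the `Y j` being arbitrary
solutions. The explicit Euler scheme is a measurable function of the initial state and the Brownian
path and converges to `Y` in mean. Hence `Y j t` is a function of the `j`-th input alone
(`IsMcKeanVlasov.exists_ae_eq_comp`), and comparing two schemes in an exponentially weighted norm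
gives uniqueness in law (`IsMcKeanVlasov.map_eq_map`).

The Wasserstein bound follows since `(X i, Y i)` is a coupling; chaos follows since `k` particles
lie at vanishing mean distance from `k` independent copies of the limit. -/

namespace GenVlasov

/-! ### Grönwall inequalities and differentiation of integral equations. -/

section Deterministic

open Filter Topology Set

variable {E : Type*} [NormedAddCommGroup E] [NormedSpace ℝ E]

/-- A differential inequality with exponential relaxation, integrated. -/
theorem le_exp_mul_add_integral_of_deriv_le {v v' r : ℝ → ℝ} {κ : ℝ}
    (hv : ContinuousOn v (Ici 0)) (hr : Continuous r)
    (hd : ∀ t, 0 < t → HasDerivAt v (v' t) t) (hle : ∀ t, 0 < t → v' t ≤ -κ * v t + r t)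
    {t : ℝ} (ht : 0 ≤ t) :
    v t ≤ Real.exp (-κ * t) * v 0 + ∫ s in (0 : ℝ)..t, Real.exp (-κ * (t - s)) * r s := by
  have hc : Continuous fun s => Real.exp (κ * s) * r s := by fun_prop
  set w : ℝ → ℝ := fun t => Real.exp (κ * t) * v t - ∫ s in (0 : ℝ)..t, Real.exp (κ * s) * r s
  have hI : ∀ t, HasDerivAt (fun t => ∫ s in (0 : ℝ)..t, Real.exp (κ * s) * r s)
      (Real.exp (κ * t) * r t) t := fun t => hc.integral_hasStrictDerivAt 0 t |>.hasDerivAt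
  have hexp : ∀ t, HasDerivAt (fun t => Real.exp (κ * t)) (Real.exp (κ * t) * κ) t := fun t => by
    simpa using ((hasDerivAt_id t).const_mul κ).exp
  have hwd : ∀ t, 0 < t → HasDerivAt w (Real.exp (κ * t) * κ * v t + Real.exp (κ * t) * v' t
      - Real.exp (κ * t) * r t) t := fun t ht => ((hexp t).mul (hd t ht)).sub (hI t)
  have hanti : AntitoneOn w (Ici 0) := by
    refine antitoneOn_of_deriv_nonpos (convex_Ici 0) ?_ ?_ ?_
    · refine ContinuousOn.sub (ContinuousOn.mul (by fun_prop) hv) ?_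
      exact fun t _ => (hI t).continuousAt.continuousWithinAt
    · intro t ht
      rw [interior_Ici] at ht
      exact (hwd t ht).differentiableAt.differentiableWithinAt
    · intro t ht
      rw [interior_Ici] at ht
      rw [(hwd t ht).deriv]
      have := mul_le_mul_of_nonneg_left (hle t ht) (Real.exp_pos (κ * t)).le
      linarith
  have h0 := hanti (mem_Ici.2 le_rfl) (mem_Ici.2 ht) ht
  simp only [w, mul_zero, Real.exp_zero, one_mul, intervalIntegral.integral_same, sub_zero] at h0
  have h1 : ∫ s in (0 : ℝ)..t, Real.exp (-κ * (t - s)) * r s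
      = Real.exp (-κ * t) * ∫ s in (0 : ℝ)..t, Real.exp (κ * s) * r s := by
    rw [← intervalIntegral.integral_const_mul]
    congr 1 with s
    rw [← mul_assoc, ← Real.exp_add]; ring_nf
  have h2 : Real.exp (-κ * t) * Real.exp (κ * t) = 1 := by
    rw [← Real.exp_add]; simp
  rw [h1, ← mul_add]
  calc v t = Real.exp (-κ * t) * (Real.exp (κ * t) * v t) := by rw [← mul_assoc, h2, one_mul]
    _ ≤ _ := by gcongr; linarith

/-- Grönwall's inequality in integral form. -/
theorem le_mul_exp_of_le_add_integral {φ : ℝ → ℝ} {a L : ℝ} (hL : 0 ≤ L)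
    (hφ : Continuous φ) {T : ℝ} (hle : ∀ t ∈ Icc 0 T, φ t ≤ a + L * ∫ s in (0 : ℝ)..t, φ s)
    {t : ℝ} (ht : t ∈ Icc 0 T) : φ t ≤ a * Real.exp (L * t) := by
  have hI : ∀ t, HasDerivAt (fun t => ∫ s in (0 : ℝ)..t, φ s) (φ t) t :=
    fun t => hφ.integral_hasStrictDerivAt 0 t |>.hasDerivAt
  set w : ℝ → ℝ := fun t => Real.exp (-L * t) * (a + L * ∫ s in (0 : ℝ)..t, φ s)
  have hexp : ∀ t, HasDerivAt (fun t => Real.exp (-L * t)) (Real.exp (-L * t) * -L) t := fun t => by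
    simpa using ((hasDerivAt_id t).const_mul (-L)).exp
  have hwd : ∀ t, HasDerivAt w (Real.exp (-L * t) * -L * (a + L * ∫ s in (0 : ℝ)..t, φ s)
      + Real.exp (-L * t) * (L * φ t)) t :=
    fun t => (hexp t).mul (((hI t).const_mul L).const_add a)
  have hanti : AntitoneOn w (Icc 0 T) := by
    refine antitoneOn_of_deriv_nonpos (convex_Icc 0 T)
      (fun t _ => (hwd t).continuousAt.continuousWithinAt)
      (fun t _ => (hwd t).differentiableAt.differentiableWithinAt) ?_
    intro t ht
    rw [(hwd t).deriv]
    have := mul_le_mul_of_nonneg_left (hle t (interior_subset ht))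
      (mul_nonneg (Real.exp_pos (-L * t)).le hL)
    linarith
  have h0 := hanti (left_mem_Icc.2 (ht.1.trans ht.2)) ht ht.1
  simp only [w, mul_zero, Real.exp_zero, one_mul, intervalIntegral.integral_same, add_zero] at h0
  have h2 : Real.exp (L * t) * Real.exp (-L * t) = 1 := by
    rw [← Real.exp_add]; simp
  calc φ t ≤ a + L * ∫ s in (0 : ℝ)..t, φ s := hle t ht
    _ = Real.exp (L * t) * (Real.exp (-L * t) * (a + L * ∫ s in (0 : ℝ)..t, φ s)) := by
      rw [← mul_assoc, h2, one_mul]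
    _ ≤ Real.exp (L * t) * a := by gcongr
    _ = _ := mul_comm _ _

/-- The fundamental theorem of calculus for paths indexed by `ℝ≥0`. -/
theorem hasDerivAt_comp_toNNReal_of_eq_integral [CompleteSpace E] {x : ℝ≥0 → E} {x₀ : E}
    {c : ℝ → E} (hc : Continuous c) (hx : ∀ t : ℝ≥0, x t = x₀ + ∫ s in (0 : ℝ)..t, c s)
    {t : ℝ} (ht : 0 < t) : HasDerivAt (fun s : ℝ => x s.toNNReal) (c t) t := by
  have h := (hc.integral_hasStrictDerivAt 0 t).hasDerivAt.const_add x₀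
  refine h.congr_of_eventuallyEq ?_
  filter_upwards [lt_mem_nhds ht] with s hs
  rw [hx, Real.coe_toNNReal s hs.le]

end Deterministic

/-! ### The hypocoercive quadratic Lyapunov function. -/

section Lyapunov

variable {d : ℕ}

/-- The quadratic Lyapunov function of the linear part of the dynamics. -/
noncomputable def lyapunov (β lam ε : ℝ) (x : State d) : ℝ :=
  β * ‖x.1‖ ^ 2 + ‖x.2.1‖ ^ 2 + ‖x.2.2‖ ^ 2
    + 2 * ε * (2 / lam * inner ℝ x.2.1 x.2.2 + inner ℝ x.1 x.2.1)

/-- The derivative of `lyapunov` at `x` in the direction `y`. -/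
noncomputable def lyapunovDeriv (β lam ε : ℝ) (x y : State d) : ℝ :=
  β * (2 * inner ℝ x.1 y.1) + 2 * inner ℝ x.2.1 y.2.1 + 2 * inner ℝ x.2.2 y.2.2
    + 2 * ε * (2 / lam * (inner ℝ x.2.1 y.2.2 + inner ℝ y.2.1 x.2.2)
      + (inner ℝ x.1 y.2.1 + inner ℝ y.1 x.2.1))

theorem hasDerivAt_lyapunov (β lam ε : ℝ) {x : ℝ → State d} {y : State d} {t : ℝ}
    (h1 : HasDerivAt (fun s => (x s).1) y.1 t) (h2 : HasDerivAt (fun s => (x s).2.1) y.2.1 t)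
    (h3 : HasDerivAt (fun s => (x s).2.2) y.2.2 t) :
    HasDerivAt (fun s => lyapunov β lam ε (x s)) (lyapunovDeriv β lam ε (x t) y) t := by
  unfold lyapunov lyapunovDeriv
  exact (((h1.norm_sq.const_mul β).add h2.norm_sq).add h3.norm_sq).add
    ((((h2.inner ℝ h3).const_mul (2 / lam)).add (h1.inner ℝ h2)).const_mul (2 * ε))

@[fun_prop]
theorem continuous_lyapunov (β lam ε : ℝ) : Continuous (lyapunov β lam ε : State d → ℝ) := by
  unfold lyapunov; fun_prop

@[fun_prop]
theorem continuous_sqNorm : Continuous (sqNorm : State d → ℝ) := by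
  unfold sqNorm; fun_prop

theorem sqNorm_nonneg (x : State d) : 0 ≤ sqNorm x := by unfold sqNorm; positivity

/-- The linear drift with a force `f` on the velocity and `h` on the memory variable. -/
def linDrift (α β lam : ℝ) (x : State d) (f h : Space d) : State d :=
  (x.2.1, -(β • x.1) + lam • x.2.2 + f, -(lam • x.2.1) - α • x.2.2 + h)

theorem two_mul_abs_inner_le {F : Type*} [NormedAddCommGroup F] [InnerProductSpace ℝ F]
    (x y : F) {a : ℝ} (ha : 0 < a) : 2 * |inner ℝ x y| ≤ a * ‖x‖ ^ 2 + a⁻¹ * ‖y‖ ^ 2 := by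
  have h1 := abs_real_inner_le_norm x y
  have h2 : 0 ≤ a⁻¹ * (a * ‖x‖ - ‖y‖) ^ 2 := by positivity
  have h3 : a⁻¹ * (a * ‖x‖ - ‖y‖) ^ 2 = a * ‖x‖ ^ 2 + a⁻¹ * ‖y‖ ^ 2 - 2 * (‖x‖ * ‖y‖) := by
    field_simp
    ring
  linarith

/-- Hypocoercivity: the linear dynamics admits a quadratic Lyapunov function. -/
theorem exists_lyapunov {α β lam : ℝ} (hα : 0 < α) (hβ : 0 < β) (hlam : 0 < lam) :
    ∃ ε c C κ K : ℝ, 0 < c ∧ 0 < C ∧ 0 < κ ∧ 0 < K ∧ ∀ (d : ℕ) (x : State d),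
      c * sqNorm x ≤ lyapunov β lam ε x ∧ lyapunov β lam ε x ≤ C * sqNorm x ∧
      ∀ f h : Space d, lyapunovDeriv β lam ε x (linDrift α β lam x f h)
        ≤ -κ * sqNorm x + K * (‖f‖ ^ 2 + ‖h‖ ^ 2) := by
  set m := |lam - 2 * β / lam| with hm
  -- The first three bounds keep the cross terms below half of the energy, so that `lyapunov` is
  -- comparable to `sqNorm`. The last one lets half of the damping `2α|z|²` pay for the `|z|²` terms
  -- that the cross terms produce.
  obtain ⟨ε, hε, h1, h2, h3, h4⟩ : ∃ ε : ℝ, 0 < ε ∧ ε ≤ 1 / 4 ∧ ε ≤ β / 2 ∧ 2 * ε / lam ≤ 1 / 4 ∧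
      ε * (4 + 2 * m ^ 2 / β + 8 * α ^ 2 / lam ^ 2) ≤ α := by
    set D := 4 + 2 * m ^ 2 / β + 8 * α ^ 2 / lam ^ 2
    have hD : 0 < D := by positivity
    refine ⟨min (min (1 / 4) (β / 2)) (min (lam / 8) (α / D)), by positivity, ?_, ?_, ?_, ?_⟩
    · exact (min_le_left _ _).trans (min_le_left _ _)
    · exact (min_le_left _ _).trans (min_le_right _ _)
    · rw [div_le_iff₀ hlam]
      have := (min_le_right (min (1 / 4) (β / 2)) _).trans (min_le_left (lam / 8) (α / D))
      linarith
    · rw [← le_div_iff₀ hD]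
      exact (min_le_right _ _).trans (min_le_right _ _)
  refine ⟨ε, min (β / 2) (1 / 2), β + 2, min (α / 2) (min ε (ε * β)),
    max (4 / ε + 16 * ε ^ 2 / (lam ^ 2 * α) + 2 * ε / β) (4 / α + 16 * ε / lam ^ 2),
    by positivity, by positivity, by positivity, by positivity, fun d x => ?_⟩
  obtain ⟨q, p, z⟩ := x
  have e1 := two_mul_abs_inner_le p z one_pos
  have e2 := two_mul_abs_inner_le q p one_pos
  simp only [one_mul, inv_one] at e1 e2
  have e1' : |4 * ε / lam * inner ℝ p z| ≤ 1 / 4 * (‖p‖ ^ 2 + ‖z‖ ^ 2) := by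
    rw [abs_mul, abs_of_pos (by positivity)]
    calc 4 * ε / lam * |inner ℝ p z| = 2 * ε / lam * (2 * |inner ℝ p z|) := by ring
      _ ≤ 1 / 4 * (‖p‖ ^ 2 + ‖z‖ ^ 2) := by gcongr
  have e2' : |2 * ε * inner ℝ q p| ≤ ε * (‖q‖ ^ 2 + ‖p‖ ^ 2) := by
    rw [abs_mul, abs_of_pos (by positivity)]
    calc 2 * ε * |inner ℝ q p| = ε * (2 * |inner ℝ q p|) := by ring
      _ ≤ ε * (‖q‖ ^ 2 + ‖p‖ ^ 2) := by gcongr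
  have hV : lyapunov β lam ε (q, p, z) = β * ‖q‖ ^ 2 + ‖p‖ ^ 2 + ‖z‖ ^ 2
      + 4 * ε / lam * inner ℝ p z + 2 * ε * inner ℝ q p := by
    simp only [lyapunov]; ring
  have hq := sq_nonneg ‖q‖
  have hp := sq_nonneg ‖p‖
  have hz := sq_nonneg ‖z‖
  have g1 : ε * ‖q‖ ^ 2 ≤ β / 2 * ‖q‖ ^ 2 := by gcongr
  have g1' : ε * ‖q‖ ^ 2 ≤ 1 / 4 * ‖q‖ ^ 2 := by gcongr
  have g2 : ε * ‖p‖ ^ 2 ≤ 1 / 4 * ‖p‖ ^ 2 := by gcongr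
  refine ⟨?_, ?_, fun f h => ?_⟩
  · rw [hV]
    simp only [sqNorm]
    have k1 : min (β / 2) (1 / 2) * ‖q‖ ^ 2 ≤ β / 2 * ‖q‖ ^ 2 := by gcongr; exact min_le_left _ _
    have k2 : min (β / 2) (1 / 2) * ‖p‖ ^ 2 ≤ 1 / 2 * ‖p‖ ^ 2 := by gcongr; exact min_le_right _ _
    have k3 : min (β / 2) (1 / 2) * ‖z‖ ^ 2 ≤ 1 / 2 * ‖z‖ ^ 2 := by gcongr; exact min_le_right _ _
    have := neg_abs_le (4 * ε / lam * inner ℝ p z)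
    have := neg_abs_le (2 * ε * inner ℝ q p)
    linarith
  · rw [hV]
    simp only [sqNorm]
    have := le_abs_self (4 * ε / lam * inner ℝ p z)
    have := le_abs_self (2 * ε * inner ℝ q p)
    have := mul_nonneg hβ.le hp
    have := mul_nonneg hβ.le hz
    linarith
  -- The energy alone gives `-2α|z|²`. The term in `⟨q, p⟩` yields `-2εβ|q|²` at the cost of
  -- `+2ε|p|²`; the weight `2 / lam` on `⟨p, z⟩` yields `-4ε|p|²`, twice what is needed, at the cost
  -- of `+4ε|z|²`.
  · have hD : lyapunovDeriv β lam ε (q, p, z) (linDrift α β lam (q, p, z) f h)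
        = -2 * α * ‖z‖ ^ 2 - 2 * ε * ‖p‖ ^ 2 - 2 * ε * β * ‖q‖ ^ 2 + 4 * ε * ‖z‖ ^ 2
          + ε * (lam - 2 * β / lam) * (2 * inner ℝ q z) - 2 * ε * α / lam * (2 * inner ℝ p z)
          + 2 * inner ℝ p f + 2 * inner ℝ z h + 2 * ε / lam * (2 * inner ℝ f z)
          + 2 * ε / lam * (2 * inner ℝ p h) + ε * (2 * inner ℝ q f) := by
      simp only [lyapunovDeriv, linDrift, inner_add_right, inner_sub_right, inner_neg_right,
        inner_add_left, inner_neg_left, real_inner_smul_right,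
        real_inner_smul_left, real_inner_self_eq_norm_sq]
      rw [real_inner_comm z p, real_inner_comm p q]
      field_simp
      ring
    rw [hD]
    have b : ∀ (u v : Space d) (s : ℝ) {a : ℝ}, 0 < a →
        s * (2 * inner ℝ u v) ≤ a * ‖u‖ ^ 2 + s ^ 2 / a * ‖v‖ ^ 2 := fun u v s a ha => by
      have h1 := two_mul_abs_inner_le u (s • v) ha
      rw [real_inner_smul_right, norm_smul, mul_pow, Real.norm_eq_abs, sq_abs] at h1
      have h2 := le_abs_self (s * inner ℝ u v)
      calc s * (2 * inner ℝ u v) = 2 * (s * inner ℝ u v) := by ring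
        _ ≤ a * ‖u‖ ^ 2 + a⁻¹ * (s ^ 2 * ‖v‖ ^ 2) := by linarith
        _ = _ := by ring
    -- Young weights chosen so that exactly half of the dissipation of `q` and of `p` is spent:
    -- `εβ/2 + εβ/2` for `q`, `ε/2 + ε/4 + ε/4` for `p`. For `z`, the two weights `α/4` together
    -- with `k0` leave `α/2`.
    have t1 := b q z (ε * (lam - 2 * β / lam)) (a := ε * β / 2) (by positivity)
    have t2 := b p z (-(2 * ε * α / lam)) (a := ε / 2) (by positivity)
    have t3 := b p f 1 (a := ε / 4) (by positivity)
    have t4 := b z h 1 (a := α / 4) (by positivity)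
    have t5 := b z f (2 * ε / lam) (a := α / 4) (by positivity)
    have t6 := b p h (2 * ε / lam) (a := ε / 4) (by positivity)
    have t7 := b q f ε (a := ε * β / 2) (by positivity)
    rw [real_inner_comm] at t5
    have c1 : (ε * (lam - 2 * β / lam)) ^ 2 / (ε * β / 2) = ε * (2 * m ^ 2 / β) := by
      rw [hm, sq_abs]; field_simp
    have c2 : (-(2 * ε * α / lam)) ^ 2 / (ε / 2) = ε * (8 * α ^ 2 / lam ^ 2) := by
      field_simp; norm_num
    have c3 : (1 : ℝ) ^ 2 / (ε / 4) = 4 / ε := by field_simp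
    have c4 : (1 : ℝ) ^ 2 / (α / 4) = 4 / α := by field_simp
    have c5 : (2 * ε / lam) ^ 2 / (α / 4) = 16 * ε ^ 2 / (lam ^ 2 * α) := by
      field_simp; norm_num
    have c6 : (2 * ε / lam) ^ 2 / (ε / 4) = 16 * ε / lam ^ 2 := by field_simp; norm_num
    have c7 : ε ^ 2 / (ε * β / 2) = 2 * ε / β := by field_simp
    rw [c1] at t1
    rw [c2] at t2
    rw [c3] at t3
    rw [c4] at t4
    rw [c5] at t5
    rw [c6] at t6
    rw [c7] at t7
    have k0 : ε * (4 + 2 * m ^ 2 / β + 8 * α ^ 2 / lam ^ 2) * ‖z‖ ^ 2 ≤ α * ‖z‖ ^ 2 := by gcongr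
    have kf := mul_le_mul_of_nonneg_right (le_max_left
      (4 / ε + 16 * ε ^ 2 / (lam ^ 2 * α) + 2 * ε / β) (4 / α + 16 * ε / lam ^ 2)) (sq_nonneg ‖f‖)
    have kh := mul_le_mul_of_nonneg_right (le_max_right
      (4 / ε + 16 * ε ^ 2 / (lam ^ 2 * α) + 2 * ε / β) (4 / α + 16 * ε / lam ^ 2)) (sq_nonneg ‖h‖)
    have kq := mul_le_mul_of_nonneg_right ((min_le_right (α / 2) (min ε (ε * β))).trans
      (min_le_right _ _)) hq
    have kp := mul_le_mul_of_nonneg_right ((min_le_right (α / 2) (min ε (ε * β))).trans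
      (min_le_left _ _)) hp
    have kz := mul_le_mul_of_nonneg_right (min_le_left (α / 2) (min ε (ε * β))) hz
    simp only [sqNorm]
    linarith

end Lyapunov

/-! ### Joint measurability of processes and inequalities between expectations. -/

section Tools

open Filter Topology Set

variable {Ω : Type*} [MeasurableSpace Ω] {P : Measure Ω}

/-- A process with almost surely continuous paths is jointly measurable up to a null set. -/
theorem aemeasurable_uncurry_toNNReal₀ {F : Type*} [TopologicalSpace F]
    [TopologicalSpace.PseudoMetrizableSpace F] [MeasurableSpace F] [BorelSpace F]
    [SFinite P] {X : ℝ≥0 → Ω → F} (hX : ∀ t, AEMeasurable (X t) P)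
    (hc : ∀ᵐ ω ∂P, Continuous fun t => X t ω) (ν : Measure ℝ) [SFinite ν] :
    AEMeasurable (fun p : ℝ × Ω => X p.1.toNNReal p.2) (ν.prod P) := by
  choose g hgm hge using hX
  -- The time is rounded up to the grid of mesh `1/(n+1)`. Only countably many times are sampled, so
  -- the measurable versions `g` agree with `X` at all of them outside one null set, and path
  -- continuity gives convergence.
  let τ : ℕ → ℕ → ℝ≥0 := fun n k => (k / (n + 1 : ℕ) : ℝ).toNNReal
  let J : ℕ → ℝ → ℕ := fun n t => ⌈(t.toNNReal : ℝ) * (n + 1 : ℕ)⌉₊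
  have hJ : ∀ n, Measurable (J n) := fun n =>
    Nat.measurable_ceil.comp ((measurable_coe_nnreal_real.comp measurable_real_toNNReal).mul_const _)
  have hf : ∀ n, Measurable fun p : ℝ × Ω => g (τ n (J n p.1)) p.2 := by
    intro n
    have h1 : Measurable fun q : ℕ × Ω => g (τ n q.1) q.2 :=
      measurable_from_prod_countable_right fun k => hgm (τ n k)
    exact h1.comp (((hJ n).comp measurable_fst).prodMk measurable_snd)
  refine aemeasurable_of_tendsto_metrizable_ae atTop (fun n => (hf n).aemeasurable) ?_
  have hae : ∀ᵐ ω ∂P, ∀ n k, X (τ n k) ω = g (τ n k) ω :=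
    ae_all_iff.2 fun n => ae_all_iff.2 fun k => hge (τ n k)
  filter_upwards [Measure.quasiMeasurePreserving_snd.ae (hae.and hc)] with p hp
  have hlim : Tendsto (fun n : ℕ => τ n (J n p.1)) atTop (𝓝 p.1.toNNReal) := by
    have h1 := (tendsto_nat_ceil_mul_div_atTop (NNReal.coe_nonneg p.1.toNNReal)).comp
      (tendsto_natCast_atTop_atTop.comp (tendsto_add_atTop_nat 1))
    have h2 := (continuous_real_toNNReal.tendsto _).comp h1
    rwa [Real.toNNReal_coe] at h2
  refine ((hp.2.tendsto p.1.toNNReal).comp hlim).congr fun n => ?_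
  exact hp.1 n _

theorem aemeasurable_uncurry_toNNReal {F : Type*} [TopologicalSpace F]
    [TopologicalSpace.PseudoMetrizableSpace F] [MeasurableSpace F] [BorelSpace F]
    [SFinite P] {X : ℝ≥0 → Ω → F} (hX : ∀ t, Measurable (X t))
    (hc : ∀ᵐ ω ∂P, Continuous fun t => X t ω) (ν : Measure ℝ) [SFinite ν] :
    AEMeasurable (fun p : ℝ × Ω => X p.1.toNNReal p.2) (ν.prod P) :=
  aemeasurable_uncurry_toNNReal₀ (fun t => (hX t).aemeasurable) hc ν

/-- Cauchy–Schwarz against the constant `1`, which has norm `1` for a probability measure. -/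
theorem lintegral_sq_le {α : Type*} [MeasurableSpace α] {ν : Measure α} [IsProbabilityMeasure ν]
    {f : α → ℝ≥0∞} (hf : AEMeasurable f ν) : (∫⁻ x, f x ∂ν) ^ 2 ≤ ∫⁻ x, f x ^ 2 ∂ν := by
  have h := ENNReal.lintegral_mul_le_Lp_mul_Lq ν Real.HolderConjugate.two_two hf
    (aemeasurable_const (b := (1 : ℝ≥0∞)))
  simp only [Pi.mul_apply, mul_one, ENNReal.one_rpow, lintegral_const, measure_univ] at h
  calc (∫⁻ x, f x ∂ν) ^ 2 ≤ ((∫⁻ x, f x ^ (2 : ℝ) ∂ν) ^ (1 / 2 : ℝ)) ^ 2 := by gcongr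
    _ = ∫⁻ x, f x ^ 2 ∂ν := by
      rw [← ENNReal.rpow_natCast, ← ENNReal.rpow_mul]
      norm_num

theorem lintegral_enorm_intervalIntegral_le {E : Type*} [NormedAddCommGroup E] [NormedSpace ℝ E]
    [MeasurableSpace E] [OpensMeasurableSpace E] [SFinite P] {f : ℝ → Ω → E} {a b : ℝ}
    (hab : a ≤ b)
    (hf : AEMeasurable (fun p : ℝ × Ω => f p.1 p.2) ((volume.restrict (Ioc a b)).prod P))
    {R : ℝ≥0∞} (hR : ∀ s ∈ Ioc a b, ∫⁻ ω, ‖f s ω‖ₑ ∂P ≤ R) :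
    ∫⁻ ω, ‖∫ s in a..b, f s ω‖ₑ ∂P ≤ R * ENNReal.ofReal (b - a) := by
  calc ∫⁻ ω, ‖∫ s in a..b, f s ω‖ₑ ∂P ≤ ∫⁻ ω, (∫⁻ s in Ioc a b, ‖f s ω‖ₑ) ∂P := by
        refine lintegral_mono fun ω => ?_
        rw [intervalIntegral.integral_of_le hab]
        exact enorm_integral_le_lintegral_enorm _
    _ = ∫⁻ s in Ioc a b, ∫⁻ ω, ‖f s ω‖ₑ ∂P := by
        rw [lintegral_lintegral_swap]
        exact (hf.prod_swap).enorm
    _ ≤ ∫⁻ s in Ioc a b, R := setLIntegral_mono measurable_const hR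
    _ = _ := by rw [setLIntegral_const, Real.volume_Ioc]

/-- The expectation of an integrated relaxation inequality. -/
theorem lintegral_le_of_relaxation [SFinite P] {v v₀ : Ω → ℝ} {r : ℝ → Ω → ℝ} {κ t : ℝ}
    (hκ : 0 < κ) (ht : 0 ≤ t) {R : ℝ≥0∞} (hv₀ : AEMeasurable v₀ P) (hv₀' : ∀ ω, 0 ≤ v₀ ω)
    (hr : AEMeasurable (fun p : ℝ × Ω => r p.1 p.2) ((volume.restrict (Ioc 0 t)).prod P))
    (hr₀ : ∀ s ω, 0 ≤ r s ω) (hR : ∀ s ∈ Ioc 0 t, ∫⁻ ω, ENNReal.ofReal (r s ω) ∂P ≤ R)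
    (h : ∀ᵐ ω ∂P, v ω ≤ Real.exp (-κ * t) * v₀ ω
      + ∫ s in (0 : ℝ)..t, Real.exp (-κ * (t - s)) * r s ω) :
    ∫⁻ ω, ENNReal.ofReal (v ω) ∂P
      ≤ ∫⁻ ω, ENNReal.ofReal (v₀ ω) ∂P + R * ENNReal.ofReal (1 / κ) := by
  calc ∫⁻ ω, ENNReal.ofReal (v ω) ∂P
      ≤ ∫⁻ ω, (ENNReal.ofReal (v₀ ω)
          + ∫⁻ s in Ioc 0 t, ENNReal.ofReal (Real.exp (-κ * (t - s)) * r s ω)) ∂P := by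
        refine lintegral_mono_ae ?_
        filter_upwards [h] with ω hω
        refine (ENNReal.ofReal_le_ofReal hω).trans (ENNReal.ofReal_add_le.trans ?_)
        gcongr
        · refine mul_le_of_le_one_left (hv₀' ω) ?_
          rw [Real.exp_le_one_iff]; nlinarith
        · rw [intervalIntegral.integral_of_le ht]
          refine (Real.ofReal_le_enorm _).trans
            ((enorm_integral_le_lintegral_enorm _).trans_eq (lintegral_congr fun s => ?_))
          rw [Real.enorm_of_nonneg (mul_nonneg (Real.exp_pos _).le (hr₀ s ω))]
    _ = ∫⁻ ω, ENNReal.ofReal (v₀ ω) ∂P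
          + ∫⁻ s in Ioc 0 t, ∫⁻ ω, ENNReal.ofReal (Real.exp (-κ * (t - s)) * r s ω) ∂P := by
        rw [lintegral_add_left' hv₀.ennreal_ofReal, lintegral_lintegral_swap]
        refine AEMeasurable.ennreal_ofReal (AEMeasurable.mul ?_ hr.prod_swap)
        exact Measurable.aemeasurable (by fun_prop)
    _ ≤ ∫⁻ ω, ENNReal.ofReal (v₀ ω) ∂P
          + ∫⁻ s in Ioc 0 t, R * ENNReal.ofReal (Real.exp (-κ * (t - s))) := by
        refine add_le_add le_rfl ?_
        have hem : Measurable fun s : ℝ => R * ENNReal.ofReal (Real.exp (-κ * (t - s))) := by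
          fun_prop
        refine setLIntegral_mono hem fun s hs => ?_
        simp_rw [ENNReal.ofReal_mul (Real.exp_pos _).le]
        rw [lintegral_const_mul' _ _ ENNReal.ofReal_ne_top, mul_comm]
        gcongr
        exact hR s hs
    _ ≤ _ := by
        gcongr
        rw [lintegral_const_mul _ (by fun_prop)]
        gcongr
        rw [← ofReal_integral_eq_lintegral_ofReal
          ((Continuous.integrableOn_Icc (by fun_prop)).mono_set Ioc_subset_Icc_self)
          (ae_of_all _ fun s => (Real.exp_pos _).le), ← intervalIntegral.integral_of_le ht]
        gcongr
        have hd : ∀ s ∈ uIcc 0 t, HasDerivAt (fun s => Real.exp (-κ * (t - s)) / κ)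
            (Real.exp (-κ * (t - s))) s := by
          intro s _
          have := ((((hasDerivAt_id s).const_sub t).const_mul (-κ)).exp).div_const κ
          refine this.congr_deriv ?_
          simp only [id]
          field_simp
        rw [intervalIntegral.integral_eq_sub_of_hasDerivAt hd
          (Continuous.intervalIntegrable (by fun_prop) _ _)]
        simp only [sub_self, mul_zero, Real.exp_zero, sub_zero]
        have := div_nonneg (Real.exp_pos (-κ * t)).le hκ.le
        linarith

end Tools

/-! ### Moments and uniqueness of the law of Brownian motion. -/

section Brownian

open Filter Topology Set

variable {Ω : Type*} [MeasurableSpace Ω] {P : Measure Ω} {d : ℕ} {W W' : ℝ≥0 → Ω → Space d}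

theorem IsBrownian.continuous (hW : IsBrownian W P) : ∀ᵐ ω ∂P, Continuous fun t => W t ω := by
  filter_upwards [ae_all_iff.2 fun k => (hW.coord k).cont] with ω hω
  exact (PiLp.continuous_toLp 2 (fun _ : Fin d => ℝ)).comp (continuous_pi hω)

theorem IsBrownian.eval_zero (hW : IsBrownian W P) : ∀ᵐ ω ∂P, W 0 ω = 0 := by
  filter_upwards [ae_all_iff.2 fun k => (hW.coord k).eval_zero_ae_eq_zero] with ω hω
  ext k; simpa using hω k

theorem IsBrownian.lintegral_sub_sq (hW : IsBrownian W P) (s t : ℝ≥0) :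
    ∫⁻ ω, ‖W s ω - W t ω‖ₑ ^ 2 ∂P = d * ENNReal.ofReal |(s : ℝ) - t| := by
  have h1 : ∀ ω, ‖W s ω - W t ω‖ₑ ^ 2 = ∑ k : Fin d, ENNReal.ofReal ((W s ω k - W t ω k) ^ 2) := by
    intro ω
    rw [← ENNReal.ofReal_sum_of_nonneg (fun _ _ => sq_nonneg _), ← ofReal_norm,
      ← ENNReal.ofReal_pow (norm_nonneg _), EuclideanSpace.norm_sq_eq]
    simp
  have hm : ∀ u (k : Fin d), Measurable fun ω => W u ω k := fun u k =>
    (EuclideanSpace.proj (𝕜 := ℝ) k).measurable.comp (hW.measurable u)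
  simp_rw [h1]
  have hs : ∀ k : Fin d, Measurable fun ω => ENNReal.ofReal ((W s ω k - W t ω k) ^ 2) :=
    fun k => (((hm s k).sub (hm t k)).pow_const 2).ennreal_ofReal
  rw [lintegral_finsetSum _ fun k _ => hs k]
  have h2 : ∀ k : Fin d, ∫⁻ ω, ENNReal.ofReal ((W s ω k - W t ω k) ^ 2) ∂P
      = ENNReal.ofReal |(s : ℝ) - t| := by
    intro k
    have hl := (hW.coord k).hasLaw_sub s t
    have := hl.lintegral_comp (f := fun x => ENNReal.ofReal (x ^ 2))
      (by fun_prop)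
    simp only [Pi.sub_apply] at this
    have hint : Integrable (fun x : ℝ => x ^ 2) (gaussianReal 0 (nndist s.1 t.1)) :=
      (memLp_id_gaussianReal 2).integrable_sq
    rw [this, ← ofReal_integral_eq_lintegral_ofReal hint (ae_of_all _ fun x => sq_nonneg x)]
    have hv := variance_id_gaussianReal (μ := 0) (v := nndist s.1 t.1)
    rw [variance_of_integral_eq_zero aemeasurable_id (by simp)] at hv
    simp only [id] at hv
    rw [hv]
    rfl
  simp [h2]

theorem IsBrownian.lintegral_sub_le [IsProbabilityMeasure P] (hW : IsBrownian W P) (s t : ℝ≥0) :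
    ∫⁻ ω, ‖W s ω - W t ω‖ₑ ∂P ≤ ENNReal.ofReal √(d * |(s : ℝ) - t|) := by
  have hm : AEMeasurable (fun ω => ‖W s ω - W t ω‖ₑ) P :=
    ((hW.measurable s).sub (hW.measurable t)).enorm.aemeasurable
  have h := lintegral_sq_le hm
  rw [hW.lintegral_sub_sq, ← ENNReal.ofReal_natCast, ← ENNReal.ofReal_mul (by positivity),
    ← Real.sq_sqrt (by positivity : 0 ≤ (d : ℝ) * |(s : ℝ) - t|),
    ENNReal.ofReal_pow (Real.sqrt_nonneg _)] at h
  exact (ENNReal.pow_le_pow_left_iff two_ne_zero).1 h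

/-- Both path laws are projective limits of the same Gaussian family, and a projective limit is
unique. Only finite-dimensional distributions matter for the product σ-algebra, so path continuity
plays no role. -/
theorem map_eq_of_isPreBrownianReal [IsProbabilityMeasure P] {B B' : ℝ≥0 → Ω → ℝ}
    (hB : IsPreBrownianReal B P) (hB' : IsPreBrownianReal B' P) (hm : ∀ t, Measurable (B t))
    (hm' : ∀ t, Measurable (B' t)) :
    P.map (fun ω t => B t ω) = P.map (fun ω t => B' t ω) := by
  have key : ∀ {B : ℝ≥0 → Ω → ℝ}, IsPreBrownianReal B P → (∀ t, Measurable (B t)) →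
      IsProjectiveLimit (P.map fun ω t => B t ω) BrownianReal.projectiveFamily := by
    intro B hB hm I
    rw [Measure.map_map (by fun_prop) (measurable_pi_lambda _ hm)]
    exact (hB.hasLaw I).map_eq
  exact (key hB hm).unique (key hB' hm')

/-- By independence of the coordinates, the path law is the image under a fixed map of the product
of the coordinate laws, and these are determined. -/
theorem IsBrownian.map_eq [IsProbabilityMeasure P] (hW : IsBrownian W P) (hW' : IsBrownian W' P) :
    P.map (fun ω t => W t ω) = P.map (fun ω t => W' t ω) := by
  let g : (Fin d → ℝ≥0 → ℝ) → ℝ≥0 → Space d := fun x t => WithLp.toLp 2 fun k => x k t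
  have hg : Measurable g := by
    refine measurable_pi_lambda _ fun t => ?_
    exact (PiLp.continuous_toLp 2 (fun _ : Fin d => ℝ)).measurable.comp (by fun_prop)
  have key : ∀ {W : ℝ≥0 → Ω → Space d}, IsBrownian W P → P.map (fun ω t => W t ω)
      = (Measure.pi fun k => P.map fun ω t => W t ω k).map g := by
    intro W hW
    have hm : ∀ k, Measurable fun ω (t : ℝ≥0) => W t ω k := fun k =>
      measurable_pi_lambda _ fun t =>
        (EuclideanSpace.proj (𝕜 := ℝ) k).measurable.comp (hW.measurable t)
    rw [← (iIndepFun_iff_map_fun_eq_pi_map fun k => (hm k).aemeasurable).1 hW.indep,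
      Measure.map_map hg (measurable_pi_lambda _ hm)]
    rfl
  rw [key hW, key hW']
  congr 2
  ext1 k
  exact map_eq_of_isPreBrownianReal (hW.coord k).toIsPreBrownianReal
    (hW'.coord k).toIsPreBrownianReal
    (fun t => (EuclideanSpace.proj (𝕜 := ℝ) k).measurable.comp (hW.measurable t))
    (fun t => (EuclideanSpace.proj (𝕜 := ℝ) k).measurable.comp (hW'.measurable t))

end Brownian

/-! ### The inputs of the particles are independent and identically distributed. -/

section DrivingData

variable {Ω : Type*} [MeasurableSpace Ω] {P : Measure Ω} {d : ℕ} {ι : Type*}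
  {ρ₀ : Measure (State d)} {W : ι → ℝ≥0 → Ω → Space d} {X₀ : ι → Ω → State d}

/-- The random input of the `i`-th particle. -/
def input (W : ι → ℝ≥0 → Ω → Space d) (X₀ : ι → Ω → State d) (i : ι) (ω : Ω) :
    State d × (ℝ≥0 → Space d) :=
  (X₀ i ω, fun t => W i t ω)

theorem IsDrivingData.measurable_input (h : IsDrivingData P ρ₀ W X₀) (i : ι) :
    Measurable (input W X₀ i) :=
  (h.measurable_init i).prodMk (measurable_pi_lambda _ (h.brownian i).measurable)

theorem IsDrivingData.map_input [IsProbabilityMeasure P] (h : IsDrivingData P ρ₀ W X₀) (i : ι) :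
    P.map (input W X₀ i) = ρ₀.prod (P.map fun ω t => W i t ω) := by
  have hi : IndepFun (X₀ i) (fun ω t => W i t ω) P :=
    h.indep_init_brownian.comp (φ := fun x : ι → State d => x i)
      (ψ := fun w : ι → ℝ≥0 → Space d => w i) (measurable_pi_apply i) (measurable_pi_apply i)
  rw [← (h.law_init i).map_eq]
  exact (indepFun_iff_map_prod_eq_prod_map_map (h.measurable_init i).aemeasurable
    (measurable_pi_lambda _ (h.brownian i).measurable).aemeasurable).1 hi

theorem IsDrivingData.map_input_eq [IsProbabilityMeasure P] (h : IsDrivingData P ρ₀ W X₀)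
    (i j : ι) : P.map (input W X₀ i) = P.map (input W X₀ j) := by
  rw [h.map_input, h.map_input, (h.brownian i).map_eq (h.brownian j)]

/-- The three independence hypotheses say that the joint law is `(⨂ laws of X₀ i) ⊗ (⨂ laws of W
i)`. Regrouping the factors by particle is measure preserving and turns this into a product over
`i`. -/
theorem IsDrivingData.iIndepFun_input [Fintype ι] [IsProbabilityMeasure P]
    (h : IsDrivingData P ρ₀ W X₀) : iIndepFun (input W X₀) P := by
  have hWm : ∀ i, Measurable fun ω t => W i t ω := fun i =>
    measurable_pi_lambda _ (h.brownian i).measurable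
  have : IsProbabilityMeasure ρ₀ ∨ IsEmpty ι := by
    rcases isEmpty_or_nonempty ι with hι | ⟨⟨i⟩⟩
    · exact Or.inr hι
    · left
      rw [← (h.law_init i).map_eq]
      exact Measure.isProbabilityMeasure_map (h.measurable_init i).aemeasurable
  have hp1 : ∀ i, IsProbabilityMeasure (P.map (X₀ i)) := fun i =>
    Measure.isProbabilityMeasure_map (h.measurable_init i).aemeasurable
  have hp2 : ∀ i, IsProbabilityMeasure (P.map fun ω t => W i t ω) := fun i =>
    Measure.isProbabilityMeasure_map (hWm i).aemeasurable
  rw [iIndepFun_iff_map_fun_eq_pi_map fun i => (h.measurable_input i).aemeasurable]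
  have e := measurePreserving_arrowProdEquivProdArrow (State d) (ℝ≥0 → Space d) ι
    (fun i => P.map (X₀ i)) (fun i => P.map fun ω t => W i t ω)
  have e' := e.symm.map_eq
  have hmap : ∀ i, P.map (input W X₀ i)
      = (P.map (X₀ i)).prod (P.map fun ω t => W i t ω) := fun i => by
    rw [h.map_input, (h.law_init i).map_eq]
  simp_rw [hmap]
  rw [← e', ← (iIndepFun_iff_map_fun_eq_pi_map fun i =>
      (h.measurable_init i).aemeasurable).1 h.indep_init,
    ← (iIndepFun_iff_map_fun_eq_pi_map fun i => (hWm i).aemeasurable).1 h.indep_brownian,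
    ← (indepFun_iff_map_prod_eq_prod_map_map
      (measurable_pi_lambda _ h.measurable_init).aemeasurable
      (measurable_pi_lambda _ hWm).aemeasurable).1 h.indep_init_brownian,
    Measure.map_map (MeasurableEquiv.measurable _)
      ((measurable_pi_lambda _ h.measurable_init).prodMk (measurable_pi_lambda _ hWm))]
  rfl

/-- Passes from the infinite family of inputs to the first `N`, or to `k` chosen particles. -/
theorem IsDrivingData.comp {κ : Type*} (h : IsDrivingData P ρ₀ W X₀) {e : κ → ι}
    (he : Function.Injective e) : IsDrivingData P ρ₀ (fun i => W (e i)) fun i => X₀ (e i) where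
  brownian i := h.brownian (e i)
  indep_brownian := h.indep_brownian.precomp he
  measurable_init i := h.measurable_init (e i)
  law_init i := h.law_init (e i)
  indep_init := h.indep_init.precomp he
  indep_init_brownian := h.indep_init_brownian.comp (φ := fun (x : ι → State d) i => x (e i))
    (ψ := fun (w : ι → ℝ≥0 → Space d) i => w (e i)) (by fun_prop) (by fun_prop)

end DrivingData

/-! ### Pathwise integral equations and Lipschitz bounds on the drift. -/

section Paths

open Filter Topology Set

variable {Ω : Type*} [MeasurableSpace Ω] {P : Measure Ω} {d : ℕ} {α β lam : ℝ}
  {A B : Space d → Space d} {W : ℝ≥0 → Ω → Space d} {X₀ : Ω → State d}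

/-- The noise enters through the memory variable. -/
noncomputable def noise (w : Space d) : State d := (0, 0, √2 • w)

@[fun_prop]
theorem continuous_noise : Continuous (noise : Space d → State d) := by
  unfold noise; fun_prop

theorem noise_sub (w w' : Space d) : noise w - noise w' = noise (w - w') := by
  simp [noise, smul_sub]

theorem norm_noise (w : Space d) : ‖noise w‖ = √2 * ‖w‖ := by
  simp [noise, norm_smul, abs_of_nonneg (Real.sqrt_nonneg 2)]

@[fun_prop]
theorem Continuous.linDrift {T : Type*} [TopologicalSpace T] {x : T → State d} {f h : T → Space d}
    (hx : Continuous x) (hf : Continuous f) (hh : Continuous h) :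
    Continuous fun t => linDrift α β lam (x t) (f t) (h t) := by
  unfold GenVlasov.linDrift; fun_prop

theorem linDrift_sub (x y : State d) (f g h k : Space d) :
    linDrift α β lam x f h - linDrift α β lam y g k = linDrift α β lam (x - y) (f - g) (h - k) := by
  simp only [linDrift, Prod.mk_sub_mk, Prod.fst_sub, Prod.snd_sub, smul_sub]
  refine Prod.ext rfl (Prod.ext ?_ ?_) <;> dsimp only <;> abel

/-- The norm of `State d` is the maximum of the three component norms, so each component is bounded
separately; the constant is a crude sum that covers all of them. -/
theorem norm_linDrift_le (hα : 0 ≤ α) (hβ : 0 ≤ β) (hlam : 0 ≤ lam) (x : State d)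
    (f h : Space d) :
    ‖linDrift α β lam x f h‖ ≤ (1 + β + 2 * lam + α) * ‖x‖ + ‖f‖ + ‖h‖ := by
  have h1 : ‖x.1‖ ≤ ‖x‖ := norm_fst_le x
  have h2 : ‖x.2.1‖ ≤ ‖x‖ := (norm_fst_le x.2).trans (norm_snd_le x)
  have h3 : ‖x.2.2‖ ≤ ‖x‖ := (norm_snd_le x.2).trans (norm_snd_le x)
  have hf := norm_nonneg f
  have hh := norm_nonneg h
  have hx := norm_nonneg x
  have e1 : β * ‖x.1‖ ≤ β * ‖x‖ := by gcongr
  have e2 : lam * ‖x.2.1‖ ≤ lam * ‖x‖ := by gcongr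
  have e3 : lam * ‖x.2.2‖ ≤ lam * ‖x‖ := by gcongr
  have e4 : α * ‖x.2.2‖ ≤ α * ‖x‖ := by gcongr
  have p1 := mul_nonneg hα hx
  have p2 := mul_nonneg hβ hx
  have p3 := mul_nonneg hlam hx
  rw [linDrift, Prod.norm_def, Prod.norm_def]
  refine max_le ?_ (max_le ?_ ?_)
  · dsimp only; linarith
  · dsimp only
    refine (norm_add₃_le).trans ?_
    rw [norm_neg, norm_smul, norm_smul, Real.norm_of_nonneg hβ, Real.norm_of_nonneg hlam]
    linarith
  · dsimp only
    refine (norm_add_le _ _).trans ?_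
    have := norm_sub_le (-(lam • x.2.1)) (α • x.2.2)
    rw [norm_neg, norm_smul, norm_smul, Real.norm_of_nonneg hα, Real.norm_of_nonneg hlam] at this
    linarith

theorem fst_intervalIntegral {E F : Type*} [NormedAddCommGroup E] [NormedSpace ℝ E]
    [CompleteSpace E] [NormedAddCommGroup F] [NormedSpace ℝ F] [CompleteSpace F] {f : ℝ → E × F}
    {a b : ℝ} (hf : IntervalIntegrable f volume a b) :
    (∫ s in a..b, f s).1 = ∫ s in a..b, (f s).1 :=
  ((ContinuousLinearMap.fst ℝ E F).intervalIntegral_comp_comm hf).symm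

theorem snd_intervalIntegral {E F : Type*} [NormedAddCommGroup E] [NormedSpace ℝ E]
    [CompleteSpace E] [NormedAddCommGroup F] [NormedSpace ℝ F] [CompleteSpace F] {f : ℝ → E × F}
    {a b : ℝ} (hf : IntervalIntegrable f volume a b) :
    (∫ s in a..b, f s).2 = ∫ s in a..b, (f s).2 :=
  ((ContinuousLinearMap.snd ℝ E F).intervalIntegral_comp_comm hf).symm

/-- The three scalar equations as one integral equation on the phase space. -/
theorem SolvesSDE.eq_integral {F : ℝ≥0 → Ω → Space d} {X : ℝ≥0 → Ω → State d}
    (h : SolvesSDE α β lam A P W X₀ F X) (hA : Continuous A) :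
    ∀ᵐ ω ∂P, ∀ t : ℝ≥0,
      IntervalIntegrable (fun s : ℝ => linDrift α β lam (X s.toNNReal ω)
        (-A (X s.toNNReal ω).1 - F s.toNNReal ω) 0) volume 0 t ∧
      X t ω = X₀ ω + (∫ s in (0 : ℝ)..t, linDrift α β lam (X s.toNNReal ω)
        (-A (X s.toNNReal ω).1 - F s.toNNReal ω) 0) + noise (W t ω) := by
  filter_upwards [h.continuous, h.integrable_force, h.eq_q, h.eq_p, h.eq_z]
    with ω hc hF hq hp hz t
  have hc' : Continuous fun s : ℝ => X s.toNNReal ω := hc.comp continuous_real_toNNReal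
  have hI : IntervalIntegrable (fun s : ℝ => linDrift α β lam (X s.toNNReal ω)
        (-A (X s.toNNReal ω).1 - F s.toNNReal ω) 0) volume 0 t := by
    have h1 : IntervalIntegrable (fun s : ℝ => linDrift α β lam (X s.toNNReal ω)
        (-A (X s.toNNReal ω).1) 0) volume 0 t :=
      Continuous.intervalIntegrable (by fun_prop) _ _
    have h2 : IntervalIntegrable (fun s : ℝ => ((0, F s.toNNReal ω, 0) : State d)) volume 0 t := by
      let J : Space d →L[ℝ] State d := (ContinuousLinearMap.inr ℝ _ _).comp
        (ContinuousLinearMap.inl ℝ _ _)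
      exact ⟨J.integrable_comp (hF t).1, J.integrable_comp (hF t).2⟩
    refine (h1.sub h2).congr fun s _ => ?_
    simp only [linDrift, Prod.mk_sub_mk, sub_zero]
    refine Prod.ext rfl (Prod.ext ?_ rfl)
    dsimp only; abel
  have hI2 : IntervalIntegrable (fun s : ℝ => (linDrift α β lam (X s.toNNReal ω)
      (-A (X s.toNNReal ω).1 - F s.toNNReal ω) 0).2) volume 0 t := by
    let J := ContinuousLinearMap.snd ℝ (Space d) (Space d × Space d)
    have h1 := J.integrable_comp hI.1
    have h2 := J.integrable_comp hI.2
    exact ⟨h1, h2⟩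
  refine ⟨hI, Prod.ext ?_ (Prod.ext ?_ ?_)⟩
  · rw [hq t, Prod.fst_add, Prod.fst_add, fst_intervalIntegral hI]
    simp only [noise, add_zero]
    rfl
  · rw [hp t, Prod.snd_add, Prod.fst_add, Prod.snd_add, Prod.fst_add, snd_intervalIntegral hI,
      fst_intervalIntegral hI2]
    simp only [noise, add_zero, linDrift]
    refine congrArg _ (intervalIntegral.integral_congr fun s _ => ?_)
    abel
  · rw [hz t, Prod.snd_add, Prod.snd_add, Prod.snd_add, Prod.snd_add, snd_intervalIntegral hI,
      snd_intervalIntegral hI2]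
    simp only [noise, add_zero, linDrift]

theorem lipschitzWith_conv {C_B : ℝ≥0} (hB : LipschitzWith C_B B) {μ : Measure (State d)}
    [IsProbabilityMeasure μ] (hint : ∀ q, Integrable (fun x : State d => B (q - x.1)) μ) :
    LipschitzWith C_B (conv B μ) := by
  refine LipschitzWith.of_dist_le_mul fun q q' => ?_
  rw [dist_eq_norm, conv, conv, ← integral_sub (hint q) (hint q')]
  refine (norm_integral_le_of_norm_le_const (C := C_B * dist q q')
    (ae_of_all _ fun x => ?_)).trans (by simp)
  rw [← dist_eq_norm]
  refine (hB.dist_le_mul _ _).trans_eq ?_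
  rw [dist_sub_right]

theorem norm_le_add_of_lipschitz {C : ℝ≥0} {f : Space d → Space d} (hf : LipschitzWith C f)
    (x : Space d) : ‖f x‖ ≤ C * ‖x‖ + ‖f 0‖ := by
  have h1 := hf.dist_le_mul x 0
  rw [dist_eq_norm, dist_zero_right] at h1
  have h2 := norm_add_le (f x - f 0) (f 0)
  rw [sub_add_cancel] at h2
  linarith

/-- The drift of the McKean–Vlasov equation when the law is `μ`. -/
noncomputable def mvDrift (α β lam : ℝ) (A B : Space d → Space d) (μ : Measure (State d))
    (x : State d) : State d :=
  linDrift α β lam x (-A x.1 - conv B μ x.1) 0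

/-- The position is changed first, under the law `μ`, and the law afterwards, at the fixed point
`y`. This separates Lipschitz dependence on the state from dependence on the law. -/
theorem norm_mvDrift_sub_le {C_A C_B : ℝ≥0} (hα : 0 ≤ α) (hβ : 0 ≤ β) (hlam : 0 ≤ lam)
    (hA : LipschitzWith C_A A) (hB : LipschitzWith C_B B) {μ ν : Measure (State d)}
    [IsProbabilityMeasure μ]
    (hint : ∀ q, Integrable (fun x : State d => B (q - x.1)) μ) (x y : State d) :
    ‖mvDrift α β lam A B μ x - mvDrift α β lam A B ν y‖
      ≤ (1 + β + 2 * lam + α + C_A + C_B) * ‖x - y‖ + ‖conv B μ y.1 - conv B ν y.1‖ := by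
  rw [mvDrift, mvDrift, linDrift_sub, sub_self]
  refine (norm_linDrift_le hα hβ hlam _ _ _).trans ?_
  have hx : ‖x.1 - y.1‖ ≤ ‖x - y‖ := norm_fst_le (x - y)
  have h1 := hA.dist_le_mul x.1 y.1
  have h2 := (lipschitzWith_conv hB hint).dist_le_mul x.1 y.1
  rw [dist_eq_norm, dist_eq_norm] at h1 h2
  have h3 : ‖-A x.1 - conv B μ x.1 - (-A y.1 - conv B ν y.1)‖
      ≤ ‖A x.1 - A y.1‖ + ‖conv B μ x.1 - conv B μ y.1‖ + ‖conv B μ y.1 - conv B ν y.1‖ := by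
    have : -A x.1 - conv B μ x.1 - (-A y.1 - conv B ν y.1) = -(A x.1 - A y.1)
      + -(conv B μ x.1 - conv B μ y.1) + -(conv B μ y.1 - conv B ν y.1) := by abel
    rw [this]
    refine norm_add₃_le.trans ?_
    simp only [norm_neg]; exact le_rfl
  have h4 : (C_A : ℝ) * ‖x.1 - y.1‖ ≤ C_A * ‖x - y‖ := by gcongr
  have h5 : (C_B : ℝ) * ‖x.1 - y.1‖ ≤ C_B * ‖x - y‖ := by gcongr
  rw [norm_zero]
  linarith

theorem norm_mvDrift_le {C_A C_B : ℝ≥0} (hα : 0 ≤ α) (hβ : 0 ≤ β) (hlam : 0 ≤ lam)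
    (hA : LipschitzWith C_A A) (hB : LipschitzWith C_B B) {μ : Measure (State d)}
    [IsProbabilityMeasure μ]
    (hint : ∀ q, Integrable (fun x : State d => B (q - x.1)) μ) (x : State d) :
    ‖mvDrift α β lam A B μ x‖
      ≤ (1 + β + 2 * lam + α + C_A + C_B) * ‖x‖ + (‖A 0‖ + ‖conv B μ 0‖) := by
  refine (norm_linDrift_le hα hβ hlam _ _ _).trans ?_
  have hx : ‖x.1‖ ≤ ‖x‖ := norm_fst_le x
  have h1 := norm_le_add_of_lipschitz hA x.1
  have h2 := norm_le_add_of_lipschitz (lipschitzWith_conv hB hint) x.1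
  have h3 := norm_sub_le (-A x.1) (conv B μ x.1)
  rw [norm_neg] at h3
  have h4 : (C_A : ℝ) * ‖x.1‖ ≤ C_A * ‖x‖ := by gcongr
  have h5 : (C_B : ℝ) * ‖x.1‖ ≤ C_B * ‖x‖ := by gcongr
  rw [norm_zero]
  linarith

end Paths

/-! ### First moments and time regularity of McKean–Vlasov solutions. -/

section McKeanVlasov

open Filter Topology Set

variable {Ω : Type*} [MeasurableSpace Ω] {P : Measure Ω} {d : ℕ}
  {α β lam : ℝ} {A B : Space d → Space d} {C_A C_B : ℝ≥0} {W : ℝ≥0 → Ω → Space d}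
  {X₀ : Ω → State d} {Y : ℝ≥0 → Ω → State d}

theorem IsMcKeanVlasov.isProbabilityMeasure_map [IsProbabilityMeasure P]
    (hY : IsMcKeanVlasov α β lam A B P W X₀ Y)
    (t : ℝ≥0) : IsProbabilityMeasure (P.map (Y t)) :=
  Measure.isProbabilityMeasure_map (hY.2.measurable t).aemeasurable

theorem IsMcKeanVlasov.eq_integral (hY : IsMcKeanVlasov α β lam A B P W X₀ Y)
    (hA : Continuous A) :
    ∀ᵐ ω ∂P, ∀ t : ℝ≥0,
      IntervalIntegrable (fun s : ℝ => mvDrift α β lam A B (P.map (Y s.toNNReal))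
        (Y s.toNNReal ω)) volume 0 t ∧
      Y t ω = X₀ ω + (∫ s in (0 : ℝ)..t, mvDrift α β lam A B (P.map (Y s.toNNReal))
        (Y s.toNNReal ω)) + noise (W t ω) :=
  hY.2.eq_integral hA

theorem IsMcKeanVlasov.conv_eq (hY : IsMcKeanVlasov α β lam A B P W X₀ Y) (hB : Continuous B)
    (t : ℝ≥0) (q : Space d) : conv B (P.map (Y t)) q = ∫ ω, B (q - (Y t ω).1) ∂P := by
  rw [conv, integral_map (hY.2.measurable t).aemeasurable]
  exact Continuous.aestronglyMeasurable (by fun_prop)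

variable [IsProbabilityMeasure P]

/-- No moment of `Y` is controlled yet, so integrability is drawn from the equation: along a single
good path, the force `B ∗ μ_s` at `Y s ω` is integrable in time. The Lipschitz bound moves the
evaluation point to `0` at the price of a continuous function of `s`. -/
theorem IsMcKeanVlasov.intervalIntegrable_conv_zero (hY : IsMcKeanVlasov α β lam A B P W X₀ Y)
    (hB : LipschitzWith C_B B) (T : ℝ≥0) :
    IntervalIntegrable (fun s : ℝ => conv B (P.map (Y s.toNNReal)) 0) volume 0 T := by
  obtain ⟨ω, hc, hF⟩ := (hY.2.continuous.and hY.2.integrable_force).exists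
  have hc' : Continuous fun s : ℝ => Y s.toNNReal ω := hc.comp continuous_real_toNNReal
  have hg : IntervalIntegrable (fun s : ℝ => C_B * ‖(Y s.toNNReal ω).1‖) volume 0 T :=
    Continuous.intervalIntegrable (by fun_prop) _ _
  refine ((hF T).norm.add hg).mono_fun ?_ (ae_of_all _ fun s => ?_)
  · simp_rw [hY.conv_eq hB.continuous]
    have hm := aemeasurable_uncurry_toNNReal (P := P) hY.2.measurable hY.2.continuous
      (volume.restrict (uIoc 0 (T : ℝ)))
    have hm' : AEStronglyMeasurable (fun p : ℝ × Ω => B (0 - (Y p.1.toNNReal p.2).1))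
        ((volume.restrict (uIoc 0 (T : ℝ))).prod P) :=
      (hB.continuous.comp (continuous_const.sub continuous_fst)).comp_aestronglyMeasurable
        hm.aestronglyMeasurable
    exact hm'.integral_prod_right'
  · have := hY.isProbabilityMeasure_map s.toNNReal
    have h := (lipschitzWith_conv hB (hY.1 s.toNNReal)).dist_le_mul 0 (Y s.toNNReal ω).1
    rw [dist_eq_norm, dist_zero_left] at h
    have h2 := norm_add_le (conv B (P.map (Y s.toNNReal)) 0
      - conv B (P.map (Y s.toNNReal)) (Y s.toNNReal ω).1)
      (conv B (P.map (Y s.toNNReal)) (Y s.toNNReal ω).1)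
    rw [sub_add_cancel] at h2
    dsimp only
    rw [Real.norm_of_nonneg (by positivity)]
    linarith

/-- First moments of a McKean–Vlasov solution are bounded on bounded time intervals. -/
theorem IsMcKeanVlasov.exists_lintegral_le (hα : 0 ≤ α) (hβ : 0 ≤ β) (hlam : 0 ≤ lam)
    (hA : LipschitzWith C_A A) (hB : LipschitzWith C_B B) (hW : IsBrownian W P)
    (hX₀ : Integrable X₀ P) (hY : IsMcKeanVlasov α β lam A B P W X₀ Y) (T : ℝ≥0) :
    ∃ M : ℝ≥0, ∀ t ≤ T, ∫⁻ ω, ‖Y t ω‖ₑ ∂P ≤ M := by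
  set L : ℝ := 1 + β + 2 * lam + α + C_A + C_B
  have hL : 0 ≤ L := by positivity
  set G : ℝ := ∫ s in (0 : ℝ)..T, (‖A 0‖ + ‖conv B (P.map (Y s.toNNReal)) 0‖) with hG
  have hg : IntervalIntegrable (fun s : ℝ => ‖A 0‖ + ‖conv B (P.map (Y s.toNNReal)) 0‖)
    volume 0 T := intervalIntegrable_const.add (hY.intervalIntegrable_conv_zero hB T).norm
  -- Grönwall is applied path by path to `Y - noise W`. The law enters only through the
  -- deterministic number `G`, so the resulting bound is integrable in `ω` without prior moment
  -- information on `Y`.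
  have hpath : ∀ᵐ ω ∂P, ∀ t ≤ T, ‖Y t ω‖ ≤ (‖X₀ ω‖ + L * √2 * (∫ s in (0 : ℝ)..T,
      ‖W s.toNNReal ω‖) + G) * Real.exp (L * T) + √2 * ‖W t ω‖ := by
    filter_upwards [hY.eq_integral hA.continuous, hY.2.continuous, hW.continuous]
      with ω heq hYc hWc
    have hYc' : Continuous fun s : ℝ => Y s.toNNReal ω := hYc.comp continuous_real_toNNReal
    have hWc' : Continuous fun s : ℝ => W s.toNNReal ω := hWc.comp continuous_real_toNNReal
    set φ : ℝ → ℝ := fun s => ‖Y s.toNNReal ω - noise (W s.toNNReal ω)‖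
    have hφ : Continuous φ := by fun_prop
    set a : ℝ := ‖X₀ ω‖ + L * √2 * (∫ s in (0 : ℝ)..T, ‖W s.toNNReal ω‖) + G
    have hYφ : ∀ s : ℝ, ‖Y s.toNNReal ω‖ ≤ φ s + √2 * ‖W s.toNNReal ω‖ := fun s => by
      rw [← norm_noise]
      simpa using norm_add_le (Y s.toNNReal ω - noise (W s.toNNReal ω)) (noise (W s.toNNReal ω))
    have hgr : ∀ t ∈ Icc (0 : ℝ) T, φ t ≤ a + L * ∫ s in (0 : ℝ)..t, φ s := by
      intro t ht
      obtain ⟨-, h2⟩ := heq t.toNNReal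
      rw [Real.coe_toNNReal t ht.1] at h2
      have hsub : uIcc (0 : ℝ) t ⊆ uIcc (0 : ℝ) T := by
        rw [uIcc_of_le ht.1, uIcc_of_le (NNReal.coe_nonneg T)]; exact Icc_subset_Icc_right ht.2
      have hgt := hg.mono_set hsub
      have hφi : IntervalIntegrable φ volume 0 t := hφ.intervalIntegrable _ _
      have hWi : ∀ b : ℝ, IntervalIntegrable (fun s : ℝ => ‖W s.toNNReal ω‖) volume 0 b :=
        fun b => hWc'.norm.intervalIntegrable _ _
      have hbound : IntervalIntegrable (fun s : ℝ => L * φ s + L * √2 * ‖W s.toNNReal ω‖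
          + (‖A 0‖ + ‖conv B (P.map (Y s.toNNReal)) 0‖)) volume 0 t :=
        ((hφi.const_mul L).add ((hWi t).const_mul _)).add hgt
      have hn : ‖∫ s in (0 : ℝ)..t, mvDrift α β lam A B (P.map (Y s.toNNReal))
          (Y s.toNNReal ω)‖ ≤ ∫ s in (0 : ℝ)..t, (L * φ s + L * √2 * ‖W s.toNNReal ω‖
          + (‖A 0‖ + ‖conv B (P.map (Y s.toNNReal)) 0‖)) := by
        refine intervalIntegral.norm_integral_le_of_norm_le ht.1 (ae_of_all _ fun s _ => ?_) hbound
        have := hY.isProbabilityMeasure_map s.toNNReal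
        refine (norm_mvDrift_le hα hβ hlam hA hB (hY.1 s.toNNReal) _).trans ?_
        have := mul_le_mul_of_nonneg_left (hYφ s) hL
        linarith
      rw [intervalIntegral.integral_add ((hφi.const_mul L).add ((hWi t).const_mul _)) hgt,
        intervalIntegral.integral_add (hφi.const_mul L) ((hWi t).const_mul _),
        intervalIntegral.integral_const_mul, intervalIntegral.integral_const_mul] at hn
      have m1 : ∫ s in (0 : ℝ)..t, ‖W s.toNNReal ω‖ ≤ ∫ s in (0 : ℝ)..T, ‖W s.toNNReal ω‖ :=
        intervalIntegral.integral_mono_interval le_rfl ht.1 ht.2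
          (ae_of_all _ fun _ => norm_nonneg _) (hWi T)
      have m2 : ∫ s in (0 : ℝ)..t, (‖A 0‖ + ‖conv B (P.map (Y s.toNNReal)) 0‖) ≤ G :=
        intervalIntegral.integral_mono_interval le_rfl ht.1 ht.2
          (ae_of_all _ fun _ => by positivity) hg
      have m3 := mul_le_mul_of_nonneg_left m1 (by positivity : 0 ≤ L * √2)
      have hφe : φ t ≤ ‖X₀ ω‖ + ‖∫ s in (0 : ℝ)..t, mvDrift α β lam A B (P.map (Y s.toNNReal))
          (Y s.toNNReal ω)‖ := by
        simp only [φ]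
        rw [h2, add_sub_cancel_right]
        exact norm_add_le _ _
      simp only [a]
      linarith
    intro t ht
    have h1 := le_mul_exp_of_le_add_integral hL hφ hgr (t := t) ⟨t.2, ht⟩
    have h2 := hYφ t
    rw [Real.toNNReal_coe] at h2
    have ha : 0 ≤ a := by
      have i1 : 0 ≤ ∫ s in (0 : ℝ)..T, ‖W s.toNNReal ω‖ :=
        intervalIntegral.integral_nonneg T.2 fun _ _ => norm_nonneg _
      have i2 : 0 ≤ G := intervalIntegral.integral_nonneg T.2 fun _ _ => by positivity
      simp only [a]; positivity
    have h3 : a * Real.exp (L * t) ≤ a * Real.exp (L * T) := by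
      gcongr
    linarith
  have hWE : ∀ t ≤ T, ∫⁻ ω, ‖W t ω‖ₑ ∂P ≤ ENNReal.ofReal √(d * T) := by
    intro t ht
    have h1 := hW.lintegral_sub_le t 0
    have h2 : ∫⁻ ω, ‖W t ω‖ₑ ∂P = ∫⁻ ω, ‖W t ω - W 0 ω‖ₑ ∂P := by
      refine lintegral_congr_ae ?_
      filter_upwards [hW.eval_zero] with ω hω
      rw [hω, sub_zero]
    rw [h2]
    refine h1.trans (ENNReal.ofReal_le_ofReal (Real.sqrt_le_sqrt ?_))
    simp only [NNReal.coe_zero, sub_zero, NNReal.abs_eq]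
    gcongr
  have hWI : ∫⁻ ω, ‖∫ s in (0 : ℝ)..T, ‖W s.toNNReal ω‖‖ₑ ∂P
      ≤ ENNReal.ofReal √(d * T) * ENNReal.ofReal (T - 0) := by
    refine lintegral_enorm_intervalIntegral_le T.2
      (aemeasurable_uncurry_toNNReal hW.measurable hW.continuous _).norm fun s hs => ?_
    simp_rw [enorm_norm]
    exact hWE _ (Real.toNNReal_le_iff_le_coe.2 hs.2)
  have hX : ∫⁻ ω, ‖X₀ ω‖ₑ ∂P < ∞ := hX₀.2
  set M : ℝ≥0∞ := (∫⁻ ω, ‖X₀ ω‖ₑ ∂P + ENNReal.ofReal (L * √2) * (ENNReal.ofReal √(d * T)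
    * ENNReal.ofReal (T - 0)) + ‖G‖ₑ) * ENNReal.ofReal (Real.exp (L * T))
    + ENNReal.ofReal √2 * ENNReal.ofReal √(d * T) with hM
  have hMtop : M ≠ ∞ := by
    refine ENNReal.add_ne_top.2 ⟨ENNReal.mul_ne_top (ENNReal.add_ne_top.2
      ⟨ENNReal.add_ne_top.2 ⟨hX.ne, ?_⟩, enorm_ne_top⟩) ENNReal.ofReal_ne_top, ?_⟩
    · finiteness
    · finiteness
  refine ⟨M.toNNReal, fun t ht => ?_⟩
  rw [ENNReal.coe_toNNReal hMtop]
  have hmI : AEMeasurable (fun ω => ∫ s in (0 : ℝ)..T, ‖W s.toNNReal ω‖) P := by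
    have hm := (aemeasurable_uncurry_toNNReal hW.measurable hW.continuous
      (volume.restrict (Ioc 0 (T : ℝ)))).norm
    have := (hm.aestronglyMeasurable.prod_swap).integral_prod_right'
    refine this.aemeasurable.congr (ae_of_all _ fun ω => ?_)
    exact (intervalIntegral.integral_of_le (NNReal.coe_nonneg T)).symm
  have hmX : AEMeasurable (fun ω => ‖X₀ ω‖ₑ) P := hX₀.1.enorm
  calc ∫⁻ ω, ‖Y t ω‖ₑ ∂P
      ≤ ∫⁻ ω, ((‖X₀ ω‖ₑ + ENNReal.ofReal (L * √2) * ‖∫ s in (0 : ℝ)..T, ‖W s.toNNReal ω‖‖ₑ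
          + ‖G‖ₑ) * ENNReal.ofReal (Real.exp (L * T)) + ENNReal.ofReal √2 * ‖W t ω‖ₑ) ∂P := by
        refine lintegral_mono_ae ?_
        filter_upwards [hpath] with ω hω
        have i1 : 0 ≤ ∫ s in (0 : ℝ)..T, ‖W s.toNNReal ω‖ :=
          intervalIntegral.integral_nonneg T.2 fun _ _ => norm_nonneg _
        have i2 : 0 ≤ G := intervalIntegral.integral_nonneg T.2 fun _ _ => by positivity
        rw [← ofReal_norm (Y t ω), ← ofReal_norm (X₀ ω), ← ofReal_norm (W t ω),
          Real.enorm_of_nonneg i1, Real.enorm_of_nonneg i2, ← ENNReal.ofReal_mul (by positivity),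
          ← ENNReal.ofReal_add (by positivity) (by positivity),
          ← ENNReal.ofReal_add (by positivity) (by positivity),
          ← ENNReal.ofReal_mul (by positivity), ← ENNReal.ofReal_mul (by positivity),
          ← ENNReal.ofReal_add (by positivity) (by positivity)]
        exact ENNReal.ofReal_le_ofReal (hω t ht)
    _ ≤ M := by
        rw [lintegral_add_right _ ((hW.measurable t).enorm.const_mul _),
          lintegral_mul_const' _ _ ENNReal.ofReal_ne_top, lintegral_add_right _ measurable_const,
          lintegral_add_left' hmX, lintegral_const_mul' _ _ ENNReal.ofReal_ne_top,
          lintegral_const_mul' _ _ ENNReal.ofReal_ne_top, lintegral_const, measure_univ, mul_one]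
        refine add_le_add ?_ (mul_le_mul_right (hWE t ht) _)
        refine mul_le_mul_left (add_le_add (add_le_add le_rfl (mul_le_mul_right hWI _)) le_rfl) _

theorem IsMcKeanVlasov.integrable (hα : 0 ≤ α) (hβ : 0 ≤ β) (hlam : 0 ≤ lam)
    (hA : LipschitzWith C_A A) (hB : LipschitzWith C_B B) (hW : IsBrownian W P)
    (hX₀ : Integrable X₀ P) (hY : IsMcKeanVlasov α β lam A B P W X₀ Y) (t : ℝ≥0) :
    Integrable (Y t) P := by
  obtain ⟨M, hM⟩ := hY.exists_lintegral_le hα hβ hlam hA hB hW hX₀ t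
  exact ⟨(hY.2.measurable t).aestronglyMeasurable, (hM t le_rfl).trans_lt ENNReal.coe_lt_top⟩

/-- The pair `(U, V)` is a coupling of the two laws and `B` is Lipschitz, so the difference of the
forces is at most `C_B` times the cost of this coupling. -/
theorem enorm_conv_map_sub_le (hB : LipschitzWith C_B B) {U V : Ω → State d}
    (hU : Integrable U P) (hV : Integrable V P) (q : Space d) :
    ‖conv B (P.map U) q - conv B (P.map V) q‖ₑ ≤ C_B * ∫⁻ ω, ‖U ω - V ω‖ₑ ∂P := by
  have key : ∀ {U : Ω → State d}, Integrable U P →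
      conv B (P.map U) q = ∫ ω, B (q - (U ω).1) ∂P ∧ Integrable (fun ω => B (q - (U ω).1)) P := by
    intro U hU
    have hc : Continuous fun x : State d => B (q - x.1) := by
      have := hB.continuous; fun_prop
    refine ⟨by rw [conv, integral_map hU.aemeasurable hc.aestronglyMeasurable], ?_⟩
    have hb : Integrable (fun ω => (C_B : ℝ) * (‖q‖ + ‖U ω‖) + ‖B 0‖) P :=
      ((((integrable_const ‖q‖).add hU.norm).const_mul (C_B : ℝ))).add (integrable_const ‖B 0‖)
    refine Integrable.mono' hb
      (hc.comp_aestronglyMeasurable hU.1) (ae_of_all _ fun ω => ?_)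
    refine (norm_le_add_of_lipschitz hB _).trans ?_
    gcongr
    refine (norm_sub_le _ _).trans ?_
    gcongr
    exact norm_fst_le _
  rw [(key hU).1, (key hV).1, ← integral_sub (key hU).2 (key hV).2]
  refine (enorm_integral_le_lintegral_enorm _).trans ?_
  rw [← lintegral_const_mul' _ _ ENNReal.coe_ne_top]
  refine lintegral_mono fun ω => ?_
  have h := hB (q - (U ω).1) (q - (V ω).1)
  rw [edist_eq_enorm_sub, edist_eq_enorm_sub] at h
  refine h.trans ?_
  gcongr
  rw [sub_sub_sub_cancel_left, ← enorm_neg, neg_sub]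
  rw [← ofReal_norm, ← ofReal_norm]
  exact ENNReal.ofReal_le_ofReal (norm_fst_le (U ω - V ω))

/-- Over a time `t - s` the drift contributes `O(t - s)` in mean, by the first moment bound, and the
Brownian increment `O(√(t - s))`. This Hölder regularity sets the accuracy of the Euler scheme. -/
theorem IsMcKeanVlasov.exists_lintegral_sub_le (hα : 0 ≤ α) (hβ : 0 ≤ β) (hlam : 0 ≤ lam)
    (hA : LipschitzWith C_A A) (hB : LipschitzWith C_B B) (hW : IsBrownian W P)
    (hX₀ : Integrable X₀ P) (hY : IsMcKeanVlasov α β lam A B P W X₀ Y) (T : ℝ≥0) :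
    ∃ K : ℝ≥0, ∀ s ≤ T, ∀ t ≤ T,
      ∫⁻ ω, ‖Y s ω - Y t ω‖ₑ ∂P ≤ ENNReal.ofReal (K * √|(s : ℝ) - t|) := by
  obtain ⟨M, hM⟩ := hY.exists_lintegral_le hα hβ hlam hA hB hW hX₀ T
  obtain ⟨L, hL⟩ : ∃ L : ℝ≥0, (L : ℝ) = 1 + β + 2 * lam + α + C_A + C_B :=
    ⟨⟨1 + β + 2 * lam + α + C_A + C_B, by positivity⟩, rfl⟩
  set c : ℝ≥0 := ‖A 0‖₊ + (C_B * M + ‖B 0‖₊) with hc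
  have hconv : ∀ t ≤ T, ‖conv B (P.map (Y t)) 0‖ ≤ C_B * M + ‖B 0‖ := by
    intro t ht
    have h1 := enorm_conv_map_sub_le hB (hY.integrable hα hβ hlam hA hB hW hX₀ t)
      (V := fun _ : Ω => (0 : State d)) (integrable_zero Ω (State d) P) 0
    have h2 : conv B (P.map fun _ : Ω => (0 : State d)) 0 = B 0 := by
      simp [conv, Measure.map_const]
    rw [h2] at h1
    simp only [sub_zero] at h1
    have h3 : ‖conv B (P.map (Y t)) 0 - B 0‖ₑ ≤ ((C_B * M : ℝ≥0) : ℝ≥0∞) := by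
      rw [ENNReal.coe_mul]
      exact h1.trans (by gcongr; exact hM t ht)
    rw [enorm_le_coe, ← NNReal.coe_le_coe, coe_nnnorm, NNReal.coe_mul] at h3
    have h4 := norm_add_le (conv B (P.map (Y t)) 0 - B 0) (B 0)
    rw [sub_add_cancel] at h4
    linarith
  have hstep : ∀ s t : ℝ≥0, s ≤ t → t ≤ T → ∫⁻ ω, ‖Y s ω - Y t ω‖ₑ ∂P
      ≤ ENNReal.ofReal (((L * M + c) * NNReal.sqrt T + NNReal.sqrt 2 * NNReal.sqrt d : ℝ≥0)
        * √|(s : ℝ) - t|) := by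
    intro s t hst htT
    have hst' : (s : ℝ) ≤ t := hst
    have hpath : ∀ᵐ ω ∂P, ‖Y s ω - Y t ω‖ₑ ≤ ‖∫ r in (s : ℝ)..t, ((L : ℝ) * ‖Y r.toNNReal ω‖ + c)‖ₑ
        + ENNReal.ofReal √2 * ‖W s ω - W t ω‖ₑ := by
      filter_upwards [hY.eq_integral hA.continuous, hY.2.continuous] with ω heq hYc
      have hYc' : Continuous fun s : ℝ => Y s.toNNReal ω := hYc.comp continuous_real_toNNReal
      obtain ⟨i1, e1⟩ := heq s
      obtain ⟨i2, e2⟩ := heq t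
      have e3 : Y s ω - Y t ω = -(∫ r in (s : ℝ)..t, mvDrift α β lam A B (P.map (Y r.toNNReal))
          (Y r.toNNReal ω)) + noise (W s ω - W t ω) := by
        rw [e1, e2, ← noise_sub, ← intervalIntegral.integral_interval_sub_left i2 i1]
        abel
      have hb : ‖∫ r in (s : ℝ)..t, mvDrift α β lam A B (P.map (Y r.toNNReal)) (Y r.toNNReal ω)‖
          ≤ ∫ r in (s : ℝ)..t, ((L : ℝ) * ‖Y r.toNNReal ω‖ + c) := by
        refine intervalIntegral.norm_integral_le_of_norm_le hst' (ae_of_all _ fun r hr => ?_)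
          (Continuous.intervalIntegrable (by fun_prop) _ _)
        have := hY.isProbabilityMeasure_map r.toNNReal
        refine (norm_mvDrift_le hα hβ hlam hA hB (hY.1 r.toNNReal) _).trans ?_
        have hr' : r.toNNReal ≤ T := (Real.toNNReal_le_iff_le_coe.2 hr.2).trans htT
        have := hconv _ hr'
        simp only [hL, hc, NNReal.coe_add, coe_nnnorm, NNReal.coe_mul]
        linarith
      rw [e3]
      refine (enorm_add_le _ _).trans ?_
      rw [enorm_neg, ← ofReal_norm (noise _), norm_noise, ENNReal.ofReal_mul (by positivity),
        ofReal_norm]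
      gcongr
      rw [← ofReal_norm, Real.enorm_of_nonneg ((norm_nonneg _).trans hb)]
      exact ENNReal.ofReal_le_ofReal hb
    have hint : ∫⁻ ω, ‖∫ r in (s : ℝ)..t, ((L : ℝ) * ‖Y r.toNNReal ω‖ + c)‖ₑ ∂P
        ≤ (L * M + c : ℝ≥0) * ENNReal.ofReal (t - s) := by
      refine lintegral_enorm_intervalIntegral_le hst'
        (((aemeasurable_uncurry_toNNReal hY.2.measurable hY.2.continuous _).norm.const_mul _).add_const _)
        fun r hr => ?_
      have hr' : r.toNNReal ≤ T := (Real.toNNReal_le_iff_le_coe.2 hr.2).trans htT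
      have : ∀ ω, ‖(L : ℝ) * ‖Y r.toNNReal ω‖ + c‖ₑ = L * ‖Y r.toNNReal ω‖ₑ + c := fun ω => by
        rw [Real.enorm_of_nonneg (by positivity), ENNReal.ofReal_add (by positivity) (by positivity),
          ENNReal.ofReal_mul (by positivity), ofReal_norm]
        simp
      simp_rw [this]
      rw [lintegral_add_right _ measurable_const, lintegral_const_mul' _ _ ENNReal.coe_ne_top,
        lintegral_const, measure_univ, mul_one]
      push_cast
      gcongr
      exact hM _ hr'
    calc ∫⁻ ω, ‖Y s ω - Y t ω‖ₑ ∂P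
        ≤ ∫⁻ ω, (‖∫ r in (s : ℝ)..t, ((L : ℝ) * ‖Y r.toNNReal ω‖ + c)‖ₑ
        + ENNReal.ofReal √2 * ‖W s ω - W t ω‖ₑ) ∂P := lintegral_mono_ae hpath
      _ ≤ (L * M + c : ℝ≥0) * ENNReal.ofReal (t - s)
          + ENNReal.ofReal √2 * ENNReal.ofReal √(d * |(s : ℝ) - t|) := by
        have hm : Measurable fun ω => ENNReal.ofReal √2 * ‖W s ω - W t ω‖ₑ :=
          ((hW.measurable s).sub (hW.measurable t)).enorm.const_mul _
        rw [lintegral_add_right _ hm,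
          lintegral_const_mul' _ _ ENNReal.ofReal_ne_top]
        gcongr
        exact hW.lintegral_sub_le s t
      _ ≤ _ := by
        rw [← ENNReal.ofReal_coe_nnreal, ← ENNReal.ofReal_mul (by positivity),
          ← ENNReal.ofReal_mul (by positivity), ← ENNReal.ofReal_add
            (mul_nonneg (NNReal.coe_nonneg _) (by linarith)) (by positivity)]
        refine ENNReal.ofReal_le_ofReal ?_
        have habs : |(s : ℝ) - t| = t - s := by
          rw [abs_sub_comm, abs_of_nonneg (by linarith)]
        -- Puts the drift contribution on the same scale as the Brownian one.
        have hts : (t : ℝ) - s ≤ √T * √(t - s) := by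
          rw [← Real.sqrt_mul (NNReal.coe_nonneg T)]
          refine Real.le_sqrt_of_sq_le ?_
          rw [sq]
          have : (t : ℝ) ≤ T := htT
          have := NNReal.coe_nonneg s
          gcongr
          linarith
        rw [habs, Real.sqrt_mul (by positivity)]
        push_cast
        have := mul_le_mul_of_nonneg_left hts (by positivity : 0 ≤ (L : ℝ) * M + c)
        nlinarith
  refine ⟨(L * M + c) * NNReal.sqrt T + NNReal.sqrt 2 * NNReal.sqrt d, fun s hs t ht => ?_⟩
  rcases le_total s t with hst | hst
  · exact hstep s t hst ht
  · have h := hstep t s hst hs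
    rw [abs_sub_comm] at h
    refine le_trans (le_of_eq (lintegral_congr fun ω => ?_)) h
    rw [← enorm_neg, neg_sub]

/-- Lipschitz in `q` uniformly in time, and continuous in time because `Y` is continuous in mean;
together these give joint continuity. The drift along a path is then continuous, so the integral
equations can be differentiated. -/
theorem IsMcKeanVlasov.continuous_conv (hα : 0 ≤ α) (hβ : 0 ≤ β) (hlam : 0 ≤ lam)
    (hA : LipschitzWith C_A A) (hB : LipschitzWith C_B B) (hW : IsBrownian W P)
    (hX₀ : Integrable X₀ P) (hY : IsMcKeanVlasov α β lam A B P W X₀ Y) :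
    Continuous fun p : Space d × ℝ≥0 => conv B (P.map (Y p.2)) p.1 := by
  have hlip : ∀ t, LipschitzWith C_B (conv B (P.map (Y t))) := fun t => by
    have := hY.isProbabilityMeasure_map t
    exact lipschitzWith_conv hB (hY.1 t)
  have h1 : Continuous fun p : ℝ≥0 × Space d => conv B (P.map (Y p.1)) p.2 := by
    refine continuous_prod_of_continuous_lipschitzWith'
      (fun p : ℝ≥0 × Space d => conv B (P.map (Y p.1)) p.2) C_B
      hlip (fun q => ?_)
    rw [continuous_iff_continuousAt]
    intro t
    obtain ⟨K, hK⟩ := hY.exists_lintegral_sub_le hα hβ hlam hA hB hW hX₀ (t + 1)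
    rw [ContinuousAt, tendsto_iff_norm_sub_tendsto_zero]
    have hlim : Tendsto (fun s : ℝ≥0 => (C_B : ℝ) * (K * √|(s : ℝ) - t|)) (𝓝 t) (𝓝 0) := by
      have : Continuous fun s : ℝ≥0 => (C_B : ℝ) * (K * √|(s : ℝ) - t|) := by fun_prop
      simpa using this.tendsto t
    refine squeeze_zero' (Eventually.of_forall fun _ => norm_nonneg _) ?_ hlim
    filter_upwards [Iio_mem_nhds (lt_add_one t)] with s hs
    have h2 := enorm_conv_map_sub_le hB (hY.integrable hα hβ hlam hA hB hW hX₀ s)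
      (hY.integrable hα hβ hlam hA hB hW hX₀ t) q
    have h3 : ‖conv B (P.map (Y s)) q - conv B (P.map (Y t)) q‖ₑ
        ≤ ENNReal.ofReal (C_B * (K * √|(s : ℝ) - t|)) := by
      rw [ENNReal.ofReal_mul (NNReal.coe_nonneg C_B), ENNReal.ofReal_coe_nnreal]
      refine h2.trans ?_
      gcongr
      exact hK s (le_of_lt hs) t (by simp)
    rw [← ofReal_norm, ENNReal.ofReal_le_ofReal_iff (by positivity)] at h3
    exact h3
  exact h1.comp (continuous_snd.prodMk continuous_fst)

end McKeanVlasov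

/-! ### The Euler scheme as a function of the input. -/

section Euler

open Filter Topology Set

variable {d : ℕ}

/-- The explicit Euler scheme with step `h` for `dX = b(t, X) dt + √2 dW` in the memory variable,
as a function of the initial state and of the driving path. -/
noncomputable def euler (b : ℝ≥0 → State d → State d) (h : ℝ≥0)
    (ξ : State d × (ℝ≥0 → Space d)) : ℕ → State d
  | 0 => ξ.1 + noise (ξ.2 0)
  | k + 1 => euler b h ξ k + (h : ℝ) • b (k * h) (euler b h ξ k)
      + noise (ξ.2 ((k + 1) * h) - ξ.2 (k * h))

theorem measurable_euler {b : ℝ≥0 → State d → State d} (hb : ∀ t, Continuous (b t)) (h : ℝ≥0)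
    (k : ℕ) : Measurable fun ξ => euler b h ξ k := by
  induction k with
  | zero =>
    exact measurable_fst.add (continuous_noise.measurable.comp
      ((measurable_pi_apply 0).comp measurable_snd))
  | succ k ih =>
    refine (ih.add (((hb _).measurable.comp ih).const_smul (h : ℝ))).add
      (continuous_noise.measurable.comp ?_)
    exact ((measurable_pi_apply _).comp measurable_snd).sub
      ((measurable_pi_apply _).comp measurable_snd)

/-- A discrete Grönwall inequality in a weighted norm. The noise is common and cancels; a source `δ
e^{θt}` growing faster than the rate `L` is only divided by `θ - L`. A large `θ` therefore makes the
dependence on the drift a contraction. -/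
theorem norm_euler_sub_le {b b' : ℝ≥0 → State d → State d} {L θ δ : ℝ} (hL : 0 ≤ L) (hθ : L < θ)
    (hδ : 0 ≤ δ) {T : ℝ≥0}
    (hb : ∀ t ≤ T, ∀ x y, ‖b t x - b' t y‖ ≤ L * ‖x - y‖ + δ * Real.exp (θ * t)) (h : ℝ≥0)
    (ξ : State d × (ℝ≥0 → Space d)) (k : ℕ) (hk : k * h ≤ T) :
    ‖euler b h ξ k - euler b' h ξ k‖ ≤ δ / (θ - L) * Real.exp (θ * (k * h : ℝ≥0)) := by
  have hθL : 0 < θ - L := sub_pos.2 hθ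
  induction k with
  | zero => simp [euler]; positivity
  | succ k ih =>
    have hk' : (k : ℝ≥0) * h ≤ T := le_trans (by push_cast; gcongr; simp) hk
    set e := Real.exp (θ * ((k : ℝ≥0) * h : ℝ≥0)) with he
    have h1 : euler b h ξ (k + 1) - euler b' h ξ (k + 1) = (euler b h ξ k - euler b' h ξ k)
        + (h : ℝ) • (b (k * h) (euler b h ξ k) - b' (k * h) (euler b' h ξ k)) := by
      simp only [euler, smul_sub]; abel
    have h2 := ih hk'
    have h3 := hb _ hk' (euler b h ξ k) (euler b' h ξ k)
    have hexp : Real.exp (θ * (((k + 1 : ℕ) : ℝ≥0) * h : ℝ≥0)) = e * Real.exp (θ * h) := by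
      rw [he, ← Real.exp_add]; push_cast; ring_nf
    rw [h1, hexp]
    refine (norm_add_le _ _).trans ?_
    rw [norm_smul, Real.norm_of_nonneg (NNReal.coe_nonneg h)]
    have h4 : (h : ℝ) * ‖b (k * h) (euler b h ξ k) - b' (k * h) (euler b' h ξ k)‖
        ≤ h * (L * (δ / (θ - L) * e) + δ * e) := by
      gcongr
      exact h3.trans (by gcongr)
    have h5 : δ / (θ - L) * e + h * (L * (δ / (θ - L) * e) + δ * e)
        = δ / (θ - L) * (e * (1 + θ * h)) := by
      field_simp; ring
    have h6 : 1 + θ * h ≤ Real.exp (θ * h) := by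
      have := Real.add_one_le_exp (θ * h); linarith
    calc _ ≤ δ / (θ - L) * e + h * (L * (δ / (θ - L) * e) + δ * e) := add_le_add h2 h4
      _ = δ / (θ - L) * (e * (1 + θ * h)) := h5
      _ ≤ _ := by gcongr

end Euler

/-! ### Convergence in mean of the Euler scheme. -/

section Convergence

open Filter Topology Set

variable {Ω : Type*} [MeasurableSpace Ω] {P : Measure Ω} [IsProbabilityMeasure P] {d : ℕ}
  {α β lam : ℝ} {A B : Space d → Space d} {C_A C_B : ℝ≥0} {W W' : ℝ≥0 → Ω → Space d}
  {X₀ X₀' : Ω → State d} {Y Y' : ℝ≥0 → Ω → State d}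

theorem IsMcKeanVlasov.continuous_mvDrift (hα : 0 ≤ α) (hβ : 0 ≤ β) (hlam : 0 ≤ lam)
    (hA : LipschitzWith C_A A) (hB : LipschitzWith C_B B) (hW : IsBrownian W P)
    (hX₀ : Integrable X₀ P) (hY : IsMcKeanVlasov α β lam A B P W X₀ Y) :
    Continuous fun p : State d × ℝ≥0 => mvDrift α β lam A B (P.map (Y p.2)) p.1 := by
  have h1 := hY.continuous_conv hα hβ hlam hA hB hW hX₀
  have h2 : Continuous fun p : State d × ℝ≥0 => conv B (P.map (Y p.2)) p.1.1 :=
    h1.comp (by fun_prop : Continuous fun p : State d × ℝ≥0 => (p.1.1, p.2))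
  have h3 := hA.continuous
  unfold mvDrift
  fun_prop

/-- The scheme uses the true law `P.map (Y t)` in its drift. Each step multiplies the mean error by
at most `1 + Lh` and adds the time-regularity error `O(√h)` of the drift over a length `h`. -/
theorem IsMcKeanVlasov.exists_euler_error_le (hα : 0 ≤ α) (hβ : 0 ≤ β) (hlam : 0 ≤ lam)
    (hA : LipschitzWith C_A A) (hB : LipschitzWith C_B B) (hW : IsBrownian W P)
    (hX₀ : Integrable X₀ P) (hX₀m : Measurable X₀) (hY : IsMcKeanVlasov α β lam A B P W X₀ Y)
    (T : ℝ≥0) :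
    ∃ K : ℝ≥0, ∀ (h : ℝ≥0) (k : ℕ), k * h ≤ T →
      ∫⁻ ω, ‖euler (fun t => mvDrift α β lam A B (P.map (Y t))) h (X₀ ω, fun t => W t ω) k
        - Y (k * h) ω‖ₑ ∂P ≤ ENNReal.ofReal (K * √h) := by
  obtain ⟨K, hK⟩ := hY.exists_lintegral_sub_le hα hβ hlam hA hB hW hX₀ T
  obtain ⟨L, hL⟩ : ∃ L : ℝ≥0, (L : ℝ) = 1 + β + 2 * lam + α + C_A + C_B :=
    ⟨⟨1 + β + 2 * lam + α + C_A + C_B, by positivity⟩, rfl⟩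
  set b : ℝ≥0 → State d → State d := fun t => mvDrift α β lam A B (P.map (Y t)) with hb
  have hbc := hY.continuous_mvDrift hα hβ hlam hA hB hW hX₀
  have hbt : ∀ t, Continuous (b t) := fun t =>
    hbc.comp (by fun_prop : Continuous fun x : State d => (x, t))
  have hblip : ∀ t x y, ‖b t x - b t y‖ ≤ L * ‖x - y‖ := fun t x y => by
    have := hY.isProbabilityMeasure_map t
    have h := norm_mvDrift_sub_le (ν := P.map (Y t)) hα hβ hlam hA hB (hY.1 t) x y
    rwa [sub_self, norm_zero, add_zero, ← hL] at h
  -- `L` accounts for the displacement of the state over a time step and `C_B` for that of its law.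
  set c : ℝ := (L + C_B) * K with hc
  have hc0 : 0 ≤ c := by positivity
  refine ⟨(c * T * Real.exp (L * T)).toNNReal, fun h => ?_⟩
  set ξ : Ω → State d × (ℝ≥0 → Space d) := fun ω => (X₀ ω, fun t => W t ω)
  have hξ : Measurable ξ := hX₀m.prodMk (measurable_pi_lambda _ hW.measurable)
  -- the local error
  have hloc : ∀ s t : ℝ≥0, s ≤ T → t ≤ T → ∫⁻ ω, ‖b s (Y s ω) - b t (Y t ω)‖ₑ ∂P
      ≤ ENNReal.ofReal (c * √|(s : ℝ) - t|) := by
    intro s t hs ht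
    have h1 : ∀ ω, ‖b s (Y s ω) - b t (Y t ω)‖ₑ ≤ L * ‖Y s ω - Y t ω‖ₑ
        + C_B * ∫⁻ ω', ‖Y s ω' - Y t ω'‖ₑ ∂P := by
      intro ω
      have := hY.isProbabilityMeasure_map s
      have e1 := norm_mvDrift_sub_le (ν := P.map (Y t)) hα hβ hlam hA hB (hY.1 s) (Y s ω) (Y t ω)
      rw [← hL] at e1
      have e2 := ENNReal.ofReal_le_ofReal e1
      rw [ofReal_norm, ENNReal.ofReal_add (by positivity) (by positivity),
        ENNReal.ofReal_mul (by positivity), ofReal_norm, ofReal_norm,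
        ENNReal.ofReal_coe_nnreal] at e2
      refine e2.trans (add_le_add le_rfl ?_)
      exact enorm_conv_map_sub_le hB (hY.integrable hα hβ hlam hA hB hW hX₀ s)
        (hY.integrable hα hβ hlam hA hB hW hX₀ t) _
    refine (lintegral_mono h1).trans ?_
    rw [lintegral_add_right _ measurable_const, lintegral_const, measure_univ, mul_one,
      lintegral_const_mul' _ _ ENNReal.coe_ne_top, ← add_mul, hc, mul_assoc,
      ENNReal.ofReal_mul (by positivity)]
    gcongr
    · rw [ENNReal.ofReal_add (by positivity) (by positivity), ENNReal.ofReal_coe_nnreal,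
        ENNReal.ofReal_coe_nnreal]
    · exact hK s hs t ht
  have key : ∀ k : ℕ, k * h ≤ T → ∫⁻ ω, ‖euler b h (ξ ω) k - Y (k * h) ω‖ₑ ∂P
      ≤ ENNReal.ofReal (c * √h * (k * h) * Real.exp (L * (k * h))) := by
    intro k
    induction k with
    | zero =>
      intro _
      -- The scheme starts at `X₀ + noise (W 0)`, exactly as the integral equation does, so `W 0 =
      -- 0` is not needed.
      have : ∀ᵐ ω ∂P, ‖euler b h (ξ ω) 0 - Y ((0 : ℕ) * h) ω‖ₑ = 0 := by
        filter_upwards [hY.eq_integral hA.continuous] with ω heq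
        obtain ⟨-, h2⟩ := heq 0
        simp only [NNReal.coe_zero, intervalIntegral.integral_same, add_zero] at h2
        simp [euler, ξ, h2]
      rw [lintegral_congr_ae this]
      simp
    | succ k ih =>
      intro hk
      have hk1 : (k : ℝ≥0) * h ≤ ((k + 1 : ℕ) : ℝ≥0) * h := by push_cast; gcongr; simp
      have hk' : (k : ℝ≥0) * h ≤ T := hk1.trans hk
      have hk1' : (((k : ℝ≥0) * h : ℝ≥0) : ℝ) ≤ (((k + 1 : ℕ) : ℝ≥0) * h : ℝ≥0) := hk1
      set tk : ℝ≥0 := (k : ℝ≥0) * h with htk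
      set tk' : ℝ≥0 := ((k + 1 : ℕ) : ℝ≥0) * h with htk'
      have hdiff : (tk' : ℝ) - tk = h := by rw [htk, htk']; push_cast; ring
      have hpath : ∀ᵐ ω ∂P, ‖euler b h (ξ ω) (k + 1) - Y tk' ω‖ₑ
          ≤ ENNReal.ofReal (1 + L * h) * ‖euler b h (ξ ω) k - Y tk ω‖ₑ
            + ‖∫ s in (tk : ℝ)..tk', (b tk (Y tk ω) - b s.toNNReal (Y s.toNNReal ω))‖ₑ := by
        filter_upwards [hY.eq_integral hA.continuous] with ω heq
        obtain ⟨i1, e1⟩ := heq tk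
        obtain ⟨i2, e2⟩ := heq tk'
        have e3 : Y tk' ω = Y tk ω + (∫ s in (tk : ℝ)..tk', b s.toNNReal (Y s.toNNReal ω))
            + noise (W tk' ω - W tk ω) := by
          rw [e1, e2, ← noise_sub, ← intervalIntegral.integral_interval_sub_left i2 i1]
          abel
        have i3 : IntervalIntegrable (fun s : ℝ => b s.toNNReal (Y s.toNNReal ω)) volume tk tk' :=
          i1.symm.trans i2
        have e4 : euler b h (ξ ω) (k + 1) - Y tk' ω = (euler b h (ξ ω) k - Y tk ω)
            + (h : ℝ) • (b tk (euler b h (ξ ω) k) - b tk (Y tk ω))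
            + ∫ s in (tk : ℝ)..tk', (b tk (Y tk ω) - b s.toNNReal (Y s.toNNReal ω)) := by
          rw [intervalIntegral.integral_sub intervalIntegrable_const i3,
            intervalIntegral.integral_const, hdiff, e3, euler]
          have : ((k : ℝ≥0) + 1) * h = tk' := by rw [htk']; push_cast; rfl
          rw [this, smul_sub]
          simp only [ξ]
          abel
        rw [e4]
        refine (enorm_add_le _ _).trans ?_
        gcongr
        rw [← ofReal_norm, ← ofReal_norm, ← ENNReal.ofReal_mul (by positivity)]
        refine ENNReal.ofReal_le_ofReal ((norm_add_le _ _).trans ?_)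
        rw [norm_smul, Real.norm_of_nonneg (NNReal.coe_nonneg h)]
        have := mul_le_mul_of_nonneg_left (hblip tk (euler b h (ξ ω) k) (Y tk ω))
          (NNReal.coe_nonneg h)
        linarith
      have hint : ∫⁻ ω, ‖∫ s in (tk : ℝ)..tk', (b tk (Y tk ω) - b s.toNNReal (Y s.toNNReal ω))‖ₑ ∂P
          ≤ ENNReal.ofReal (c * √h) * ENNReal.ofReal (tk' - tk) := by
        refine lintegral_enorm_intervalIntegral_le hk1' ?_ fun s hs => ?_
        · refine aemeasurable_uncurry_toNNReal
            (X := fun s ω => b tk (Y tk ω) - b s (Y s ω)) (fun s => ?_) ?_ _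
          · exact ((hbt tk).measurable.comp (hY.2.measurable tk)).sub
              ((hbt s).measurable.comp (hY.2.measurable s))
          · filter_upwards [hY.2.continuous] with ω hω
            exact continuous_const.sub (hbc.comp (hω.prodMk continuous_id))
        · have hs0 : (0 : ℝ) ≤ s := (NNReal.coe_nonneg tk).trans hs.1.le
          refine (hloc tk s.toNNReal hk' ((Real.toNNReal_le_iff_le_coe.2 hs.2).trans hk)).trans ?_
          refine ENNReal.ofReal_le_ofReal ?_
          gcongr
          rw [Real.coe_toNNReal _ hs0, abs_sub_comm, abs_of_nonneg (by linarith [hs.1])]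
          linarith [hs.2]
      have hm : AEMeasurable (fun ω => ‖euler b h (ξ ω) k - Y tk ω‖ₑ) P :=
        (((measurable_euler hbt h k).comp hξ).sub (hY.2.measurable tk)).enorm.aemeasurable
      calc ∫⁻ ω, ‖euler b h (ξ ω) (k + 1) - Y tk' ω‖ₑ ∂P
          ≤ _ := lintegral_mono_ae hpath
        _ ≤ ENNReal.ofReal (1 + L * h) * ENNReal.ofReal (c * √h * (k * h) * Real.exp (L * (k * h)))
            + ENNReal.ofReal (c * √h) * ENNReal.ofReal (tk' - tk) := by
          rw [lintegral_add_left' (hm.const_mul _), lintegral_const_mul' _ _ ENNReal.ofReal_ne_top]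
          gcongr
          exact ih hk'
        _ ≤ _ := by
          rw [hdiff, ← ENNReal.ofReal_mul (by positivity), ← ENNReal.ofReal_mul (by positivity),
            ← ENNReal.ofReal_add (by positivity) (by positivity)]
          refine ENNReal.ofReal_le_ofReal ?_
          push_cast
          have x1 : 1 + L * h ≤ Real.exp (L * h) := by
            have := Real.add_one_le_exp (L * h : ℝ); linarith
          have x2 : Real.exp (L * ((k + 1) * h)) = Real.exp (L * h) * Real.exp (L * (k * h)) := by
            rw [← Real.exp_add]; ring_nf
          have x3 : 1 ≤ Real.exp (L * ((k + 1) * h) : ℝ) := Real.one_le_exp (by positivity)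
          have x4 : (1 + L * h) * (c * √h * (k * h) * Real.exp (L * (k * h)))
              ≤ Real.exp (L * h) * (c * √h * (k * h) * Real.exp (L * (k * h))) := by gcongr
          have x5 : c * √h * h * 1 ≤ c * √h * h * Real.exp (L * ((k + 1) * h)) := by gcongr
          calc _ ≤ Real.exp (L * h) * (c * √h * (k * h) * Real.exp (L * (k * h)))
                + c * √h * h * Real.exp (L * ((k + 1) * h)) := by linarith
            _ = _ := by rw [x2]; ring
  intro k hk
  refine (key k hk).trans (ENNReal.ofReal_le_ofReal ?_)
  have hk' : (k : ℝ) * h ≤ T := by exact_mod_cast hk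
  calc c * √h * (k * h) * Real.exp (L * (k * h)) ≤ c * √h * T * Real.exp (L * T) := by gcongr
    _ = _ := by rw [Real.coe_toNNReal _ (by positivity)]; ring

/-- The Euler approximation of the state at time `t` with `n + 1` steps. -/
noncomputable def eulerAt (b : ℝ≥0 → State d → State d) (t : ℝ≥0) (n : ℕ)
    (ξ : State d × (ℝ≥0 → Space d)) : State d :=
  euler b (t / (n + 1 : ℕ)) ξ (n + 1)

theorem IsMcKeanVlasov.tendsto_eulerAt (hα : 0 ≤ α) (hβ : 0 ≤ β) (hlam : 0 ≤ lam)
    (hA : LipschitzWith C_A A) (hB : LipschitzWith C_B B) (hW : IsBrownian W P)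
    (hX₀ : Integrable X₀ P) (hX₀m : Measurable X₀) (hY : IsMcKeanVlasov α β lam A B P W X₀ Y)
    (t : ℝ≥0) :
    Tendsto (fun n => ∫⁻ ω, ‖eulerAt (fun t => mvDrift α β lam A B (P.map (Y t))) t n
      (X₀ ω, fun t => W t ω) - Y t ω‖ₑ ∂P) atTop (𝓝 0) := by
  obtain ⟨K, hK⟩ := hY.exists_euler_error_le hα hβ hlam hA hB hW hX₀ hX₀m t
  have hlim : Tendsto (fun n : ℕ => ENNReal.ofReal (K * √(t / (n + 1 : ℕ)))) atTop (𝓝 0) := by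
    have h1 : Tendsto (fun n : ℕ => (t : ℝ) / (n + 1 : ℕ)) atTop (𝓝 0) :=
      (tendsto_const_div_atTop_nhds_zero_nat (t : ℝ)).comp (tendsto_add_atTop_nat 1)
    have h2 : Continuous fun x : ℝ => ENNReal.ofReal (K * √x) :=
      ENNReal.continuous_ofReal.comp (by fun_prop)
    have h3 := (h2.tendsto 0).comp h1
    rwa [Real.sqrt_zero, mul_zero, ENNReal.ofReal_zero] at h3
  refine tendsto_of_tendsto_of_tendsto_of_le_of_le tendsto_const_nhds hlim
    (fun _ => zero_le) fun n => ?_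
  have e : ((n + 1 : ℕ) : ℝ≥0) * (t / (n + 1 : ℕ)) = t :=
    mul_div_cancel₀ t (Nat.cast_ne_zero.2 n.succ_ne_zero)
  have := hK (t / (n + 1 : ℕ)) (n + 1) e.le
  rw [e] at this
  simpa [eulerAt] using this

end Convergence

/-! ### Uniqueness in law, and solutions as functions of the input. -/

section Law

open Filter Topology Set

variable {Ω : Type*} [MeasurableSpace Ω] {P : Measure Ω} {d : ℕ}
  {α β lam : ℝ} {A B : Space d → Space d} {C_A C_B : ℝ≥0} {W W' : ℝ≥0 → Ω → Space d}
  {X₀ X₀' : Ω → State d} {Y Y' : ℝ≥0 → Ω → State d}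

theorem tendstoInMeasure_of_tendsto_lintegral {E : Type*} [NormedAddCommGroup E]
    {f : ℕ → Ω → E} {g : Ω → E} (hf : ∀ n, AEStronglyMeasurable (f n) P)
    (hg : AEStronglyMeasurable g P)
    (h : Tendsto (fun n => ∫⁻ ω, ‖f n ω - g ω‖ₑ ∂P) atTop (𝓝 0)) :
    TendstoInMeasure P f atTop g := by
  refine tendstoInMeasure_of_tendsto_eLpNorm one_ne_zero hf hg ?_
  simpa [eLpNorm_one_eq_lintegral_enorm] using h

variable [IsProbabilityMeasure P]

theorem measurable_eulerAt {b : ℝ≥0 → State d → State d} (hb : ∀ t, Continuous (b t)) (t : ℝ≥0)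
    (n : ℕ) : Measurable (eulerAt b t n) :=
  measurable_euler hb _ _

theorem IsMcKeanVlasov.continuous_mvDrift_apply (hα : 0 ≤ α) (hβ : 0 ≤ β) (hlam : 0 ≤ lam)
    (hA : LipschitzWith C_A A) (hB : LipschitzWith C_B B) (hW : IsBrownian W P)
    (hX₀ : Integrable X₀ P) (hY : IsMcKeanVlasov α β lam A B P W X₀ Y) (t : ℝ≥0) :
    Continuous (mvDrift α β lam A B (P.map (Y t))) :=
  (hY.continuous_mvDrift hα hβ hlam hA hB hW hX₀).comp
    (by fun_prop : Continuous fun x : State d => (x, t))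

/-- A McKean–Vlasov solution is at each time a measurable function of its random input. -/
theorem IsMcKeanVlasov.exists_ae_eq_comp (hα : 0 ≤ α) (hβ : 0 ≤ β) (hlam : 0 ≤ lam)
    (hA : LipschitzWith C_A A) (hB : LipschitzWith C_B B) (hW : IsBrownian W P)
    (hX₀ : Integrable X₀ P) (hX₀m : Measurable X₀) (hY : IsMcKeanVlasov α β lam A B P W X₀ Y)
    (t : ℝ≥0) : ∃ Φ : State d × (ℝ≥0 → Space d) → State d, Measurable Φ ∧
      Y t =ᵐ[P] fun ω => Φ (X₀ ω, fun t => W t ω) := by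
  have hm := measurable_eulerAt
    (hY.continuous_mvDrift_apply hα hβ hlam hA hB hW hX₀) t
  have hξ : Measurable fun ω => (X₀ ω, fun t => W t ω) :=
    hX₀m.prodMk (measurable_pi_lambda _ hW.measurable)
  obtain ⟨ns, -, hns⟩ := (tendstoInMeasure_of_tendsto_lintegral
    (fun n => ((hm n).comp hξ).aestronglyMeasurable) (hY.2.measurable t).aestronglyMeasurable
    (hY.tendsto_eulerAt hα hβ hlam hA hB hW hX₀ hX₀m t)).exists_seq_tendsto_ae
  -- Convergence in mean gives an almost surely convergent subsequence of schemes; `limUnder`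
  -- defines its limit for every input, as a measurable function.
  refine ⟨fun ξ => limUnder atTop fun i => eulerAt _ t (ns i) ξ,
    (StronglyMeasurable.limUnder fun i => (hm (ns i)).stronglyMeasurable).measurable, ?_⟩
  filter_upwards [hns] with ω hω
  exact hω.limUnder_eq.symm

theorem norm_conv_map_sub_le (hB : LipschitzWith C_B B) {U V : Ω → State d}
    (hU : Integrable U P) (hV : Integrable V P) (q : Space d) :
    ‖conv B (P.map U) q - conv B (P.map V) q‖ ≤ C_B * (∫⁻ ω, ‖U ω - V ω‖ₑ ∂P).toReal := by
  have h := enorm_conv_map_sub_le hB hU hV q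
  have hfin : ∫⁻ ω, ‖U ω - V ω‖ₑ ∂P ≠ ∞ := (hU.sub hV).2.ne
  have h2 := ENNReal.toReal_mono (ENNReal.mul_ne_top ENNReal.coe_ne_top hfin) h
  rwa [toReal_enorm, ENNReal.toReal_mul, ENNReal.coe_toReal] at h2

/-- Uniqueness in law for the interaction force of the McKean–Vlasov equation. -/
theorem IsMcKeanVlasov.conv_eq_conv (hα : 0 ≤ α) (hβ : 0 ≤ β) (hlam : 0 ≤ lam)
    (hA : LipschitzWith C_A A) (hB : LipschitzWith C_B B) (hW : IsBrownian W P)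
    (hX₀ : Integrable X₀ P) (hX₀m : Measurable X₀) (hY : IsMcKeanVlasov α β lam A B P W X₀ Y)
    (hW' : IsBrownian W' P) (hX₀' : Integrable X₀' P) (hX₀m' : Measurable X₀')
    (hY' : IsMcKeanVlasov α β lam A B P W' X₀' Y')
    (hlaw : P.map (fun ω => (X₀ ω, fun t => W t ω)) = P.map (fun ω => (X₀' ω, fun t => W' t ω)))
    (t : ℝ≥0) : conv B (P.map (Y t)) = conv B (P.map (Y' t)) := by
  obtain ⟨M, hM⟩ := hY.exists_lintegral_le hα hβ hlam hA hB hW hX₀ t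
  obtain ⟨M', hM'⟩ := hY'.exists_lintegral_le hα hβ hlam hA hB hW' hX₀' t
  set L : ℝ := 1 + β + 2 * lam + α + C_A + C_B with hL
  have hL0 : 0 ≤ L := by positivity
  -- With this weight `C_B / (θ - L) ≤ 1/2`, which makes each iteration below halve the bound; the
  -- `+ 1` keeps `θ - L` positive when `C_B = 0`.
  set θ : ℝ := L + (2 * C_B + 1) with hθ
  have hθL : L < θ := by rw [hθ]; have := NNReal.coe_nonneg C_B; linarith
  have hθ0 : 0 ≤ θ := hL0.trans hθL.le
  set N : ℝ := C_B * (M + M') with hN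
  have hN0 : 0 ≤ N := by positivity
  set b : ℝ≥0 → State d → State d := fun t => mvDrift α β lam A B (P.map (Y t))
  set b' : ℝ≥0 → State d → State d := fun t => mvDrift α β lam A B (P.map (Y' t))
  have hbt := hY.continuous_mvDrift_apply hα hβ hlam hA hB hW hX₀
  have hbt' := hY'.continuous_mvDrift_apply hα hβ hlam hA hB hW' hX₀'
  set ξ : Ω → State d × (ℝ≥0 → Space d) := fun ω => (X₀ ω, fun t => W t ω)
  set ξ' : Ω → State d × (ℝ≥0 → Space d) := fun ω => (X₀' ω, fun t => W' t ω)
  have hξ : Measurable ξ := hX₀m.prodMk (measurable_pi_lambda _ hW.measurable)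
  have hξ' : Measurable ξ' := hX₀m'.prodMk (measurable_pi_lambda _ hW'.measurable)
  -- A Picard iteration on the gap between the two force fields in the norm weighted by `e^{-θs}`. A
  -- gap in the fields gives a gap between the schemes, hence between the limiting laws, hence a
  -- smaller gap in the fields.
  have key : ∀ j : ℕ, ∀ s ≤ t, ∀ q, ‖conv B (P.map (Y s)) q - conv B (P.map (Y' s)) q‖
      ≤ N * (1 / 2) ^ j * Real.exp (θ * s) := by
    intro j
    induction j with
    | zero =>
      intro s hs q
      have h1 := norm_conv_map_sub_le hB (hY.integrable hα hβ hlam hA hB hW hX₀ s)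
        (hY'.integrable hα hβ hlam hA hB hW' hX₀' s) q
      have h2 : ∫⁻ ω, ‖Y s ω - Y' s ω‖ₑ ∂P ≤ ((M + M' : ℝ≥0) : ℝ≥0∞) := by
        calc ∫⁻ ω, ‖Y s ω - Y' s ω‖ₑ ∂P ≤ ∫⁻ ω, (‖Y s ω‖ₑ + ‖Y' s ω‖ₑ) ∂P :=
              lintegral_mono fun ω => enorm_sub_le
          _ = ∫⁻ ω, ‖Y s ω‖ₑ ∂P + ∫⁻ ω, ‖Y' s ω‖ₑ ∂P :=
              lintegral_add_left (hY.2.measurable s).enorm _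
          _ ≤ _ := by
              rw [ENNReal.coe_add]
              exact add_le_add (hM s hs) (hM' s hs)
      have h3 := ENNReal.toReal_mono ENNReal.coe_ne_top h2
      rw [ENNReal.coe_toReal, NNReal.coe_add] at h3
      have h4 : 1 ≤ Real.exp (θ * s) := Real.one_le_exp (by positivity)
      calc _ ≤ (C_B : ℝ) * (M + M') := h1.trans (by gcongr)
        _ = N * (1 / 2) ^ 0 * 1 := by rw [hN]; ring
        _ ≤ _ := by gcongr
    | succ j ih =>
      intro s hs q
      set δ : ℝ := N * (1 / 2) ^ j with hδ
      have hδ0 : 0 ≤ δ := by positivity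
      have hbb : ∀ r ≤ s, ∀ x y, ‖b r x - b' r y‖ ≤ L * ‖x - y‖ + δ * Real.exp (θ * r) := by
        intro r hr x y
        have := hY.isProbabilityMeasure_map r
        exact (norm_mvDrift_sub_le hα hβ hlam hA hB (hY.1 r) x y).trans
          (add_le_add le_rfl (ih r (hr.trans hs) _))
      have hE : ∀ n ξ, ‖eulerAt b s n ξ - eulerAt b' s n ξ‖ ≤ δ / (θ - L) * Real.exp (θ * s) := by
        intro n ξ
        have e : ((n + 1 : ℕ) : ℝ≥0) * (s / (n + 1 : ℕ)) = s :=
          mul_div_cancel₀ s (Nat.cast_ne_zero.2 n.succ_ne_zero)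
        have h := norm_euler_sub_le hL0 hθL hδ0 hbb (s / (n + 1 : ℕ)) ξ (n + 1) e.le
        rwa [e] at h
      have hYs := hY.integrable hα hβ hlam hA hB hW hX₀ s
      have hYs' := hY'.integrable hα hβ hlam hA hB hW' hX₀' s
      have hlim := hY.tendsto_eulerAt hα hβ hlam hA hB hW hX₀ hX₀m s
      have hlim' := hY'.tendsto_eulerAt hα hβ hlam hA hB hW' hX₀' hX₀m' s
      have hmE := measurable_eulerAt hbt s
      have hmE' := measurable_eulerAt hbt' s
      have hR : Tendsto (fun n => (C_B : ℝ) * (∫⁻ ω, ‖eulerAt b s n (ξ ω) - Y s ω‖ₑ ∂P).toReal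
          + C_B * (δ / (θ - L) * Real.exp (θ * s))
          + C_B * (∫⁻ ω, ‖eulerAt b' s n (ξ' ω) - Y' s ω‖ₑ ∂P).toReal) atTop
          (𝓝 (C_B * (0 : ℝ≥0∞).toReal + C_B * (δ / (θ - L) * Real.exp (θ * s))
            + C_B * (0 : ℝ≥0∞).toReal)) :=
        ((((ENNReal.tendsto_toReal ENNReal.zero_ne_top).comp hlim).const_mul _).add_const _).add
          (((ENNReal.tendsto_toReal ENNReal.zero_ne_top).comp hlim').const_mul _)
      simp only [ENNReal.toReal_zero, mul_zero, zero_add, add_zero] at hR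
      have hbound : ‖conv B (P.map (Y s)) q - conv B (P.map (Y' s)) q‖
          ≤ C_B * (δ / (θ - L) * Real.exp (θ * s)) := by
        refine ge_of_tendsto hR ?_
        filter_upwards [hlim.eventually_lt_const ENNReal.zero_lt_top,
          hlim'.eventually_lt_const ENNReal.zero_lt_top] with n hn hn'
        have i1 : Integrable (fun ω => eulerAt b s n (ξ ω)) P := by
          have : Integrable (fun ω => eulerAt b s n (ξ ω) - Y s ω) P :=
            ⟨(((hmE n).comp hξ).sub (hY.2.measurable s)).aestronglyMeasurable, hn⟩
          exact (this.add hYs).congr (ae_of_all _ fun ω => sub_add_cancel _ _)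
        have i2 : Integrable (fun ω => eulerAt b' s n (ξ' ω)) P := by
          have : Integrable (fun ω => eulerAt b' s n (ξ' ω) - Y' s ω) P :=
            ⟨(((hmE' n).comp hξ').sub (hY'.2.measurable s)).aestronglyMeasurable, hn'⟩
          exact (this.add hYs').congr (ae_of_all _ fun ω => sub_add_cancel _ _)
        -- The second scheme may be fed with the first input without changing its law. Both schemes
        -- can then be compared path by path, although `Y` and `Y'` have different inputs.
        have hmap : P.map (fun ω => eulerAt b' s n (ξ' ω)) = P.map (fun ω => eulerAt b' s n (ξ ω)) := by
          have e1 := Measure.map_map (μ := P) (hmE' n) hξ'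
          have e2 := Measure.map_map (μ := P) (hmE' n) hξ
          rw [← hlaw] at e1
          exact e1.symm.trans e2
        have i3 : Integrable (fun ω => eulerAt b' s n (ξ ω)) P := by
          have : Integrable (fun ω => eulerAt b s n (ξ ω) - eulerAt b' s n (ξ ω)) P :=
            Integrable.of_bound (((hmE n).comp hξ).sub ((hmE' n).comp hξ)).aestronglyMeasurable _
              (ae_of_all _ fun ω => hE n (ξ ω))
          exact (i1.sub this).congr (ae_of_all _ fun ω => sub_sub_cancel _ _)
        have n1 := norm_conv_map_sub_le hB i1 hYs q
        have n2 := norm_conv_map_sub_le hB i1 i3 q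
        have n3 := norm_conv_map_sub_le hB i2 hYs' q
        rw [hmap] at n3
        have n4 : (∫⁻ ω, ‖eulerAt b s n (ξ ω) - eulerAt b' s n (ξ ω)‖ₑ ∂P).toReal
            ≤ δ / (θ - L) * Real.exp (θ * s) := by
          refine ENNReal.toReal_le_of_le_ofReal (mul_nonneg (div_nonneg hδ0 (by linarith))
            (Real.exp_pos _).le) ?_
          calc _ ≤ ∫⁻ _, ENNReal.ofReal (δ / (θ - L) * Real.exp (θ * s)) ∂P := by
                refine lintegral_mono fun ω => ?_
                rw [← ofReal_norm]
                exact ENNReal.ofReal_le_ofReal (hE n (ξ ω))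
            _ = _ := by simp
        have n5 := mul_le_mul_of_nonneg_left n4 (NNReal.coe_nonneg C_B)
        have tri : ∀ a b c e : Space d, ‖a - e‖ ≤ ‖b - a‖ + ‖b - c‖ + ‖c - e‖ := fun a b c e => by
          have : a - e = -(b - a) + (b - c) + (c - e) := by abel
          rw [this]
          refine norm_add₃_le.trans ?_
          rw [norm_neg]
        have n6 := tri (conv B (P.map (Y s)) q) (conv B (P.map fun ω => eulerAt b s n (ξ ω)) q)
          (conv B (P.map fun ω => eulerAt b' s n (ξ ω)) q) (conv B (P.map (Y' s)) q)
        linarith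
      refine hbound.trans ?_
      have hCB : (C_B : ℝ) / (θ - L) ≤ 1 / 2 := by
        rw [div_le_iff₀ (by linarith), hθ]; ring_nf; linarith
      calc C_B * (δ / (θ - L) * Real.exp (θ * s))
          = C_B / (θ - L) * (δ * Real.exp (θ * s)) := by ring
        _ ≤ 1 / 2 * (δ * Real.exp (θ * s)) := by gcongr
        _ = _ := by rw [hδ, pow_succ]; ring
  funext q
  have hlim : Tendsto (fun j : ℕ => N * (1 / 2 : ℝ) ^ j * Real.exp (θ * t)) atTop
      (𝓝 (N * 0 * Real.exp (θ * t))) :=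
    ((tendsto_pow_atTop_nhds_zero_of_lt_one (by norm_num) (by norm_num)).const_mul N).mul_const _
  have h := ge_of_tendsto' hlim fun j => key j t le_rfl q
  simp only [mul_zero, zero_mul] at h
  exact sub_eq_zero.1 (norm_le_zero_iff.1 h)

/-- Uniqueness in law for the McKean–Vlasov equation. -/
theorem IsMcKeanVlasov.map_eq_map (hα : 0 ≤ α) (hβ : 0 ≤ β) (hlam : 0 ≤ lam)
    (hA : LipschitzWith C_A A) (hB : LipschitzWith C_B B) (hW : IsBrownian W P)
    (hX₀ : Integrable X₀ P) (hX₀m : Measurable X₀) (hY : IsMcKeanVlasov α β lam A B P W X₀ Y)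
    (hW' : IsBrownian W' P) (hX₀' : Integrable X₀' P) (hX₀m' : Measurable X₀')
    (hY' : IsMcKeanVlasov α β lam A B P W' X₀' Y')
    (hlaw : P.map (fun ω => (X₀ ω, fun t => W t ω)) = P.map (fun ω => (X₀' ω, fun t => W' t ω)))
    (t : ℝ≥0) : P.map (Y t) = P.map (Y' t) := by
  have hconv := hY.conv_eq_conv hα hβ hlam hA hB hW hX₀ hX₀m hW' hX₀' hX₀m' hY' hlaw
  have hb : (fun t => mvDrift α β lam A B (P.map (Y t)))
      = fun t => mvDrift α β lam A B (P.map (Y' t)) := by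
    funext t x
    simp only [mvDrift, hconv]
  have hξ : Measurable fun ω => (X₀ ω, fun t => W t ω) :=
    hX₀m.prodMk (measurable_pi_lambda _ hW.measurable)
  have hξ' : Measurable fun ω => (X₀' ω, fun t => W' t ω) :=
    hX₀m'.prodMk (measurable_pi_lambda _ hW'.measurable)
  have hm := measurable_eulerAt (hY.continuous_mvDrift_apply hα hβ hlam hA hB hW hX₀) t
  have h1 := (tendstoInMeasure_of_tendsto_lintegral
    (fun n => ((hm n).comp hξ).aestronglyMeasurable) (hY.2.measurable t).aestronglyMeasurable
    (hY.tendsto_eulerAt hα hβ hlam hA hB hW hX₀ hX₀m t)).tendstoInDistribution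
    fun n => ((hm n).comp hξ).aemeasurable
  have hlim' := hY'.tendsto_eulerAt hα hβ hlam hA hB hW' hX₀' hX₀m' t
  rw [← hb] at hlim'
  have h2 := (tendstoInMeasure_of_tendsto_lintegral
    (fun n => ((hm n).comp hξ').aestronglyMeasurable) (hY'.2.measurable t).aestronglyMeasurable
    hlim').tendstoInDistribution fun n => ((hm n).comp hξ').aemeasurable
  -- Since the fields agree, one scheme serves both solutions; fed with either input it has the same
  -- law, so `Y t` and `Y' t` are limits in law of the same sequence.
  refine tendstoInDistribution_unique _ h1 ⟨h1.forall_aemeasurable, h2.aemeasurable_limit, ?_⟩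
  refine h2.tendsto.congr fun n => ?_
  refine Subtype.ext ?_
  have e1 := Measure.map_map (μ := P) (hm n) hξ
  have e2 := Measure.map_map (μ := P) (hm n) hξ'
  rw [← hlaw] at e2
  exact e2.symm.trans e1

end Law

/-! ### The mean-field copies are independent with a common law. -/

section Independence

variable {Ω : Type*} [MeasurableSpace Ω] {P : Measure Ω} [IsProbabilityMeasure P] {d : ℕ}
  {ι : Type*} {α β lam : ℝ} {A B : Space d → Space d} {C_A C_B : ℝ≥0}
  {ρ₀ : Measure (State d)} {W : ι → ℝ≥0 → Ω → Space d} {X₀ : ι → Ω → State d}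
  {Y : ι → ℝ≥0 → Ω → State d}

theorem IsDrivingData.map_mcKeanVlasov_eq (hα : 0 ≤ α) (hβ : 0 ≤ β) (hlam : 0 ≤ lam)
    (hA : LipschitzWith C_A A) (hB : LipschitzWith C_B B) (h : IsDrivingData P ρ₀ W X₀)
    (hX₀ : ∀ i, Integrable (X₀ i) P)
    (hY : ∀ i, IsMcKeanVlasov α β lam A B P (W i) (X₀ i) (Y i)) (t : ℝ≥0) (i j : ι) :
    P.map (Y i t) = P.map (Y j t) :=
  (hY i).map_eq_map hα hβ hlam hA hB (h.brownian i) (hX₀ i) (h.measurable_init i)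
    (h.brownian j) (hX₀ j) (h.measurable_init j) (hY j) (h.map_input_eq i j) t

/-- Each copy is almost surely a measurable function of its own input, and the inputs are
independent. -/
theorem IsDrivingData.iIndepFun_mcKeanVlasov [Fintype ι] (hα : 0 ≤ α) (hβ : 0 ≤ β)
    (hlam : 0 ≤ lam) (hA : LipschitzWith C_A A) (hB : LipschitzWith C_B B)
    (h : IsDrivingData P ρ₀ W X₀) (hX₀ : ∀ i, Integrable (X₀ i) P)
    (hY : ∀ i, IsMcKeanVlasov α β lam A B P (W i) (X₀ i) (Y i)) (t : ℝ≥0) :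
    iIndepFun (fun i => Y i t) P := by
  have hΦ := fun i => (hY i).exists_ae_eq_comp hα hβ hlam hA hB (h.brownian i) (hX₀ i)
    (h.measurable_init i) t
  choose Φ hΦm hΦ using hΦ
  exact (h.iIndepFun_input.comp Φ hΦm).congr fun i => (hΦ i).symm

end Independence

/-! ### Relaxation for families of trajectories. -/

section Dissipation

open Filter Topology Set

variable {d : ℕ} {α β lam ε c C κ K : ℝ}

/-- The constants of a quadratic Lyapunov function for the linear dynamics. -/
structure IsLyapunov (α β lam ε c C κ K : ℝ) : Prop where
  c_pos : 0 < c
  C_pos : 0 < C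
  κ_pos : 0 < κ
  K_pos : 0 < K
  le_lyapunov : ∀ {d : ℕ} (x : State d), c * sqNorm x ≤ lyapunov β lam ε x
  lyapunov_le : ∀ {d : ℕ} (x : State d), lyapunov β lam ε x ≤ C * sqNorm x
  deriv_le : ∀ {d : ℕ} (x : State d) (f h : Space d),
    lyapunovDeriv β lam ε x (linDrift α β lam x f h)
      ≤ -κ * sqNorm x + K * (‖f‖ ^ 2 + ‖h‖ ^ 2)

theorem exists_isLyapunov (hα : 0 < α) (hβ : 0 < β) (hlam : 0 < lam) :
    ∃ ε c C κ K : ℝ, IsLyapunov α β lam ε c C κ K := by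
  obtain ⟨ε, c, C, κ, K, hc, hC, hκ, hK, h⟩ := exists_lyapunov hα hβ hlam
  exact ⟨ε, c, C, κ, K, hc, hC, hκ, hK, fun x => (h _ x).1, fun x => (h _ x).2.1,
    fun x => (h _ x).2.2⟩

theorem IsLyapunov.lyapunov_nonneg (hL : IsLyapunov α β lam ε c C κ K) (x : State d) :
    0 ≤ lyapunov β lam ε x :=
  (mul_nonneg hL.c_pos.le (sqNorm_nonneg x)).trans (hL.le_lyapunov x)

/-- Exponential relaxation of a finite family of trajectories whose forces are controlled by the
dissipation. -/
theorem IsLyapunov.sum_le (hL : IsLyapunov α β lam ε c C κ K) {ι : Type*} (S : Finset ι)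
    {x : ι → ℝ → State d} {f h : ι → ℝ → Space d} {r : ℝ → ℝ}
    (hx : ∀ i ∈ S, Continuous (x i))
    (hd : ∀ i ∈ S, ∀ t, 0 < t →
      HasDerivAt (x i) (linDrift α β lam (x i t) (f i t) (h i t)) t)
    (hr : Continuous r)
    (hle : ∀ t, 0 < t → ∑ i ∈ S, K * (‖f i t‖ ^ 2 + ‖h i t‖ ^ 2)
      ≤ κ / 2 * ∑ i ∈ S, sqNorm (x i t) + r t) {t : ℝ} (ht : 0 ≤ t) :
    ∑ i ∈ S, lyapunov β lam ε (x i t)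
      ≤ Real.exp (-(κ / (2 * C)) * t) * ∑ i ∈ S, lyapunov β lam ε (x i 0)
        + ∫ s in (0 : ℝ)..t, Real.exp (-(κ / (2 * C)) * (t - s)) * r s := by
  refine le_exp_mul_add_integral_of_deriv_le (v := fun t => ∑ i ∈ S, lyapunov β lam ε (x i t))
    (v' := fun t => ∑ i ∈ S, lyapunovDeriv β lam ε (x i t)
      (linDrift α β lam (x i t) (f i t) (h i t))) ?_ hr ?_ ?_ ht
  · exact (continuous_finsetSum _ fun i hi =>
      (continuous_lyapunov β lam ε).comp (hx i hi)).continuousOn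
  · intro t ht
    refine HasDerivAt.fun_sum fun i hi => ?_
    have h0 := (hd i hi t ht).hasFDerivAt
    exact hasDerivAt_lyapunov β lam ε (h0.fst.hasDerivAt.congr_deriv (by simp))
      (h0.snd.fst.hasDerivAt.congr_deriv (by simp)) (h0.snd.snd.hasDerivAt.congr_deriv (by simp))
  · intro t ht
    have h1 : ∑ i ∈ S, lyapunovDeriv β lam ε (x i t) (linDrift α β lam (x i t) (f i t) (h i t))
        ≤ -κ * ∑ i ∈ S, sqNorm (x i t) + ∑ i ∈ S, K * (‖f i t‖ ^ 2 + ‖h i t‖ ^ 2) := by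
      rw [Finset.mul_sum, ← Finset.sum_add_distrib]
      exact Finset.sum_le_sum fun i _ => hL.deriv_le _ _ _
    have h2 : ∑ i ∈ S, lyapunov β lam ε (x i t) ≤ C * ∑ i ∈ S, sqNorm (x i t) := by
      rw [Finset.mul_sum]
      exact Finset.sum_le_sum fun i _ => hL.lyapunov_le _
    have h3 : κ / (2 * C) * ∑ i ∈ S, lyapunov β lam ε (x i t)
        ≤ κ / 2 * ∑ i ∈ S, sqNorm (x i t) := by
      have := hL.κ_pos
      have := hL.C_pos
      calc _ ≤ κ / (2 * C) * (C * ∑ i ∈ S, sqNorm (x i t)) := by gcongr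
        _ = _ := by field_simp
    have := hle t ht
    linarith

end Dissipation

/-! ### A regularised noise with bounded variance. -/

section WindowedNoise

open Filter Topology Set

variable {Ω : Type*} {d : ℕ} {W : ℝ≥0 → Ω → Space d}

/-- The difference between a path and its average over the preceding unit of time, the path being
extended by its value at `0` to negative times. -/
noncomputable def windowed (W : ℝ≥0 → Ω → Space d) (t : ℝ≥0) (ω : Ω) : Space d :=
  W t ω - ∫ s in ((t : ℝ) - 1)..t, W s.toNNReal ω

/-- The increment of a path over the preceding unit of time. -/
noncomputable def unitIncrement (W : ℝ≥0 → Ω → Space d) (t : ℝ≥0) (ω : Ω) : Space d :=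
  W t ω - W ((t : ℝ) - 1).toNNReal ω

/-- The reason for the window: the average of `W` over unit time is differentiable, its derivative
is the unit increment, and both this increment and `W` minus the average have second moments bounded
in time. -/
theorem hasDerivAt_window {w : ℝ → Space d} (hw : Continuous w) (t : ℝ) :
    HasDerivAt (fun t => ∫ s in (t - 1)..t, w s) (w t - w (t - 1)) t := by
  have hI : ∀ t, HasDerivAt (fun t => ∫ s in (0 : ℝ)..t, w s) (w t) t :=
    fun t => (hw.integral_hasStrictDerivAt 0 t).hasDerivAt
  have h := (hI t).sub ((hI (t - 1)).comp_sub_const t 1)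
  refine h.congr_of_eventuallyEq (Eventually.of_forall fun s => ?_)
  exact (intervalIntegral.integral_interval_sub_left (hw.intervalIntegrable _ _)
    (hw.intervalIntegrable _ _)).symm

theorem continuous_windowed {ω : Ω} (hc : Continuous fun t => W t ω) :
    Continuous fun t => windowed W t ω := by
  have hc' : Continuous fun s : ℝ => W s.toNNReal ω := hc.comp continuous_real_toNNReal
  have h : Continuous fun t : ℝ => ∫ s in (t - 1)..t, W s.toNNReal ω :=
    continuous_iff_continuousAt.2 fun t => (hasDerivAt_window hc' t).continuousAt
  exact hc.sub (h.comp NNReal.continuous_coe)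

theorem continuous_unitIncrement {ω : Ω} (hc : Continuous fun t => W t ω) :
    Continuous fun t => unitIncrement W t ω :=
  hc.sub (hc.comp (by fun_prop))

variable [MeasurableSpace Ω] {P : Measure Ω}

theorem IsBrownian.aemeasurable_windowed [IsProbabilityMeasure P] (hW : IsBrownian W P) (t : ℝ≥0) :
    AEMeasurable (windowed W t) P := by
  have hm := aemeasurable_uncurry_toNNReal hW.measurable hW.continuous
    (volume.restrict (Ioc ((t : ℝ) - 1) t))
  have := (hm.aestronglyMeasurable.prod_swap).integral_prod_right'
  refine (hW.measurable t).aemeasurable.sub (this.aemeasurable.congr (ae_of_all _ fun ω => ?_))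
  exact (intervalIntegral.integral_of_le (by linarith)).symm

theorem measurable_unitIncrement (hW : IsBrownian W P) (t : ℝ≥0) :
    Measurable (unitIncrement W t) :=
  (hW.measurable t).sub (hW.measurable _)

/-- For `t < 1` the window reaches negative times, where the path is frozen at its value at `0`;
this only shortens the time gap. -/
theorem abs_sub_toNNReal_le {s : ℝ} {t : ℝ≥0} (h1 : (t : ℝ) - 1 ≤ s) (h2 : s ≤ t) :
    |(t : ℝ) - s.toNNReal| ≤ 1 := by
  rw [Real.coe_toNNReal', abs_le]
  have := NNReal.coe_nonneg t
  rcases le_total s 0 with h | h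
  · rw [max_eq_right h]; constructor <;> linarith
  · rw [max_eq_left h]; constructor <;> linarith

theorem IsBrownian.lintegral_unitIncrement_sq_le (hW : IsBrownian W P) (t : ℝ≥0) :
    ∫⁻ ω, ‖unitIncrement W t ω‖ₑ ^ 2 ∂P ≤ d := by
  unfold unitIncrement
  rw [hW.lintegral_sub_sq]
  refine mul_le_of_le_one_right' ?_
  rw [← ENNReal.ofReal_one]
  exact ENNReal.ofReal_le_ofReal (abs_sub_toNNReal_le le_rfl (by linarith))

theorem IsBrownian.lintegral_windowed_sq_le [IsProbabilityMeasure P] (hW : IsBrownian W P)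
    (t : ℝ≥0) : ∫⁻ ω, ‖windowed W t ω‖ₑ ^ 2 ∂P ≤ d := by
  -- The window has length one, so this is a probability measure and `lintegral_sq_le` applies.
  set ν : Measure ℝ := volume.restrict (Ioc ((t : ℝ) - 1) t) with hν
  have : IsProbabilityMeasure ν := ⟨by simp [hν]⟩
  have hm : AEMeasurable (fun p : ℝ × Ω => ‖W t p.2 - W p.1.toNNReal p.2‖ₑ) (ν.prod P) :=
    (((hW.measurable t).comp measurable_snd).aemeasurable.sub
      (aemeasurable_uncurry_toNNReal hW.measurable hW.continuous ν)).enorm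
  calc ∫⁻ ω, ‖windowed W t ω‖ₑ ^ 2 ∂P
      ≤ ∫⁻ ω, (∫⁻ s, ‖W t ω - W s.toNNReal ω‖ₑ ^ 2 ∂ν) ∂P := by
        refine lintegral_mono_ae ?_
        filter_upwards [hW.continuous] with ω hc
        have hc' : Continuous fun s : ℝ => W s.toNNReal ω := hc.comp continuous_real_toNNReal
        have e : windowed W t ω = ∫ s, (W t ω - W s.toNNReal ω) ∂ν := by
          rw [windowed, intervalIntegral.integral_of_le (by linarith), integral_sub
            (integrable_const _) ((hc'.integrableOn_Icc).mono_set Ioc_subset_Icc_self)]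
          simp
        rw [e]
        refine le_trans ?_ (lintegral_sq_le (Continuous.aemeasurable (by fun_prop)))
        gcongr
        exact enorm_integral_le_lintegral_enorm _
    _ = ∫⁻ s, (∫⁻ ω, ‖W t ω - W s.toNNReal ω‖ₑ ^ 2 ∂P) ∂ν :=
        lintegral_lintegral_swap (hm.prod_swap.pow_const 2)
    _ ≤ ∫⁻ s, d ∂ν := by
        refine setLIntegral_mono measurable_const fun s hs => ?_
        rw [hW.lintegral_sub_sq]
        refine mul_le_of_le_one_right' ?_
        rw [← ENNReal.ofReal_one]
        exact ENNReal.ofReal_le_ofReal (abs_sub_toNNReal_le hs.1.le hs.2)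
    _ = d := by simp

end WindowedNoise

/-! ### Uniform-in-time second moment of the mean-field position. -/

section SecondMoment

open Filter Topology Set

variable {Ω : Type*} [MeasurableSpace Ω] {P : Measure Ω} {d : ℕ}
  {α β lam ε c C κ K : ℝ} {A B : Space d → Space d} {C_A C_B : ℝ≥0} {W : ℝ≥0 → Ω → Space d}
  {X₀ : Ω → State d} {Y : ℝ≥0 → Ω → State d}

/-- The dynamics in the variable `y - noise w`: the linear part applied to the shift leaves a force
in `w` on the velocity and one in `w` on the memory variable, to which the derivative `v` of the
window average is added. -/
theorem linDrift_add_noise (y : State d) (f w v : Space d) :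
    linDrift α β lam y f 0 + noise v
      = linDrift α β lam (y - noise w) (f + (lam * √2) • w) (-((α * √2) • w) + √2 • v) := by
  simp only [linDrift, noise, Prod.mk_add_mk, Prod.fst_sub, Prod.snd_sub, smul_sub, sub_zero,
    add_zero, smul_smul]
  refine Prod.ext rfl (Prod.ext ?_ ?_) <;> dsimp only <;> abel

theorem norm_sq_le_sqNorm (x : State d) : ‖x‖ ^ 2 ≤ sqNorm x := by
  have h1 := sq_nonneg ‖x.1‖
  have h2 := sq_nonneg ‖x.2.1‖
  have h3 := sq_nonneg ‖x.2.2‖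
  simp only [sqNorm]
  rw [Prod.norm_def, Prod.norm_def]
  rcases max_choice ‖x.1‖ (max ‖x.2.1‖ ‖x.2.2‖) with h | h <;> rw [h]
  · linarith
  · rcases max_choice ‖x.2.1‖ ‖x.2.2‖ with h | h <;> rw [h] <;> linarith

theorem ofReal_norm_sq {E : Type*} [NormedAddCommGroup E] (x : E) :
    ENNReal.ofReal (‖x‖ ^ 2) = ‖x‖ₑ ^ 2 := by
  rw [ENNReal.ofReal_pow (norm_nonneg _), ofReal_norm]

theorem IsMcKeanVlasov.enorm_conv_zero_le (hB : LipschitzWith C_B B) (hB0 : B 0 = 0)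
    (hY : IsMcKeanVlasov α β lam A B P W X₀ Y) (t : ℝ≥0) :
    ‖conv B (P.map (Y t)) 0‖ₑ ≤ C_B * ∫⁻ ω, ‖(Y t ω).1‖ₑ ∂P := by
  rw [hY.conv_eq hB.continuous]
  refine (enorm_integral_le_lintegral_enorm _).trans ?_
  rw [← lintegral_const_mul' _ _ ENNReal.coe_ne_top]
  refine lintegral_mono fun ω => ?_
  have h := hB (0 - (Y t ω).1) 0
  rwa [edist_eq_enorm_sub, edist_eq_enorm_sub, hB0, sub_zero, sub_zero, zero_sub, enorm_neg,
    ← zero_sub] at h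

variable [IsProbabilityMeasure P]

/-- Along a path, the Lyapunov function of the McKean–Vlasov solution relaxes up to the noise, which
is first made regular by subtracting from `Z` the windowed Brownian path. -/
theorem IsMcKeanVlasov.lyapunov_le (hL : IsLyapunov α β lam ε c C κ K) (hα : 0 ≤ α) (hβ : 0 ≤ β)
    (hlam : 0 ≤ lam) (hA : LipschitzWith C_A A) (hB : LipschitzWith C_B B)
    (hsmall : 8 * K * (C_A + C_B : ℝ) ^ 2 ≤ κ) (hW : IsBrownian W P)
    (hX₀ : Integrable X₀ P) (hY : IsMcKeanVlasov α β lam A B P W X₀ Y) :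
    ∀ᵐ ω ∂P, ∀ t : ℝ≥0, lyapunov β lam ε (Y t ω - noise (windowed W t ω))
      ≤ Real.exp (-(κ / (2 * C)) * t) * lyapunov β lam ε (X₀ ω)
        + ∫ s in (0 : ℝ)..t, Real.exp (-(κ / (2 * C)) * (t - s))
          * (4 * K * (‖A 0‖ ^ 2 + ‖conv B (P.map (Y s.toNNReal)) 0‖ ^ 2
            + (4 * lam ^ 2 + 2 * α ^ 2) * ‖windowed W s.toNNReal ω‖ ^ 2
            + 2 * ‖unitIncrement W s.toNNReal ω‖ ^ 2)) := by
  have hcc := hY.continuous_conv hα hβ hlam hA hB hW hX₀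
  filter_upwards [hY.eq_integral hA.continuous, hY.2.continuous, hW.continuous, hW.eval_zero]
    with ω heq hYc hWc hW0 t
  have hYc' : Continuous fun s : ℝ => Y s.toNNReal ω := hYc.comp continuous_real_toNNReal
  have hWc' : Continuous fun s : ℝ => W s.toNNReal ω := hWc.comp continuous_real_toNNReal
  have hw : Continuous fun s : ℝ => windowed W s.toNNReal ω :=
    (continuous_windowed hWc).comp continuous_real_toNNReal
  have hv : Continuous fun s : ℝ => unitIncrement W s.toNNReal ω :=
    (continuous_unitIncrement hWc).comp continuous_real_toNNReal
  have hg : Continuous fun s : ℝ => conv B (P.map (Y s.toNNReal)) 0 :=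
    hcc.comp (continuous_const.prodMk continuous_real_toNNReal)
  have hg' : Continuous fun s : ℝ => conv B (P.map (Y s.toNNReal)) (Y s.toNNReal ω).1 :=
    hcc.comp ((continuous_fst.comp hYc').prodMk continuous_real_toNNReal)
  have hdrift : Continuous fun s : ℝ => mvDrift α β lam A B (P.map (Y s.toNNReal))
      (Y s.toNNReal ω) := by
    have := hA.continuous
    unfold mvDrift
    fun_prop
  have hder : ∀ s : ℝ, 0 < s →
      HasDerivAt (fun s : ℝ => Y s.toNNReal ω - noise (windowed W s.toNNReal ω))
      (linDrift α β lam (Y s.toNNReal ω - noise (windowed W s.toNNReal ω))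
        (-A (Y s.toNNReal ω).1 - conv B (P.map (Y s.toNNReal)) (Y s.toNNReal ω).1
          + (lam * √2) • windowed W s.toNNReal ω)
        (-((α * √2) • windowed W s.toNNReal ω) + √2 • unitIncrement W s.toNNReal ω)) s := by
    intro s hs
    -- The shifted process is `Y - noise W`, differentiable by the equation, plus the noise of the
    -- window average, differentiable by `hasDerivAt_window`.
    have h1 := hasDerivAt_comp_toNNReal_of_eq_integral (x := fun s => Y s ω - noise (W s ω))
      hdrift (fun t => sub_eq_of_eq_add (heq t).2) hs
    let J : Space d →L[ℝ] State d := (ContinuousLinearMap.inr ℝ _ _).comp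
        ((ContinuousLinearMap.inr ℝ _ _).comp (√2 • ContinuousLinearMap.id ℝ (Space d)))
    have hJ : ∀ w, J w = noise w := fun w => rfl
    have h2 := J.hasFDerivAt.comp_hasDerivAt s (hasDerivAt_window hWc' s)
    refine ((h1.add h2).congr_of_eventuallyEq ?_).congr_deriv ?_
    · filter_upwards [lt_mem_nhds hs] with u hu
      simp only [windowed, Pi.add_apply, Function.comp, hJ, Real.coe_toNNReal u hu.le, ← noise_sub]
      abel
    · rw [← linDrift_add_noise, hJ, unitIncrement, Real.coe_toNNReal s hs.le]
      rfl
  have key := hL.sum_le (d := d) {()} (x := fun _ s => Y s.toNNReal ω - noise (windowed W s.toNNReal ω))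
    (r := fun s => 4 * K * (‖A 0‖ ^ 2 + ‖conv B (P.map (Y s.toNNReal)) 0‖ ^ 2
            + (4 * lam ^ 2 + 2 * α ^ 2) * ‖windowed W s.toNNReal ω‖ ^ 2
            + 2 * ‖unitIncrement W s.toNNReal ω‖ ^ 2))
    (fun _ _ => by fun_prop) (fun _ _ => hder) (by fun_prop) ?_ (NNReal.coe_nonneg t)
  · simp only [Finset.sum_singleton, Real.toNNReal_coe, Real.toNNReal_zero] at key
    -- At time `0` the window sees only the frozen value `W 0 = 0`, so the shift vanishes.
    have h0 : Y 0 ω - noise (windowed W 0 ω) = X₀ ω := by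
      have e1 := (heq 0).2
      have e2 : windowed W 0 ω = 0 := by
        rw [windowed, hW0, intervalIntegral.integral_congr (g := fun _ => 0)]
        · simp
        · intro s hs
          simp only [NNReal.coe_zero, zero_sub] at hs
          rw [uIcc_of_le (by norm_num)] at hs
          simp only [Real.toNNReal_of_nonpos hs.2, hW0]
      rw [e1, e2, hW0]
      simp
    rw [h0] at key
    exact key
  · intro s hs
    simp only [Finset.sum_singleton]
    have := hY.isProbabilityMeasure_map s.toNNReal
    set y := Y s.toNNReal ω
    set μ := P.map (Y s.toNNReal)
    set w := windowed W s.toNNReal ω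
    set v := unitIncrement W s.toNNReal ω
    have hs2 : √2 * √2 = (2 : ℝ) := Real.mul_self_sqrt (by norm_num)
    have n1 : ‖-A y.1 - conv B μ y.1 + (lam * √2) • w‖
        ≤ (C_A + C_B) * ‖y.1‖ + ‖A 0‖ + ‖conv B μ 0‖ + lam * √2 * ‖w‖ := by
      have h1 := norm_le_add_of_lipschitz hA y.1
      have h2 := norm_le_add_of_lipschitz (lipschitzWith_conv hB (hY.1 s.toNNReal)) y.1
      refine (norm_add_le _ _).trans ?_
      have h3 := norm_sub_le (-A y.1) (conv B μ y.1)
      rw [norm_smul, Real.norm_of_nonneg (by positivity)]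
      rw [norm_neg] at h3
      linarith
    have n2 : ‖-((α * √2) • w) + √2 • v‖ ≤ α * √2 * ‖w‖ + √2 * ‖v‖ := by
      refine (norm_add_le _ _).trans_eq ?_
      rw [norm_neg, norm_smul, norm_smul, Real.norm_of_nonneg (by positivity),
        Real.norm_of_nonneg (by positivity)]
    have q1 : ‖-A y.1 - conv B μ y.1 + (lam * √2) • w‖ ^ 2 ≤ 4 * ((C_A + C_B) ^ 2 * ‖y.1‖ ^ 2
        + ‖A 0‖ ^ 2 + ‖conv B μ 0‖ ^ 2 + 2 * lam ^ 2 * ‖w‖ ^ 2) := by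
      refine (pow_le_pow_left₀ (norm_nonneg _) n1 2).trans ?_
      have e : 2 * lam ^ 2 * ‖w‖ ^ 2 = (lam * √2 * ‖w‖) ^ 2 := by
        rw [mul_pow, mul_pow, Real.sq_sqrt (by norm_num)]; ring
      have e' : ((C_A : ℝ) + C_B) ^ 2 * ‖y.1‖ ^ 2 = ((C_A + C_B) * ‖y.1‖) ^ 2 := by ring
      rw [e, e']
      generalize (↑C_A + ↑C_B) * ‖y.1‖ = a1
      generalize ‖A 0‖ = a2
      generalize ‖conv B μ 0‖ = a3
      generalize lam * √2 * ‖w‖ = a4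
      linarith [sq_nonneg (a1 - a2), sq_nonneg (a1 - a3), sq_nonneg (a1 - a4),
        sq_nonneg (a2 - a3), sq_nonneg (a2 - a4), sq_nonneg (a3 - a4)]
    have q2 : ‖-((α * √2) • w) + √2 • v‖ ^ 2 ≤ 4 * (α ^ 2 * ‖w‖ ^ 2 + ‖v‖ ^ 2) := by
      refine (pow_le_pow_left₀ (norm_nonneg _) n2 2).trans ?_
      have e : (α * √2 * ‖w‖ + √2 * ‖v‖) ^ 2 = 2 * (α * ‖w‖ + ‖v‖) ^ 2 := by
        linear_combination (α * ‖w‖ + ‖v‖) ^ 2 * hs2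
      rw [e]
      linarith [sq_nonneg (α * ‖w‖ - ‖v‖)]
    have hyq : ‖y.1‖ ^ 2 ≤ sqNorm (y - noise w) := by
      simp only [sqNorm, noise, Prod.fst_sub, sub_zero]
      have := sq_nonneg ‖(y - ((0 : Space d), (0 : Space d), √2 • w)).2.1‖
      have := sq_nonneg ‖(y - ((0 : Space d), (0 : Space d), √2 • w)).2.2‖
      linarith
    have hK := hL.K_pos
    have hκ := hL.κ_pos
    have b1 : K * (4 * ((C_A + C_B : ℝ) ^ 2 * ‖y.1‖ ^ 2)) ≤ κ / 2 * sqNorm (y - noise w) := by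
      calc K * (4 * ((C_A + C_B : ℝ) ^ 2 * ‖y.1‖ ^ 2))
          = (8 * K * (C_A + C_B : ℝ) ^ 2) / 2 * ‖y.1‖ ^ 2 := by ring
        _ ≤ κ / 2 * sqNorm (y - noise w) := by gcongr
    have b2 : K * (‖-A y.1 - conv B μ y.1 + (lam * √2) • w‖ ^ 2
        + ‖-((α * √2) • w) + √2 • v‖ ^ 2) ≤ K * (4 * ((C_A + C_B) ^ 2 * ‖y.1‖ ^ 2
        + ‖A 0‖ ^ 2 + ‖conv B μ 0‖ ^ 2 + 2 * lam ^ 2 * ‖w‖ ^ 2)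
        + 4 * (α ^ 2 * ‖w‖ ^ 2 + ‖v‖ ^ 2)) := by gcongr
    -- The noise coefficients in the statement are twice what the estimates require; this is the
    -- excess.
    have b3 : 0 ≤ K * (8 * lam ^ 2 * ‖w‖ ^ 2 + 4 * α ^ 2 * ‖w‖ ^ 2 + 4 * ‖v‖ ^ 2) := by positivity
    linarith

theorem fst_norm_sq_le_sqNorm (x : State d) : ‖x.1‖ ^ 2 ≤ sqNorm x := by
  have h2 := sq_nonneg ‖x.2.1‖
  have h3 := sq_nonneg ‖x.2.2‖
  simp only [sqNorm]; linarith

/-- The second moment of the position in the McKean–Vlasov equation is bounded uniformly in time. -/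
theorem IsMcKeanVlasov.lintegral_fst_sq_le (hL : IsLyapunov α β lam ε c C κ K) (hα : 0 ≤ α)
    (hβ : 0 ≤ β) (hlam : 0 ≤ lam) (hA : LipschitzWith C_A A) (hB : LipschitzWith C_B B)
    (hB0 : B 0 = 0) (hsmall : 8 * K * (C_A + C_B : ℝ) ^ 2 ≤ κ)
    (hsmall' : 16 * K * C * (C_A + C_B : ℝ) ^ 2 ≤ c * κ) (hW : IsBrownian W P)
    (hX₀ : Integrable X₀ P) (hY : IsMcKeanVlasov α β lam A B P W X₀ Y) {M₀ : ℝ≥0}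
    (hM₀ : ∫⁻ ω, ENNReal.ofReal (sqNorm (X₀ ω)) ∂P ≤ M₀) (t : ℝ≥0) :
    ∫⁻ ω, ‖(Y t ω).1‖ₑ ^ 2 ∂P ≤ ENNReal.ofReal (2 / c * (C * M₀
      + 8 * K * C / κ * (‖A 0‖ ^ 2 + (4 * lam ^ 2 + 2 * α ^ 2 + 2) * d))) := by
  have hc := hL.c_pos
  have hC := hL.C_pos
  have hκ := hL.κ_pos
  have hK := hL.K_pos
  obtain ⟨M, hM⟩ := hY.exists_lintegral_le hα hβ hlam hA hB hW hX₀ t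
  -- The mean field at `0` is bounded by the first moment of `Q`, so the estimate must be closed on
  -- itself. `S` is known to be finite from the first moment bound; finiteness of the second moments
  -- is not assumed.
  set S : ℝ≥0∞ := ⨆ s : Iic t, (∫⁻ ω, ‖(Y s ω).1‖ₑ ∂P) ^ 2 with hS
  have hSle : S ≤ (M : ℝ≥0∞) ^ 2 := iSup_le fun s => by
    gcongr
    refine (lintegral_mono fun ω => ?_).trans (hM s s.2)
    rw [← ofReal_norm, ← ofReal_norm]
    exact ENNReal.ofReal_le_ofReal (norm_fst_le _)
  have hStop : S ≠ ∞ := (hSle.trans_lt (by finiteness)).ne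
  obtain ⟨σ, hσ⟩ : ∃ σ : ℝ≥0, S = σ := ⟨S.toNNReal, (ENNReal.coe_toNNReal hStop).symm⟩
  set a : ℝ := ‖A 0‖ ^ 2 + C_B ^ 2 * σ with ha
  set b : ℝ := 4 * lam ^ 2 + 2 * α ^ 2 with hb
  have hb0 : 0 ≤ b := by positivity
  have hg : ∀ s ≤ t, ‖conv B (P.map (Y s)) 0‖ ^ 2 ≤ C_B ^ 2 * σ := by
    intro s hs
    rw [← ENNReal.ofReal_le_ofReal_iff (by positivity), ofReal_norm_sq,
      ENNReal.ofReal_mul (by positivity), ENNReal.ofReal_pow (NNReal.coe_nonneg _),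
      ENNReal.ofReal_coe_nnreal, ENNReal.ofReal_coe_nnreal, ← hσ]
    calc _ ≤ (C_B * ∫⁻ ω, ‖(Y s ω).1‖ₑ ∂P) ^ 2 := by
          gcongr; exact hY.enorm_conv_zero_le hB hB0 s
      _ = C_B ^ 2 * (∫⁻ ω, ‖(Y s ω).1‖ₑ ∂P) ^ 2 := mul_pow _ _ _
      _ ≤ C_B ^ 2 * S := by
          gcongr
          exact le_iSup (fun s : Iic t => (∫⁻ ω, ‖(Y s ω).1‖ₑ ∂P) ^ 2) ⟨s, hs⟩
  set ρ : ℝ → Ω → ℝ := fun s ω => 4 * K * (‖A 0‖ ^ 2 + ‖conv B (P.map (Y s.toNNReal)) 0‖ ^ 2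
    + b * ‖windowed W s.toNNReal ω‖ ^ 2 + 2 * ‖unitIncrement W s.toNNReal ω‖ ^ 2) with hρ
  have hρ0 : ∀ s ω, 0 ≤ ρ s ω := fun s ω => by positivity
  have hR : ∀ s ≤ t, ∫⁻ ω, ENNReal.ofReal (ρ s ω) ∂P
      ≤ ENNReal.ofReal (4 * K * (a + b * d + 2 * d)) := by
    intro s hs
    have hmw := (hW.aemeasurable_windowed s).enorm.pow_const 2
    have hmv := (measurable_unitIncrement hW s).enorm.pow_const 2
    calc ∫⁻ ω, ENNReal.ofReal (ρ s ω) ∂P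
        ≤ ∫⁻ ω, ENNReal.ofReal (4 * K) * (ENNReal.ofReal a + ENNReal.ofReal b
          * ‖windowed W s ω‖ₑ ^ 2 + ENNReal.ofReal 2 * ‖unitIncrement W s ω‖ₑ ^ 2) ∂P := by
          refine lintegral_mono fun ω => ?_
          rw [← ofReal_norm_sq, ← ofReal_norm_sq, ← ENNReal.ofReal_mul hb0,
            ← ENNReal.ofReal_add (by positivity) (by positivity),
            ← ENNReal.ofReal_mul zero_le_two,
            ← ENNReal.ofReal_add (by positivity) (by positivity),
            ← ENNReal.ofReal_mul (by positivity)]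
          refine ENNReal.ofReal_le_ofReal ?_
          simp only [hρ, Real.toNNReal_coe, ha]
          gcongr
          exact hg s hs
      _ = ENNReal.ofReal (4 * K) * (ENNReal.ofReal a + ENNReal.ofReal b
          * (∫⁻ ω, ‖windowed W s ω‖ₑ ^ 2 ∂P) + ENNReal.ofReal 2 * ∫⁻ ω, ‖unitIncrement W s ω‖ₑ ^ 2 ∂P) := by
          rw [lintegral_const_mul' _ _ ENNReal.ofReal_ne_top,
            lintegral_add_right _ (hmv.const_mul _), lintegral_add_left measurable_const,
            lintegral_const_mul' _ _ ENNReal.ofReal_ne_top,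
            lintegral_const_mul' _ _ ENNReal.ofReal_ne_top, lintegral_const, measure_univ, mul_one]
      _ ≤ ENNReal.ofReal (4 * K) * (ENNReal.ofReal a + ENNReal.ofReal b * d + ENNReal.ofReal 2 * d) := by
          gcongr
          · exact hW.lintegral_windowed_sq_le s
          · exact hW.lintegral_unitIncrement_sq_le s
      _ = _ := by
          rw [← ENNReal.ofReal_natCast, ← ENNReal.ofReal_mul hb0,
            ← ENNReal.ofReal_add (by positivity) (by positivity),
            ← ENNReal.ofReal_mul zero_le_two,
            ← ENNReal.ofReal_add (by positivity) (by positivity),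
            ← ENNReal.ofReal_mul (by positivity)]
  set F : ℝ := 1 / c * (C * M₀ + 4 * K * (a + b * d + 2 * d) * (2 * C / κ)) with hF
  have hF0 : 0 ≤ F := by positivity
  have hQ : ∀ s ≤ t, ∫⁻ ω, ‖(Y s ω).1‖ₑ ^ 2 ∂P ≤ ENNReal.ofReal F := by
    intro s hs
    have hmX : AEMeasurable X₀ P := hX₀.aemeasurable
    have hρm : AEMeasurable (fun p : ℝ × Ω => ρ p.1 p.2)
        ((volume.restrict (Ioc 0 (s : ℝ))).prod P) := by
      have hgc : Continuous fun s : ℝ => conv B (P.map (Y s.toNNReal)) 0 :=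
        (hY.continuous_conv hα hβ hlam hA hB hW hX₀).comp
          (continuous_const.prodMk continuous_real_toNNReal)
      have h1 := aemeasurable_uncurry_toNNReal₀ hW.aemeasurable_windowed
        (hW.continuous.mono fun ω h => continuous_windowed h) (volume.restrict (Ioc 0 (s : ℝ)))
      have h2 := aemeasurable_uncurry_toNNReal (measurable_unitIncrement hW)
        (hW.continuous.mono fun ω h => continuous_unitIncrement h)
        (volume.restrict (Ioc 0 (s : ℝ)))
      have h3 : AEMeasurable (fun p : ℝ × Ω => ‖conv B (P.map (Y p.1.toNNReal)) 0‖ ^ 2)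
          ((volume.restrict (Ioc 0 (s : ℝ))).prod P) :=
        ((hgc.norm.pow 2).measurable.comp measurable_fst).aemeasurable
      exact (((h3.const_add _).add ((h1.norm.pow_const 2).const_mul b)).add
        ((h2.norm.pow_const 2).const_mul 2)).const_mul (4 * K)
    have hrel := lintegral_le_of_relaxation (P := P) (κ := κ / (2 * C)) (by positivity)
      (NNReal.coe_nonneg s) (v := fun ω => lyapunov β lam ε (Y s ω - noise (windowed W s ω)))
      (v₀ := fun ω => lyapunov β lam ε (X₀ ω)) (r := ρ)
      ((continuous_lyapunov β lam ε).measurable.comp_aemeasurable hmX)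
      (fun ω => hL.lyapunov_nonneg _) hρm hρ0 (R := ENNReal.ofReal (4 * K * (a + b * d + 2 * d)))
      (fun u hu => ?_)
      ((hY.lyapunov_le hL hα hβ hlam hA hB hsmall hW hX₀).mono fun ω h => h s)
    · calc ∫⁻ ω, ‖(Y s ω).1‖ₑ ^ 2 ∂P
          ≤ ∫⁻ ω, ENNReal.ofReal (1 / c) * ENNReal.ofReal
            (lyapunov β lam ε (Y s ω - noise (windowed W s ω))) ∂P := by
            refine lintegral_mono fun ω => ?_
            rw [← ofReal_norm_sq, ← ENNReal.ofReal_mul (by positivity)]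
            refine ENNReal.ofReal_le_ofReal ?_
            have h1 := fst_norm_sq_le_sqNorm (Y s ω - noise (windowed W s ω))
            simp only [noise, Prod.fst_sub, sub_zero] at h1
            refine h1.trans ?_
            rw [one_div, ← div_eq_inv_mul, le_div_iff₀ hc, mul_comm]
            exact hL.le_lyapunov _
        _ = ENNReal.ofReal (1 / c) * ∫⁻ ω, ENNReal.ofReal
            (lyapunov β lam ε (Y s ω - noise (windowed W s ω))) ∂P :=
            lintegral_const_mul' _ _ ENNReal.ofReal_ne_top
        _ ≤ ENNReal.ofReal (1 / c) * (ENNReal.ofReal (C * M₀)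
            + ENNReal.ofReal (4 * K * (a + b * d + 2 * d)) * ENNReal.ofReal (1 / (κ / (2 * C)))) := by
            gcongr
            refine hrel.trans ?_
            gcongr
            rw [ENNReal.ofReal_mul hC.le, ENNReal.ofReal_coe_nnreal]
            refine le_trans ?_ (mul_le_mul_right hM₀ _)
            rw [← lintegral_const_mul' _ _ ENNReal.ofReal_ne_top]
            refine lintegral_mono fun ω => ?_
            rw [← ENNReal.ofReal_mul hC.le]
            exact ENNReal.ofReal_le_ofReal (hL.lyapunov_le _)
        _ = ENNReal.ofReal F := by
            rw [← ENNReal.ofReal_mul (by positivity),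
              ← ENNReal.ofReal_add (by positivity) (by positivity),
              ← ENNReal.ofReal_mul (by positivity), hF, one_div_div]
    · rw [← Real.coe_toNNReal u hu.1.le]
      exact hR _ ((Real.toNNReal_le_iff_le_coe.2 hu.2).trans hs)
  -- Squared first moments are at most second moments, so `σ ≤ F`; since `F ≤ D + σ / 2` by
  -- smallness of `C_B`, it follows that `F ≤ 2D`, a bound that does not involve `t`.
  have hσF : (σ : ℝ) ≤ F := by
    rw [← ENNReal.ofReal_le_ofReal_iff hF0, ENNReal.ofReal_coe_nnreal, ← hσ]
    refine iSup_le fun s => le_trans (lintegral_sq_le ?_) (hQ s s.2)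
    exact (measurable_fst.comp (hY.2.measurable s)).enorm.aemeasurable
  refine (hQ t le_rfl).trans (ENNReal.ofReal_le_ofReal ?_)
  set D : ℝ := 1 / c * (C * M₀ + 8 * K * C / κ * (‖A 0‖ ^ 2 + (b + 2) * d)) with hD
  have hFD : F ≤ D + σ / 2 := by
    have hq : 8 * K * C * C_B ^ 2 / (c * κ) ≤ (1 / 2 : ℝ) := by
      rw [div_le_iff₀ (by positivity)]
      have h1 : (C_B : ℝ) ^ 2 ≤ (C_A + C_B) ^ 2 := by gcongr; simp
      have h2 : 16 * K * C * (C_B : ℝ) ^ 2 ≤ 16 * K * C * (C_A + C_B) ^ 2 := by gcongr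
      linarith
    have e : F = D + 8 * K * C * C_B ^ 2 / (c * κ) * σ := by
      rw [hF, hD, ha]; field_simp; ring
    rw [e]
    have := mul_le_mul_of_nonneg_right hq (NNReal.coe_nonneg σ)
    linarith
  calc F ≤ 2 * D := by linarith
    _ = _ := by rw [hD]; ring

end SecondMoment

/-! ### Law of large numbers for the interaction force. -/

section Fluctuation

open Filter Topology Set

variable {Ω : Type*} [MeasurableSpace Ω] {P : Measure Ω} {d : ℕ} {A B : Space d → Space d}
  {C_A C_B : ℝ≥0}

/-- If `G z x` is centred in `x` under the law of `U`, and `U` is independent of `Z`, then `G Z U` is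
orthogonal to every function of `Z`. -/
theorem integral_inner_eq_zero_of_indepFun [IsProbabilityMeasure P] {S T : Type*}
    [MeasurableSpace S] [MeasurableSpace T] {Z : Ω → S} {U : Ω → T} (hZ : Measurable Z)
    (hU : Measurable U) (hind : IndepFun Z U P) {F : S → Space d} {G : S × T → Space d}
    (hF : Measurable F) (hG : Measurable G) (hGi : ∀ z, Integrable (fun x => G (z, x)) (P.map U))
    (hG0 : ∀ z, ∫ x, G (z, x) ∂(P.map U) = 0) :
    ∫ ω, inner ℝ (F (Z ω)) (G (Z ω, U ω)) ∂P = 0 := by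
  have := Measure.isProbabilityMeasure_map (μ := P) hZ.aemeasurable
  have := Measure.isProbabilityMeasure_map (μ := P) hU.aemeasurable
  have hm : Measurable fun p : S × T => inner ℝ (F p.1) (G p) := (hF.comp measurable_fst).inner hG
  have h1 : ∫ ω, inner ℝ (F (Z ω)) (G (Z ω, U ω)) ∂P
      = ∫ p, inner ℝ (F p.1) (G p) ∂((P.map Z).prod (P.map U)) := by
    rw [← (indepFun_iff_map_prod_eq_prod_map_map hZ.aemeasurable hU.aemeasurable).1 hind,
      integral_map (hZ.prodMk hU).aemeasurable hm.aestronglyMeasurable]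
  rw [h1]
  -- If the inner product is not integrable its integral is `0` by convention, so no joint
  -- integrability is required.
  by_cases hi : Integrable (fun p : S × T => inner ℝ (F p.1) (G p)) ((P.map Z).prod (P.map U))
  · rw [integral_prod _ hi]
    simp only [integral_inner (hGi _), hG0, inner_zero_right, integral_zero]
  · exact integral_undef hi

/-- Given `(X, Y)`, the first factor is fixed and the second averages to zero over `U`, because
`conv B μ` is precisely the mean over `U`. -/
theorem integral_inner_interaction_eq_zero [IsProbabilityMeasure P] {X Y U : Ω → State d}
    (hX : Measurable X) (hY : Measurable Y) (hU : Measurable U)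
    (hind : IndepFun (fun ω => (X ω, Y ω)) U P) {μ : Measure (State d)} [IsProbabilityMeasure μ]
    (hlaw : P.map U = μ) (hB : Continuous B) (hc : Continuous (conv B μ))
    (hint : ∀ q, Integrable (fun x : State d => B (q - x.1)) μ) :
    ∫ ω, inner ℝ (B ((X ω).1 - (Y ω).1) - conv B μ (X ω).1)
      (B ((X ω).1 - (U ω).1) - conv B μ (X ω).1) ∂P = 0 := by
  have hF : Measurable fun z : State d × State d => B (z.1.1 - z.2.1) - conv B μ z.1.1 := by
    have h1 : Measurable fun z : State d × State d => z.1.1 - z.2.1 :=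
      measurable_fst.fst.sub measurable_snd.fst
    exact (hB.measurable.comp h1).sub (hc.measurable.comp measurable_fst.fst)
  have hG : Measurable fun p : (State d × State d) × State d =>
      B (p.1.1.1 - p.2.1) - conv B μ p.1.1.1 := by
    have h1 : Measurable fun p : (State d × State d) × State d => p.1.1.1 - p.2.1 :=
      measurable_fst.fst.fst.sub measurable_snd.fst
    exact (hB.measurable.comp h1).sub (hc.measurable.comp measurable_fst.fst.fst)
  refine integral_inner_eq_zero_of_indepFun (Z := fun ω => (X ω, Y ω))
    (F := fun z => B (z.1.1 - z.2.1) - conv B μ z.1.1)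
    (G := fun p => B (p.1.1.1 - p.2.1) - conv B μ p.1.1.1)
    (hX.prodMk hY) hU hind hF hG (fun z => ?_) fun z => ?_
  · rw [hlaw]
    exact (hint z.1.1).sub (integrable_const (conv B μ z.1.1))
  · rw [hlaw]
    refine (integral_sub (hint z.1.1) (integrable_const (conv B μ z.1.1))).trans ?_
    rw [integral_const, probReal_univ, one_smul, conv, sub_self]

variable {ι : Type*} [Fintype ι]

/-- Law of large numbers in `L²` for the empirical interaction force. -/
theorem lintegral_fluctuation_sq_le [IsProbabilityMeasure P] {Y : ι → Ω → State d}
    (hm : ∀ i, Measurable (Y i)) (hind : iIndepFun Y P) {μ : Measure (State d)}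
    (hlaw : ∀ i, P.map (Y i) = μ) (hB : LipschitzWith C_B B) (hB0 : B 0 = 0) {M : ℝ≥0}
    (hM : ∀ i, ∫⁻ ω, ‖(Y i ω).1‖ₑ ^ 2 ∂P ≤ M) (i : ι) :
    ∫⁻ ω, ‖(Fintype.card ι : ℝ)⁻¹ • ∑ j, B ((Y i ω).1 - (Y j ω).1) - conv B μ (Y i ω).1‖ₑ ^ 2 ∂P
      ≤ ENNReal.ofReal (16 * C_B ^ 2 * M / Fintype.card ι) := by
  have hBn : ∀ x, ‖B x‖ ≤ C_B * ‖x‖ := fun x => by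
    simpa [hB0] using norm_le_add_of_lipschitz hB x
  have hQ : ∀ j, MemLp (fun ω => (Y j ω).1) 2 P := fun j => by
    refine ⟨(measurable_fst.comp (hm j)).aestronglyMeasurable, ?_⟩
    rw [eLpNorm_lt_top_iff_lintegral_rpow_enorm_lt_top (by norm_num) (by norm_num)]
    simpa using (hM j).trans_lt ENNReal.coe_lt_top
  have hQsq : ∀ j, ∫ ω, ‖(Y j ω).1‖ ^ 2 ∂P ≤ M := fun j => by
    have h1 : Measurable fun ω => ‖(Y j ω).1‖ ^ 2 := (measurable_fst.comp (hm j)).norm.pow_const 2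
    rw [integral_eq_lintegral_of_nonneg_ae (ae_of_all _ fun ω => sq_nonneg _)
      h1.aestronglyMeasurable]
    simp_rw [ofReal_norm_sq]
    exact ENNReal.toReal_le_of_le_ofReal M.2 ((hM j).trans_eq (ENNReal.ofReal_coe_nnreal).symm)
  have hYm : ∀ (j : ι), IsProbabilityMeasure (P.map (Y j)) := fun j =>
    Measure.isProbabilityMeasure_map (hm j).aemeasurable
  have hμ : IsProbabilityMeasure μ := hlaw i ▸ hYm i
  have hint : ∀ q, Integrable (fun x : State d => B (q - x.1)) μ := fun q => by
    have hc : Continuous fun x : State d => B (q - x.1) := by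
      have := hB.continuous; fun_prop
    rw [← hlaw i, integrable_map_measure hc.aestronglyMeasurable (hm i).aemeasurable]
    have h1 : Integrable (fun ω => (C_B : ℝ) * (‖q‖ + ‖(Y i ω).1‖)) P :=
      ((integrable_const ‖q‖).add ((hQ i).integrable one_le_two).norm).const_mul _
    refine h1.mono' (hc.measurable.comp (hm i)).aestronglyMeasurable (ae_of_all _ fun ω => ?_)
    refine (hBn _).trans ?_
    gcongr
    exact norm_sub_le _ _
  have hcl := lipschitzWith_conv hB hint
  set m : ℝ := ∫ ω, ‖(Y i ω).1‖ ∂P with hmdef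
  have hm0 : 0 ≤ m := integral_nonneg fun _ => norm_nonneg _
  have hm2 : m ^ 2 ≤ M := by
    refine le_trans ?_ (hQsq i)
    have := variance_nonneg (fun ω => ‖(Y i ω).1‖) P
    rw [variance_eq_sub (hQ i).norm] at this
    simpa [hmdef] using this
  have hc0 : ‖conv B μ 0‖ ≤ C_B * m := by
    rw [conv, ← hlaw i, integral_map (hm i).aemeasurable (Continuous.aestronglyMeasurable (by
      have := hB.continuous; fun_prop)), hmdef, ← integral_const_mul]
    refine norm_integral_le_of_norm_le (((hQ i).integrable one_le_two).norm.const_mul _)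
      (ae_of_all _ fun ω => ?_)
    refine (hBn _).trans ?_
    rw [zero_sub, norm_neg]
  set b : ι → Ω → Space d := fun j ω => B ((Y i ω).1 - (Y j ω).1) - conv B μ (Y i ω).1 with hb
  have hbm : ∀ j, Measurable (b j) := fun j =>
    (hB.continuous.measurable.comp ((measurable_fst.comp (hm i)).sub
      (measurable_fst.comp (hm j)))).sub (hcl.continuous.measurable.comp
        (measurable_fst.comp (hm i)))
  have hbn : ∀ j ω, ‖b j ω‖ ≤ C_B * (2 * ‖(Y i ω).1‖ + ‖(Y j ω).1‖ + m) := fun j ω => by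
    have h1 := hBn ((Y i ω).1 - (Y j ω).1)
    have h2 := norm_le_add_of_lipschitz hcl (Y i ω).1
    have h3 := mul_le_mul_of_nonneg_left (norm_sub_le (Y i ω).1 (Y j ω).1) (NNReal.coe_nonneg C_B)
    have h4 := norm_sub_le (B ((Y i ω).1 - (Y j ω).1)) (conv B μ (Y i ω).1)
    simp only [hb]
    linarith
  have hbL : ∀ j, MemLp (b j) 2 P := fun j => by
    have h1 : MemLp (fun ω => C_B * (2 * ‖(Y i ω).1‖ + ‖(Y j ω).1‖ + m)) 2 P :=
      ((((hQ i).norm.const_mul 2).add (hQ j).norm).add (memLp_const m)).const_mul (C_B : ℝ)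
    exact h1.mono' (hbm j).aestronglyMeasurable (ae_of_all _ (hbn j))
  have hbsq : ∀ j, ∫ ω, ‖b j ω‖ ^ 2 ∂P ≤ 16 * C_B ^ 2 * M := fun j => by
    have i1 := (hQ i).integrable_norm_pow two_ne_zero
    have i2 := (hQ j).integrable_norm_pow two_ne_zero
    have i12 : Integrable (fun ω => 2 * ‖(Y i ω).1‖ ^ 2 + ‖(Y j ω).1‖ ^ 2) P := (i1.const_mul 2).add i2
    have i3 : Integrable (fun ω => 4 * (C_B : ℝ) ^ 2 * (2 * ‖(Y i ω).1‖ ^ 2 + ‖(Y j ω).1‖ ^ 2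
        + m ^ 2)) P := (i12.add (integrable_const _)).const_mul _
    calc ∫ ω, ‖b j ω‖ ^ 2 ∂P ≤ ∫ ω, 4 * (C_B : ℝ) ^ 2 * (2 * ‖(Y i ω).1‖ ^ 2 + ‖(Y j ω).1‖ ^ 2
        + m ^ 2) ∂P := by
          refine integral_mono ((hbL j).integrable_norm_pow two_ne_zero) i3 fun ω => ?_
          refine (pow_le_pow_left₀ (norm_nonneg _) (hbn j ω) 2).trans ?_
          rw [mul_pow, mul_comm 4, mul_assoc]
          gcongr
          generalize ‖(Y i ω).1‖ = u
          generalize ‖(Y j ω).1‖ = v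
          linarith [sq_nonneg (u - v), sq_nonneg (u - m), sq_nonneg (v - m)]
      _ = 4 * (C_B : ℝ) ^ 2 * (2 * (∫ ω, ‖(Y i ω).1‖ ^ 2 ∂P) + (∫ ω, ‖(Y j ω).1‖ ^ 2 ∂P)
        + m ^ 2) := by
          rw [integral_const_mul, integral_add i12 (integrable_const _),
            integral_add (i1.const_mul 2) i2, integral_const_mul]
          simp
      _ ≤ 4 * (C_B : ℝ) ^ 2 * (2 * M + M + M) := by
          gcongr
          · exact hQsq i
          · exact hQsq j
      _ = _ := by ring
  have hcross : ∀ j k, k ≠ i → k ≠ j → ∫ ω, inner ℝ (b j ω) (b k ω) ∂P = 0 := by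
    intro j k hki hkj
    have hI := hind.indepFun_prodMk hm i j k hki.symm hkj.symm
    exact integral_inner_interaction_eq_zero (hm i) (hm j) (hm k) hI (hlaw k) hB.continuous
      hcl.continuous hint
  -- Of two distinct indices at least one differs from `i`, and the summand with that index is
  -- centred given the other variables. The self-interaction term `b i` need not be centred, but it
  -- is orthogonal to the others.
  have hcross' : ∀ j k, j ≠ k → ∫ ω, inner ℝ (b j ω) (b k ω) ∂P = 0 := by
    intro j k hjk
    by_cases hki : k = i
    · simp_rw [real_inner_comm (b k _)]
      exact hcross k j (hki ▸ hjk) hjk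
    · exact hcross j k hki hjk.symm
  -- Only the `N` diagonal terms survive; after division by `N²` the mean square is `O(1/N)`.
  have hsum : ∫ ω, ‖∑ j, b j ω‖ ^ 2 ∂P ≤ Fintype.card ι * (16 * C_B ^ 2 * M) := by
    simp_rw [← real_inner_self_eq_norm_sq, sum_inner, inner_sum]
    have hii : ∀ j k, Integrable (fun ω => inner ℝ (b j ω) (b k ω)) P := fun j k =>
      ((hbL j).norm.integrable_mul (hbL k).norm).mono'
        ((hbm j).inner (hbm k)).aestronglyMeasurable
        (ae_of_all _ fun ω => norm_inner_le_norm _ _)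
    rw [integral_finsetSum _ fun j _ => integrable_finsetSum _ fun k _ => hii j k]
    simp_rw [integral_finsetSum _ fun k _ => hii _ k]
    calc ∑ j, ∑ k, ∫ ω, inner ℝ (b j ω) (b k ω) ∂P
        = ∑ j, ∫ ω, inner ℝ (b j ω) (b j ω) ∂P := Finset.sum_congr rfl fun j _ =>
          Finset.sum_eq_single j (fun k _ hk => hcross' j k hk.symm) (by simp)
      _ ≤ ∑ _j : ι, 16 * (C_B : ℝ) ^ 2 * M := by
          refine Finset.sum_le_sum fun j _ => ?_
          simp_rw [real_inner_self_eq_norm_sq]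
          exact hbsq j
      _ = _ := by simp
  have hN : (0 : ℝ) < Fintype.card ι := by
    have : Nonempty ι := ⟨i⟩
    exact_mod_cast Fintype.card_pos
  have hR : ∀ ω, (Fintype.card ι : ℝ)⁻¹ • ∑ j, B ((Y i ω).1 - (Y j ω).1) - conv B μ (Y i ω).1
      = (Fintype.card ι : ℝ)⁻¹ • ∑ j, b j ω := fun ω => by
    simp only [hb, Finset.sum_sub_distrib, Finset.sum_const, Finset.card_univ, smul_sub,
      ← Nat.cast_smul_eq_nsmul ℝ, smul_smul]
    rw [inv_mul_cancel₀ hN.ne', one_smul]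
  have hi2 : Integrable (fun ω => ‖∑ j, b j ω‖ ^ 2) P :=
    (memLp_finsetSum Finset.univ fun j _ => hbL j).integrable_norm_pow two_ne_zero
  calc _ = ∫⁻ ω, ENNReal.ofReal ((Fintype.card ι : ℝ)⁻¹ ^ 2 * ‖∑ j, b j ω‖ ^ 2) ∂P := by
        refine lintegral_congr fun ω => ?_
        rw [hR, ← ofReal_norm_sq, norm_smul, mul_pow, Real.norm_of_nonneg (by positivity)]
    _ = ENNReal.ofReal (∫ ω, (Fintype.card ι : ℝ)⁻¹ ^ 2 * ‖∑ j, b j ω‖ ^ 2 ∂P) :=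
        (ofReal_integral_eq_lintegral_ofReal (hi2.const_mul _)
          (ae_of_all _ fun ω => by positivity)).symm
    _ ≤ _ := by
        refine ENNReal.ofReal_le_ofReal ?_
        rw [integral_const_mul]
        calc _ ≤ (Fintype.card ι : ℝ)⁻¹ ^ 2 * (Fintype.card ι * (16 * C_B ^ 2 * M)) := by gcongr
          _ = _ := by field_simp

/-- The difference of the forces in two particle configurations, one of them in the field `g`. -/
theorem norm_force_sub_sq_le (hA : LipschitzWith C_A A) (hB : LipschitzWith C_B B)
    (q q' : ι → Space d) (g : Space d) (i : ι) :
    ‖-A (q i) - (Fintype.card ι : ℝ)⁻¹ • ∑ j, B (q i - q j) - (-A (q' i) - g)‖ ^ 2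
      ≤ 3 * ((C_A + C_B) ^ 2 * ‖q i - q' i‖ ^ 2
        + (C_A + C_B) ^ 2 * ((Fintype.card ι : ℝ)⁻¹ * ∑ j, ‖q j - q' j‖ ^ 2)
        + ‖(Fintype.card ι : ℝ)⁻¹ • ∑ j, B (q' i - q' j) - g‖ ^ 2) := by
  have hN : (0 : ℝ) < Fintype.card ι := by
    have : Nonempty ι := ⟨i⟩
    exact_mod_cast Fintype.card_pos
  set N : ℝ := (Fintype.card ι : ℝ)
  set R := N⁻¹ • ∑ j, B (q' i - q' j) - g with hR
  set a := ‖q i - q' i‖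
  set s := N⁻¹ * ∑ j, ‖q j - q' j‖ with hs
  have h1 : ‖A (q i) - A (q' i)‖ ≤ C_A * a := by
    simpa only [dist_eq_norm] using hA.dist_le_mul (q i) (q' i)
  have h2 : ‖N⁻¹ • ∑ j, (B (q i - q j) - B (q' i - q' j))‖ ≤ C_B * a + C_B * s := by
    rw [norm_smul, Real.norm_of_nonneg (by positivity)]
    calc N⁻¹ * ‖∑ j, (B (q i - q j) - B (q' i - q' j))‖
        ≤ N⁻¹ * ∑ j, (C_B * a + C_B * ‖q j - q' j‖) := by
          gcongr
          refine norm_sum_le_of_le _ fun j _ => ?_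
          have := hB.dist_le_mul (q i - q j) (q' i - q' j)
          rw [dist_eq_norm, dist_eq_norm] at this
          refine this.trans ?_
          rw [← mul_add, sub_sub_sub_comm]
          gcongr
          exact norm_sub_le _ _
      _ = C_B * a + C_B * s := by
          rw [Finset.sum_add_distrib, Finset.sum_const, Finset.card_univ, nsmul_eq_mul,
            ← Finset.mul_sum, hs]
          change N⁻¹ * (N * (C_B * a) + _) = _
          field_simp
  have e : -A (q i) - N⁻¹ • ∑ j, B (q i - q j) - (-A (q' i) - g)
      = -(A (q i) - A (q' i)) - N⁻¹ • (∑ j, (B (q i - q j) - B (q' i - q' j))) - R := by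
    rw [hR, Finset.sum_sub_distrib, smul_sub]; abel
  have hs0 : 0 ≤ s := by positivity
  have ha0 : 0 ≤ a := norm_nonneg _
  -- The coefficient `C_B` of the average `s` is enlarged to `C_A + C_B`, so that a single smallness
  -- parameter remains.
  have h3 : ‖-A (q i) - N⁻¹ • ∑ j, B (q i - q j) - (-A (q' i) - g)‖
      ≤ (C_A + C_B) * a + (C_A + C_B) * s + ‖R‖ := by
    rw [e]
    have n1 := norm_sub_le (-(A (q i) - A (q' i)) - N⁻¹ • (∑ j, (B (q i - q j) - B (q' i - q' j)))) R
    have n2 := norm_sub_le (-(A (q i) - A (q' i))) (N⁻¹ • (∑ j, (B (q i - q j) - B (q' i - q' j))))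
    rw [norm_neg] at n2
    have := mul_nonneg (NNReal.coe_nonneg C_A) hs0
    linarith
  have hs2 : s ^ 2 ≤ N⁻¹ * ∑ j, ‖q j - q' j‖ ^ 2 := by
    have := sq_sum_le_card_mul_sum_sq (s := Finset.univ) (f := fun j => ‖q j - q' j‖)
    rw [Finset.card_univ] at this
    rw [hs, mul_pow]
    calc _ ≤ N⁻¹ ^ 2 * (N * ∑ j, ‖q j - q' j‖ ^ 2) := by gcongr
      _ = _ := by field_simp
  refine (pow_le_pow_left₀ (norm_nonneg _) h3 2).trans ?_
  have h4 := mul_le_mul_of_nonneg_left hs2 (sq_nonneg ((C_A : ℝ) + C_B))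
  have h5 : ((C_A + C_B) * a + (C_A + C_B) * s + ‖R‖) ^ 2
      ≤ 3 * (((C_A + C_B) * a) ^ 2 + ((C_A + C_B) * s) ^ 2 + ‖R‖ ^ 2) := by
    generalize ((C_A : ℝ) + C_B) * a = u
    generalize ((C_A : ℝ) + C_B) * s = v
    linarith [sq_nonneg (u - v), sq_nonneg (u - ‖R‖), sq_nonneg (v - ‖R‖)]
  rw [mul_pow, mul_pow] at h5
  linarith

end Fluctuation

/-! ### Pathwise comparison of the particles with their mean-field limits. -/

section Coupling

open Filter Topology Set

variable {Ω : Type*} [MeasurableSpace Ω] {P : Measure Ω} [IsProbabilityMeasure P] {d : ℕ}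
  {α β lam ε c C κ K : ℝ} {A B : Space d → Space d} {C_A C_B : ℝ≥0} {ι : Type*} [Fintype ι]
  {ρ₀ : Measure (State d)} {W : ι → ℝ≥0 → Ω → Space d} {X₀ : ι → Ω → State d}
  {X Y : ι → ℝ≥0 → Ω → State d}

/-- The difference between the empirical interaction force and the mean-field force. -/
noncomputable def fluctuation (B : Space d → Space d) (P : Measure Ω)
    (Y : ι → ℝ≥0 → Ω → State d) (i : ι) (t : ℝ≥0) (ω : Ω) : Space d :=
  (Fintype.card ι : ℝ)⁻¹ • ∑ j, B ((Y i t ω).1 - (Y j t ω).1) - conv B (P.map (Y i t)) (Y i t ω).1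

/-- The noise cancels in the difference of the particle system and its mean-field limit. -/
theorem IsParticleSystem.ae_hasDerivAt_sub (hα : 0 ≤ α) (hβ : 0 ≤ β) (hlam : 0 ≤ lam)
    (hA : LipschitzWith C_A A) (hB : LipschitzWith C_B B) (h : IsDrivingData P ρ₀ W X₀)
    (hX₀ : ∀ i, Integrable (X₀ i) P) (hX : IsParticleSystem α β lam A B P W X₀ X)
    (hY : ∀ i, IsMcKeanVlasov α β lam A B P (W i) (X₀ i) (Y i)) :
    ∀ᵐ ω ∂P, ∀ i, (Continuous fun t => X i t ω - Y i t ω) ∧ X i 0 ω - Y i 0 ω = 0 ∧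
      (Continuous fun t => fluctuation B P Y i t ω) ∧
      ∀ t : ℝ, 0 < t → HasDerivAt (fun s : ℝ => X i s.toNNReal ω - Y i s.toNNReal ω)
        (linDrift α β lam (X i t.toNNReal ω - Y i t.toNNReal ω)
          (-A (X i t.toNNReal ω).1 - (Fintype.card ι : ℝ)⁻¹ • ∑ j, B ((X i t.toNNReal ω).1
            - (X j t.toNNReal ω).1) - (-A (Y i t.toNNReal ω).1
            - conv B (P.map (Y i t.toNNReal)) (Y i t.toNNReal ω).1)) 0) t := by
  have hXc : ∀ᵐ ω ∂P, ∀ i, Continuous fun t => X i t ω := ae_all_iff.2 fun i => (hX i).continuous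
  have hYc : ∀ᵐ ω ∂P, ∀ i, Continuous fun t => Y i t ω :=
    ae_all_iff.2 fun i => (hY i).2.continuous
  filter_upwards [hXc, hYc, ae_all_iff.2 fun i => (hX i).eq_integral hA.continuous,
    ae_all_iff.2 fun i => (hY i).eq_integral hA.continuous] with ω hXc hYc hXe hYe i
  have hAc := hA.continuous
  have hBc := hB.continuous
  have hX' : ∀ j, Continuous fun s : ℝ => X j s.toNNReal ω :=
    fun j => (hXc j).comp continuous_real_toNNReal
  have hconv : Continuous fun t : ℝ≥0 => conv B (P.map (Y i t)) (Y i t ω).1 := by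
    have h1 : Continuous fun t : ℝ≥0 => ((Y i t ω).1, t) :=
      (continuous_fst.comp (hYc i)).prodMk continuous_id
    exact ((hY i).continuous_conv hα hβ hlam hA hB (h.brownian i) (hX₀ i)).comp h1
  have hsumc : ∀ {Z : ι → ℝ≥0 → Ω → State d}, (∀ j, Continuous fun t => Z j t ω) →
      Continuous fun t : ℝ≥0 => (Fintype.card ι : ℝ)⁻¹ • ∑ j, B ((Z i t ω).1 - (Z j t ω).1) := by
    intro Z hZ
    have h1 : ∀ j, Continuous fun t : ℝ≥0 => B ((Z i t ω).1 - (Z j t ω).1) := fun j =>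
      hBc.comp ((continuous_fst.comp (hZ i)).sub (continuous_fst.comp (hZ j)))
    exact (continuous_finsetSum _ fun j _ => h1 j).const_smul (Fintype.card ι : ℝ)⁻¹
  have hd1 : Continuous fun s : ℝ => linDrift α β lam (X i s.toNNReal ω) (-A (X i s.toNNReal ω).1
      - (Fintype.card ι : ℝ)⁻¹ • ∑ j, B ((X i s.toNNReal ω).1 - (X j s.toNNReal ω).1)) 0 := by
    have h1 := (hsumc hXc).comp continuous_real_toNNReal
    have h2 := hX' i
    exact Continuous.linDrift h2 ((hAc.comp (continuous_fst.comp h2)).neg.sub h1) continuous_const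
  have hd2 : Continuous fun s : ℝ => mvDrift α β lam A B (P.map (Y i s.toNNReal))
      (Y i s.toNNReal ω) := by
    have h1 := hconv.comp continuous_real_toNNReal
    have h2 : Continuous fun s : ℝ => Y i s.toNNReal ω := (hYc i).comp continuous_real_toNNReal
    exact Continuous.linDrift h2 ((hAc.comp (continuous_fst.comp h2)).neg.sub h1) continuous_const
  refine ⟨(hXc i).sub (hYc i), ?_, (hsumc hYc).sub hconv, fun t ht => ?_⟩
  · rw [(hXe i 0).2, (hYe i 0).2]
    simp
  · have h1 := hasDerivAt_comp_toNNReal_of_eq_integral (x := fun s => X i s ω - noise (W i s ω))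
      hd1 (fun t => sub_eq_of_eq_add (hXe i t).2) ht
    have h2 := hasDerivAt_comp_toNNReal_of_eq_integral (x := fun s => Y i s ω - noise (W i s ω))
      hd2 (fun t => sub_eq_of_eq_add (hYe i t).2) ht
    refine ((h1.sub h2).congr_of_eventuallyEq (Eventually.of_forall fun s => ?_)).congr_deriv ?_
    · exact (sub_sub_sub_cancel_right _ _ _).symm
    · rw [mvDrift, linDrift_sub, sub_self]

variable (hL : IsLyapunov α β lam ε c C κ K) (hα : 0 ≤ α) (hβ : 0 ≤ β) (hlam : 0 ≤ lam)
  (hA : LipschitzWith C_A A) (hB : LipschitzWith C_B B)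

include hL hα hβ hlam hA hB

/-- Summed over all particles, the averaged position error is again at most the total one, so the
dissipation absorbs both it and the individual errors. Only the fluctuation remains, the initial
difference being zero. -/
theorem IsParticleSystem.ae_sum_lyapunov_le (hsmall : 12 * K * (C_A + C_B : ℝ) ^ 2 ≤ κ)
    (h : IsDrivingData P ρ₀ W X₀)
    (hX₀ : ∀ i, Integrable (X₀ i) P) (hX : IsParticleSystem α β lam A B P W X₀ X)
    (hY : ∀ i, IsMcKeanVlasov α β lam A B P (W i) (X₀ i) (Y i)) :
    ∀ᵐ ω ∂P, ∀ t : ℝ≥0, ∑ i, lyapunov β lam ε (X i t ω - Y i t ω)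
      ≤ ∫ s in (0 : ℝ)..t, Real.exp (-(κ / (2 * C)) * (t - s))
        * (3 * K * ∑ i, ‖fluctuation B P Y i s.toNNReal ω‖ ^ 2) := by
  filter_upwards [hX.ae_hasDerivAt_sub hα hβ hlam hA hB h hX₀ hY] with ω hω t
  have hK := hL.K_pos
  have hκ := hL.κ_pos
  have hfl : ∀ i, Continuous fun s : ℝ => fluctuation B P Y i s.toNNReal ω :=
    fun i => (hω i).2.2.1.comp continuous_real_toNNReal
  have key := hL.sum_le (d := d) Finset.univ
    (x := fun i s => X i s.toNNReal ω - Y i s.toNNReal ω) (h := fun _ _ => 0)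
    (r := fun s => 3 * K * ∑ i, ‖fluctuation B P Y i s.toNNReal ω‖ ^ 2)
    (fun i _ => (hω i).1.comp continuous_real_toNNReal) (fun i _ => (hω i).2.2.2)
    (continuous_const.mul (continuous_finsetSum _ fun i _ => (hfl i).norm.pow 2)) ?_
    (NNReal.coe_nonneg t)
  · have h0 : lyapunov β lam ε (0 : State d) = 0 := by simp [lyapunov]
    simpa only [Real.toNNReal_coe, Real.toNNReal_zero, (hω _).2.1, h0, Finset.sum_const_zero,
      mul_zero, zero_add] using key
  · intro s _
    simp only [norm_zero, zero_pow two_ne_zero, add_zero]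
    set q : ι → Space d := fun i => (X i s.toNNReal ω).1
    set q' : ι → Space d := fun i => (Y i s.toNNReal ω).1
    set S := ∑ j, ‖q j - q' j‖ ^ 2
    have hS : S ≤ ∑ i, sqNorm (X i s.toNNReal ω - Y i s.toNNReal ω) :=
      Finset.sum_le_sum fun i _ =>
        fst_norm_sq_le_sqNorm (X i s.toNNReal ω - Y i s.toNNReal ω)
    have havg : ∑ _i : ι, ((Fintype.card ι : ℝ)⁻¹ * S) ≤ S := by
      rw [Finset.sum_const, Finset.card_univ, nsmul_eq_mul, ← mul_assoc]
      exact mul_le_of_le_one_left (by positivity) (mul_inv_le_one)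
    have hf := fun i => norm_force_sub_sq_le hA hB q q'
      (conv B (P.map (Y i s.toNNReal)) (Y i s.toNNReal ω).1) i
    refine (Finset.sum_le_sum fun i _ => mul_le_mul_of_nonneg_left (hf i) hK.le).trans ?_
    calc ∑ i, K * (3 * ((C_A + C_B) ^ 2 * ‖q i - q' i‖ ^ 2
          + (C_A + C_B) ^ 2 * ((Fintype.card ι : ℝ)⁻¹ * S)
          + ‖fluctuation B P Y i s.toNNReal ω‖ ^ 2))
        = 3 * K * (C_A + C_B) ^ 2 * S
          + 3 * K * (C_A + C_B) ^ 2 * ∑ _i : ι, ((Fintype.card ι : ℝ)⁻¹ * S)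
          + 3 * K * ∑ i, ‖fluctuation B P Y i s.toNNReal ω‖ ^ 2 := by
          rw [← Finset.mul_sum, ← Finset.mul_sum, Finset.sum_add_distrib, Finset.sum_add_distrib,
            ← Finset.mul_sum, ← Finset.mul_sum]
          ring
      _ ≤ 3 * K * (C_A + C_B) ^ 2 * S + 3 * K * (C_A + C_B) ^ 2 * S
          + 3 * K * ∑ i, ‖fluctuation B P Y i s.toNNReal ω‖ ^ 2 := by gcongr
      _ = 12 * K * (C_A + C_B) ^ 2 / 2 * S
          + 3 * K * ∑ i, ‖fluctuation B P Y i s.toNNReal ω‖ ^ 2 := by ring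
      _ ≤ _ := by gcongr

/-- One particle's dissipation cannot absorb the errors of the others. Their average is kept as a
source, to be estimated by the summed inequality; this replaces exchangeability. -/
theorem IsParticleSystem.ae_lyapunov_le (hsmall : 12 * K * (C_A + C_B : ℝ) ^ 2 ≤ κ)
    (h : IsDrivingData P ρ₀ W X₀)
    (hX₀ : ∀ i, Integrable (X₀ i) P) (hX : IsParticleSystem α β lam A B P W X₀ X)
    (hY : ∀ i, IsMcKeanVlasov α β lam A B P (W i) (X₀ i) (Y i)) (i : ι) :
    ∀ᵐ ω ∂P, ∀ t : ℝ≥0, lyapunov β lam ε (X i t ω - Y i t ω)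
      ≤ ∫ s in (0 : ℝ)..t, Real.exp (-(κ / (2 * C)) * (t - s))
        * (3 * K * ((C_A + C_B) ^ 2 * ((Fintype.card ι : ℝ)⁻¹
            * ∑ j, ‖(X j s.toNNReal ω).1 - (Y j s.toNNReal ω).1‖ ^ 2)
          + ‖fluctuation B P Y i s.toNNReal ω‖ ^ 2)) := by
  filter_upwards [hX.ae_hasDerivAt_sub hα hβ hlam hA hB h hX₀ hY] with ω hω t
  have hK := hL.K_pos
  have hκ := hL.κ_pos
  have hfl : ∀ i, Continuous fun s : ℝ => fluctuation B P Y i s.toNNReal ω :=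
    fun i => (hω i).2.2.1.comp continuous_real_toNNReal
  have hD : ∀ j, Continuous fun s : ℝ => (X j s.toNNReal ω).1 - (Y j s.toNNReal ω).1 :=
    fun j => continuous_fst.comp ((hω j).1.comp continuous_real_toNNReal)
  have key := hL.sum_le (d := d) {i}
    (x := fun i s => X i s.toNNReal ω - Y i s.toNNReal ω) (h := fun _ _ => 0)
    (r := fun s => 3 * K * ((C_A + C_B) ^ 2 * ((Fintype.card ι : ℝ)⁻¹
            * ∑ j, ‖(X j s.toNNReal ω).1 - (Y j s.toNNReal ω).1‖ ^ 2)
          + ‖fluctuation B P Y i s.toNNReal ω‖ ^ 2))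
    (fun i _ => (hω i).1.comp continuous_real_toNNReal) (fun i _ => (hω i).2.2.2)
    ?_ ?_ (NNReal.coe_nonneg t)
  · have h0 : lyapunov β lam ε (0 : State d) = 0 := by simp [lyapunov]
    simpa only [Real.toNNReal_coe, Real.toNNReal_zero, (hω _).2.1, h0, Finset.sum_singleton,
      mul_zero, zero_add] using key
  · have := hfl i
    fun_prop
  · intro s _
    simp only [norm_zero, zero_pow two_ne_zero, add_zero, Finset.sum_singleton]
    have h1 := fst_norm_sq_le_sqNorm (X i s.toNNReal ω - Y i s.toNNReal ω)
    have h2 := mul_le_mul_of_nonneg_left (norm_force_sub_sq_le hA hB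
      (fun i => (X i s.toNNReal ω).1) (fun i => (Y i s.toNNReal ω).1)
      (conv B (P.map (Y i s.toNNReal)) (Y i s.toNNReal ω).1) i) hK.le
    have h3 : 3 * K * (C_A + C_B) ^ 2 * ‖(X i s.toNNReal ω).1 - (Y i s.toNNReal ω).1‖ ^ 2
        ≤ κ / 2 * sqNorm (X i s.toNNReal ω - Y i s.toNNReal ω) := by
      have h4 : 3 * K * (C_A + C_B : ℝ) ^ 2 ≤ κ / 2 := by
        have : 0 ≤ K * (C_A + C_B : ℝ) ^ 2 := by positivity
        linarith
      exact mul_le_mul h4 h1 (sq_nonneg _) (by positivity)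
    refine h2.trans ?_
    rw [fluctuation]
    linarith

end Coupling

/-! ### The mean square error is of order `1/N`. -/

section MeanSquare

open Filter Topology Set

variable {Ω : Type*} [MeasurableSpace Ω] {P : Measure Ω} {d : ℕ}
  {α β lam ε c C κ K : ℝ} {A B : Space d → Space d} {C_A C_B : ℝ≥0} {ι : Type*} [Fintype ι]
  {ρ₀ : Measure (State d)} {W : ι → ℝ≥0 → Ω → Space d} {X₀ : ι → Ω → State d}
  {X Y : ι → ℝ≥0 → Ω → State d}

theorem lintegral_ofReal_const_mul {a : ℝ} (ha : 0 ≤ a) (f : Ω → ℝ) :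
    ∫⁻ ω, ENNReal.ofReal (a * f ω) ∂P = ENNReal.ofReal a * ∫⁻ ω, ENNReal.ofReal (f ω) ∂P := by
  simp_rw [ENNReal.ofReal_mul ha]
  exact lintegral_const_mul' _ _ ENNReal.ofReal_ne_top

theorem lintegral_ofReal_sum {f : ι → Ω → ℝ} (hf : ∀ i, Measurable (f i)) (h0 : ∀ i ω, 0 ≤ f i ω) :
    ∫⁻ ω, ENNReal.ofReal (∑ i, f i ω) ∂P = ∑ i, ∫⁻ ω, ENNReal.ofReal (f i ω) ∂P := by
  simp_rw [fun ω => ENNReal.ofReal_sum_of_nonneg (s := Finset.univ) (f := fun i => f i ω)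
    fun i _ => h0 i ω]
  exact lintegral_finsetSum _ fun i _ => (hf i).ennreal_ofReal

theorem IsLyapunov.lintegral_sqNorm_le (hL : IsLyapunov α β lam ε c C κ K) {D : Ω → State d}
    {R : ℝ} (h : ∫⁻ ω, ENNReal.ofReal (lyapunov β lam ε (D ω)) ∂P ≤ ENNReal.ofReal R) :
    ∫⁻ ω, ENNReal.ofReal (sqNorm (D ω)) ∂P ≤ ENNReal.ofReal (R / c) := by
  have hc := hL.c_pos
  calc ∫⁻ ω, ENNReal.ofReal (sqNorm (D ω)) ∂P
      ≤ ∫⁻ ω, ENNReal.ofReal (c⁻¹ * lyapunov β lam ε (D ω)) ∂P := by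
        refine lintegral_mono fun ω => ENNReal.ofReal_le_ofReal ?_
        rw [← div_eq_inv_mul, le_div_iff₀ hc, mul_comm]
        exact hL.le_lyapunov _
    _ = ENNReal.ofReal c⁻¹ * ∫⁻ ω, ENNReal.ofReal (lyapunov β lam ε (D ω)) ∂P :=
        lintegral_ofReal_const_mul (by positivity) _
    _ ≤ ENNReal.ofReal c⁻¹ * ENNReal.ofReal R := by gcongr
    _ = _ := by rw [← ENNReal.ofReal_mul (by positivity), div_eq_inv_mul]

variable [IsProbabilityMeasure P]

theorem measurable_fluctuation (hB : LipschitzWith C_B B)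
    (hY : ∀ i, IsMcKeanVlasov α β lam A B P (W i) (X₀ i) (Y i)) (i : ι) (t : ℝ≥0) :
    Measurable (fluctuation B P Y i t) := by
  have := (hY i).isProbabilityMeasure_map t
  have hc := lipschitzWith_conv hB ((hY i).1 t)
  have hq : ∀ j, Measurable fun ω => (Y j t ω).1 := fun j =>
    measurable_fst.comp ((hY j).2.measurable t)
  have hs : Measurable fun ω => ∑ j, B ((Y i t ω).1 - (Y j t ω).1) :=
    Finset.measurable_fun_sum _ fun j _ => hB.continuous.measurable.comp ((hq i).sub (hq j))
  exact (hs.const_smul (Fintype.card ι : ℝ)⁻¹).sub (hc.continuous.measurable.comp (hq i))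

/-- The mean square distance between the particle system and its mean-field limit. -/
theorem IsParticleSystem.lintegral_sqNorm_sub_le (hL : IsLyapunov α β lam ε c C κ K)
    (hα : 0 ≤ α) (hβ : 0 ≤ β) (hlam : 0 ≤ lam) (hA : LipschitzWith C_A A)
    (hB : LipschitzWith C_B B) (hB0 : B 0 = 0) (hsmall : 12 * K * (C_A + C_B : ℝ) ^ 2 ≤ κ)
    (h : IsDrivingData P ρ₀ W X₀) (hX₀ : ∀ i, Integrable (X₀ i) P)
    (hX : IsParticleSystem α β lam A B P W X₀ X)
    (hY : ∀ i, IsMcKeanVlasov α β lam A B P (W i) (X₀ i) (Y i)) {M : ℝ≥0}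
    (hM : ∀ i t, ∫⁻ ω, ‖(Y i t ω).1‖ₑ ^ 2 ∂P ≤ M) (i : ι) (t : ℝ≥0) :
    ∫⁻ ω, ENNReal.ofReal (sqNorm (X i t ω - Y i t ω)) ∂P ≤ ENNReal.ofReal
      (6 * K * C / (c * κ) * (16 * C_B ^ 2 * M) * (6 * K * C / (c * κ) * (C_A + C_B) ^ 2 + 1)
        / Fintype.card ι) := by
  have hc := hL.c_pos
  have hC := hL.C_pos
  have hκ := hL.κ_pos
  have hK := hL.K_pos
  have hN : (0 : ℝ) < Fintype.card ι := by
    have : Nonempty ι := ⟨i⟩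
    exact_mod_cast Fintype.card_pos
  set N : ℝ := (Fintype.card ι : ℝ)
  set F : ℝ := 16 * C_B ^ 2 * M with hF
  have hF0 : 0 ≤ F := by positivity
  have hflm := measurable_fluctuation hB hY
  have hfl : ∀ j (s : ℝ≥0), ∫⁻ ω, ENNReal.ofReal (‖fluctuation B P Y j s ω‖ ^ 2) ∂P
      ≤ ENNReal.ofReal (F / N) := fun j s => by
    simp_rw [ofReal_norm_sq]
    exact lintegral_fluctuation_sq_le (fun j => (hY j).2.measurable s)
      (h.iIndepFun_mcKeanVlasov hα hβ hlam hA hB hX₀ hY s)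
      (fun k => h.map_mcKeanVlasov_eq hα hβ hlam hA hB hX₀ hY s k j) hB hB0 (fun j => hM j s) j
  have hpath := hX.ae_hasDerivAt_sub hα hβ hlam hA hB h hX₀ hY
  have hflj : ∀ j (ν : Measure ℝ) [SFinite ν],
      AEMeasurable (fun p : ℝ × Ω => ‖fluctuation B P Y j p.1.toNNReal p.2‖ ^ 2) (ν.prod P) :=
    fun j ν _ => (aemeasurable_uncurry_toNNReal (hflm j)
      (hpath.mono fun ω hω => (hω j).2.2.1) ν).norm.pow_const 2
  have hDm : ∀ j s, Measurable fun ω => X j s ω - Y j s ω := fun j s =>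
    ((hX j).measurable s).sub ((hY j).2.measurable s)
  have hDj : ∀ j (ν : Measure ℝ) [SFinite ν], AEMeasurable (fun p : ℝ × Ω =>
      ‖(X j p.1.toNNReal p.2).1 - (Y j p.1.toNNReal p.2).1‖ ^ 2) (ν.prod P) := fun j ν _ => by
    have h1 := aemeasurable_uncurry_toNNReal (hDm j) (hpath.mono fun ω hω => (hω j).1) ν
    exact (measurable_fst.comp_aemeasurable h1).norm.pow_const 2
  -- The sum of `N` fluctuations of mean square `F / N` does not depend on `N`, and the relaxation
  -- time `2C / κ` makes the bound uniform in `s`.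
  have hsum : ∀ s : ℝ≥0, ∫⁻ ω, ENNReal.ofReal (∑ j, ‖(X j s ω).1 - (Y j s ω).1‖ ^ 2) ∂P
      ≤ ENNReal.ofReal (6 * K * C / (c * κ) * F) := by
    intro s
    have hrel := lintegral_le_of_relaxation (P := P) (κ := κ / (2 * C)) (by positivity)
      (NNReal.coe_nonneg s) (v := fun ω => ∑ j, lyapunov β lam ε (X j s ω - Y j s ω))
      (v₀ := fun _ => 0) (r := fun u ω => 3 * K * ∑ j, ‖fluctuation B P Y j u.toNNReal ω‖ ^ 2)
      (R := ENNReal.ofReal (3 * K * F)) aemeasurable_const (fun _ => le_rfl)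
      ((Finset.aemeasurable_fun_sum _ fun j _ => hflj j _).const_mul _)
      (fun _ _ => by positivity) (fun u _ => ?_) ?_
    · simp only [ENNReal.ofReal_zero, lintegral_zero, zero_add] at hrel
      calc ∫⁻ ω, ENNReal.ofReal (∑ j, ‖(X j s ω).1 - (Y j s ω).1‖ ^ 2) ∂P
          ≤ ∫⁻ ω, ENNReal.ofReal (c⁻¹ * ∑ j, lyapunov β lam ε (X j s ω - Y j s ω)) ∂P := by
            refine lintegral_mono fun ω => ENNReal.ofReal_le_ofReal ?_
            rw [Finset.mul_sum]
            refine Finset.sum_le_sum fun j _ => ?_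
            rw [← div_eq_inv_mul, le_div_iff₀ hc, mul_comm]
            refine le_trans ?_ (hL.le_lyapunov _)
            gcongr
            exact fst_norm_sq_le_sqNorm (X j s ω - Y j s ω)
        _ = ENNReal.ofReal c⁻¹ * ∫⁻ ω, ENNReal.ofReal
            (∑ j, lyapunov β lam ε (X j s ω - Y j s ω)) ∂P :=
            lintegral_ofReal_const_mul (by positivity) _
        _ ≤ ENNReal.ofReal c⁻¹ * (ENNReal.ofReal (3 * K * F)
            * ENNReal.ofReal (1 / (κ / (2 * C)))) := by gcongr
        _ = _ := by
            rw [← ENNReal.ofReal_mul (by positivity), ← ENNReal.ofReal_mul (by positivity)]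
            congr 1
            field_simp
            ring
    · rw [lintegral_ofReal_const_mul (by positivity),
        lintegral_ofReal_sum (fun j => (hflm j _).norm.pow_const 2) fun _ _ => sq_nonneg _]
      calc ENNReal.ofReal (3 * K) * ∑ j, ∫⁻ ω, ENNReal.ofReal
            (‖fluctuation B P Y j u.toNNReal ω‖ ^ 2) ∂P
          ≤ ENNReal.ofReal (3 * K) * ∑ _j : ι, ENNReal.ofReal (F / N) := by
            gcongr with j _
            exact hfl j _
        _ = _ := by
            rw [Finset.sum_const, Finset.card_univ, nsmul_eq_mul, ← ENNReal.ofReal_natCast,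
              ← ENNReal.ofReal_mul (by positivity), ← ENNReal.ofReal_mul (by positivity)]
            congr 2
            exact mul_div_cancel₀ F hN.ne'
    · filter_upwards [hX.ae_sum_lyapunov_le hL hα hβ hlam hA hB hsmall h hX₀ hY] with ω hω
      simpa using hω s
  -- Second pass, for particle `i` alone: the average of the errors is now `O(1/N)` by `hsum`, as is
  -- the fluctuation.
  have hrel := lintegral_le_of_relaxation (P := P) (κ := κ / (2 * C)) (by positivity)
    (NNReal.coe_nonneg t) (v := fun ω => lyapunov β lam ε (X i t ω - Y i t ω))
    (v₀ := fun _ => 0) (r := fun s ω => 3 * K * ((C_A + C_B) ^ 2 * (N⁻¹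
            * ∑ j, ‖(X j s.toNNReal ω).1 - (Y j s.toNNReal ω).1‖ ^ 2)
          + ‖fluctuation B P Y i s.toNNReal ω‖ ^ 2))
    (R := ENNReal.ofReal (3 * K * ((C_A + C_B) ^ 2 * (N⁻¹ * (6 * K * C / (c * κ) * F)) + F / N)))
    aemeasurable_const (fun _ => le_rfl)
    (((((Finset.aemeasurable_fun_sum _ fun j _ => hDj j _).const_mul _).const_mul _).add
      (hflj i _)).const_mul _)
    (fun _ _ => by positivity) (fun u _ => ?_) ?_
  · simp only [ENNReal.ofReal_zero, lintegral_zero, zero_add] at hrel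
    rw [← ENNReal.ofReal_mul (by positivity)] at hrel
    refine (hL.lintegral_sqNorm_le hrel).trans_eq (congrArg _ ?_)
    field_simp
    ring
  · rw [lintegral_ofReal_const_mul (by positivity),
      ENNReal.ofReal_mul (p := 3 * K) (by positivity)]
    gcongr
    simp_rw [fun ω => ENNReal.ofReal_add (p := (C_A + C_B : ℝ) ^ 2 * (N⁻¹
      * ∑ j, ‖(X j u.toNNReal ω).1 - (Y j u.toNNReal ω).1‖ ^ 2))
      (q := ‖fluctuation B P Y i u.toNNReal ω‖ ^ 2) (by positivity) (by positivity)]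
    rw [lintegral_add_right _ ((hflm i _).norm.pow_const 2).ennreal_ofReal,
      ENNReal.ofReal_add (by positivity) (by positivity),
      lintegral_ofReal_const_mul (by positivity), lintegral_ofReal_const_mul (by positivity),
      ENNReal.ofReal_mul (p := (C_A + C_B : ℝ) ^ 2) (by positivity),
      ENNReal.ofReal_mul (p := N⁻¹) (by positivity)]
    gcongr
    · exact hsum _
    · exact hfl i _
  · filter_upwards [hX.ae_lyapunov_le hL hα hβ hlam hA hB hsmall h hX₀ hY i] with ω hω
    simpa using hω t

end MeanSquare

/-! ### Wasserstein bound and propagation of chaos. -/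

section Chaos

open Filter Topology Set

variable {Ω : Type*} [MeasurableSpace Ω] {P : Measure Ω} {d : ℕ}
  {α β lam ε c C κ K : ℝ} {A B : Space d → Space d} {C_A C_B : ℝ≥0} {ι : Type*}
  {ρ₀ : Measure (State d)} {W : ι → ℝ≥0 → Ω → Space d} {X₀ : ι → Ω → State d}

/-- The joint law of `(U, V)` is one of the couplings in the infimum. -/
theorem W₂_map_sq_le {U V : Ω → State d} (hU : Measurable U) (hV : Measurable V) :
    W₂ (P.map U) (P.map V) ^ 2 ≤ ∫⁻ ω, ENNReal.ofReal (sqNorm (U ω - V ω)) ∂P := by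
  rw [W₂, ← ENNReal.rpow_natCast, ← ENNReal.rpow_mul]
  norm_num
  have h1 : (P.map fun ω => (U ω, V ω)).map Prod.fst = P.map U :=
    Measure.map_map measurable_fst (hU.prodMk hV)
  have h2 : (P.map fun ω => (U ω, V ω)).map Prod.snd = P.map V :=
    Measure.map_map measurable_snd (hU.prodMk hV)
  refine (iInf_le _ ⟨P.map fun ω => (U ω, V ω), h1, h2⟩).trans_eq ?_
  refine lintegral_map (f := fun x : State d × State d => ENNReal.ofReal (sqNorm (x.1 - x.2))) ?_
    (hU.prodMk hV)
  exact (continuous_sqNorm.measurable.comp (measurable_fst.sub measurable_snd)).ennreal_ofReal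

theorem IsDrivingData.lintegral_sqNorm_init (h : IsDrivingData P ρ₀ W X₀) (i : ι) :
    ∫⁻ ω, ENNReal.ofReal (sqNorm (X₀ i ω)) ∂P = secondMoment ρ₀ :=
  (h.law_init i).lintegral_comp continuous_sqNorm.measurable.ennreal_ofReal.aemeasurable

theorem lintegral_enorm_sq_le (U : Ω → State d) :
    ∫⁻ ω, ‖U ω‖ₑ ^ 2 ∂P ≤ ∫⁻ ω, ENNReal.ofReal (sqNorm (U ω)) ∂P := by
  refine lintegral_mono fun ω => ?_
  rw [← ofReal_norm_sq]
  exact ENNReal.ofReal_le_ofReal (norm_sq_le_sqNorm _)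

variable [IsProbabilityMeasure P]

theorem IsDrivingData.integrable_init (h : IsDrivingData P ρ₀ W X₀)
    (hρ₀ : secondMoment ρ₀ ≠ ∞) (i : ι) : Integrable (X₀ i) P := by
  refine ⟨(h.measurable_init i).aestronglyMeasurable, ?_⟩
  have h1 := (lintegral_sq_le (h.measurable_init i).enorm.aemeasurable (ν := P)).trans
    ((lintegral_enorm_sq_le (X₀ i)).trans_eq (h.lintegral_sqNorm_init i))
  exact (ENNReal.pow_lt_top_iff.1 (h1.trans_lt hρ₀.lt_top)).resolve_right two_ne_zero

/-- The constant in the uniform bound on the second moments of the positions. -/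
noncomputable def momentConst (α lam c C κ K : ℝ) (A : Space d → Space d) (M₀ : ℝ≥0) : ℝ≥0 :=
  (2 / c * (C * M₀
    + 8 * K * C / κ * (‖A 0‖ ^ 2 + (4 * lam ^ 2 + 2 * α ^ 2 + 2) * d))).toNNReal

/-- The constant in the quantitative propagation of chaos. -/
noncomputable def chaosConst (α lam c C κ K : ℝ) (A : Space d → Space d) (C_A C_B M₀ : ℝ≥0) : ℝ :=
  6 * K * C / (c * κ) * (16 * C_B ^ 2 * momentConst α lam c C κ K A M₀)
    * (6 * K * C / (c * κ) * (C_A + C_B) ^ 2 + 1)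

theorem IsLyapunov.chaosConst_nonneg (hL : IsLyapunov α β lam ε c C κ K) (A : Space d → Space d)
    (C_A C_B M₀ : ℝ≥0) : 0 ≤ chaosConst α lam c C κ K A C_A C_B M₀ := by
  have hc := hL.c_pos
  have hC := hL.C_pos
  have hκ := hL.κ_pos
  have hK := hL.K_pos
  unfold chaosConst
  positivity

/-- Mean square convergence of the particle system to the McKean–Vlasov processes, uniformly in
time. -/
theorem IsParticleSystem.lintegral_sqNorm_sub_le_chaosConst [Fintype ι]
    {X Y : ι → ℝ≥0 → Ω → State d} (hL : IsLyapunov α β lam ε c C κ K)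
    (hα : 0 ≤ α) (hβ : 0 ≤ β) (hlam : 0 ≤ lam) (hA : LipschitzWith C_A A)
    (hB : LipschitzWith C_B B) (hB0 : B 0 = 0) (hsmall : 12 * K * (C_A + C_B : ℝ) ^ 2 ≤ κ)
    (hsmall' : 16 * K * C * (C_A + C_B : ℝ) ^ 2 ≤ c * κ) {M₀ : ℝ≥0}
    (hρ₀ : secondMoment ρ₀ ≤ M₀) (h : IsDrivingData P ρ₀ W X₀)
    (hX : IsParticleSystem α β lam A B P W X₀ X)
    (hY : ∀ i, IsMcKeanVlasov α β lam A B P (W i) (X₀ i) (Y i)) (i : ι) (t : ℝ≥0) :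
    ∫⁻ ω, ENNReal.ofReal (sqNorm (X i t ω - Y i t ω)) ∂P ≤ ENNReal.ofReal
      (chaosConst α lam c C κ K A C_A C_B M₀ / Fintype.card ι) := by
  have hX₀ := h.integrable_init (hρ₀.trans_lt ENNReal.coe_lt_top).ne
  have hK := hL.K_pos
  have h8 : 8 * K * (C_A + C_B : ℝ) ^ 2 ≤ κ := by
    refine le_trans ?_ hsmall
    gcongr
    norm_num
  exact hX.lintegral_sqNorm_sub_le hL hα hβ hlam hA hB hB0 hsmall h hX₀ hY
    (M := momentConst α lam c C κ K A M₀) (fun j s => (hY j).lintegral_fst_sq_le hL hα hβ hlam hA hB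
      hB0 h8 hsmall' (h.brownian j) (hX₀ j) ((h.lintegral_sqNorm_init j).le.trans hρ₀) s) i t

theorem pi_norm_sq_le_sum_sqNorm {k : ℕ} (x : Fin k → State d) : ‖x‖ ^ 2 ≤ ∑ a, sqNorm (x a) := by
  have h0 : 0 ≤ ∑ a, sqNorm (x a) := Finset.sum_nonneg fun a _ => sqNorm_nonneg _
  rw [← Real.le_sqrt (norm_nonneg _) h0, pi_norm_le_iff_of_nonneg (Real.sqrt_nonneg _)]
  intro a
  refine Real.le_sqrt_of_sq_le ((norm_sq_le_sqNorm _).trans ?_)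
  exact Finset.single_le_sum (f := fun a => sqNorm (x a)) (fun a _ => sqNorm_nonneg _)
    (Finset.mem_univ a)

/-- Random vectors at vanishing mean distance from vectors of fixed law converge in law. -/
theorem tendsto_integral_map_of_tendsto_lintegral {E : Type*} [NormedAddCommGroup E]
    [SecondCountableTopology E] [MeasurableSpace E] [BorelSpace E] {U V : ℕ → Ω → E}
    (hU : ∀ n, Measurable (U n)) (hV : ∀ n, Measurable (V n)) {ν : Measure E}
    [IsProbabilityMeasure ν] (hlaw : ∀ n, P.map (V n) = ν)
    (hUV : Tendsto (fun n => ∫⁻ ω, ‖U n ω - V n ω‖ₑ ∂P) atTop (𝓝 0)) (φ : E →ᵇ ℝ) :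
    Tendsto (fun n => ∫ x, φ x ∂(P.map (U n))) atTop (𝓝 (∫ x, φ x ∂ν)) := by
  have hmeas : TendstoInMeasure P (U - V) atTop 0 :=
    tendstoInMeasure_of_tendsto_lintegral (g := fun _ => (0 : E))
      (fun n => ((hU n).sub (hV n)).aestronglyMeasurable) aestronglyMeasurable_const
      (by simpa only [sub_zero, Pi.sub_apply] using hUV)
  have hVlim : TendstoInDistribution V atTop id (fun _ => P) ν := by
    refine ⟨fun n => (hV n).aemeasurable, aemeasurable_id, ?_⟩
    simp only [hlaw, Measure.map_id]
    exact tendsto_const_nhds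
  have hUlim := tendstoInDistribution_of_tendstoInMeasure_sub U id hVlim hmeas
    fun n => (hU n).aemeasurable
  have := (ProbabilityMeasure.tendsto_iff_forall_integral_tendsto.1 hUlim.tendsto) φ
  simpa only [ProbabilityMeasure.coe_mk, Measure.map_id] using this

/-- Random vectors at mean square distance `O(1/n)` from vectors of fixed law converge in law. -/
theorem tendsto_integral_map_of_lintegral_sqNorm_le {k : ℕ} {U V : ℕ → Ω → Fin k → State d}
    (hU : ∀ n, Measurable (U n)) (hV : ∀ n, Measurable (V n)) {ν : Measure (Fin k → State d)}
    [IsProbabilityMeasure ν] (hlaw : ∀ n, P.map (V n) = ν) {R : ℝ} (hR : 0 ≤ R)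
    (hUV : ∀ n a, ∫⁻ ω, ENNReal.ofReal (sqNorm (U n ω a - V n ω a)) ∂P
      ≤ ENNReal.ofReal (R / (k + n : ℕ))) (φ : (Fin k → State d) →ᵇ ℝ) :
    Tendsto (fun n => ∫ x, φ x ∂(P.map (U n))) atTop (𝓝 (∫ x, φ x ∂ν)) := by
  have hbound : ∀ n, ∫⁻ ω, ‖U n ω - V n ω‖ₑ ∂P ≤ ENNReal.ofReal √(k * (R / (k + n : ℕ))) := by
    intro n
    have h1 := lintegral_sq_le ((hU n).sub (hV n)).enorm.aemeasurable (ν := P)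
    have h2 : ∫⁻ ω, ‖(U n - V n) ω‖ₑ ^ 2 ∂P ≤ ENNReal.ofReal (k * (R / (k + n : ℕ))) := by
      calc ∫⁻ ω, ‖(U n - V n) ω‖ₑ ^ 2 ∂P
          ≤ ∫⁻ ω, ENNReal.ofReal (∑ a, sqNorm (U n ω a - V n ω a)) ∂P := by
            refine lintegral_mono fun ω => ?_
            rw [← ofReal_norm_sq]
            exact ENNReal.ofReal_le_ofReal (pi_norm_sq_le_sum_sqNorm ((U n - V n) ω))
        _ = ∑ a, ∫⁻ ω, ENNReal.ofReal (sqNorm (U n ω a - V n ω a)) ∂P :=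
            lintegral_ofReal_sum (f := fun a ω => sqNorm (U n ω a - V n ω a))
              (fun a => continuous_sqNorm.measurable.comp
                (((measurable_pi_apply a).comp (hU n)).sub ((measurable_pi_apply a).comp (hV n))))
              fun _ _ => sqNorm_nonneg _
        _ ≤ ∑ _a : Fin k, ENNReal.ofReal (R / (k + n : ℕ)) := Finset.sum_le_sum fun a _ => hUV n a
        _ = _ := by
            rw [Finset.sum_const, Finset.card_univ, Fintype.card_fin, nsmul_eq_mul,
              ENNReal.ofReal_mul (Nat.cast_nonneg k), ENNReal.ofReal_natCast]
    refine (ENNReal.pow_le_pow_left_iff two_ne_zero).1 ?_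
    rw [← ENNReal.ofReal_pow (Real.sqrt_nonneg _), Real.sq_sqrt (by positivity)]
    exact h1.trans h2
  have hlim : Tendsto (fun n : ℕ => ENNReal.ofReal √(k * (R / (k + n : ℕ)))) atTop (𝓝 0) := by
    have h1 : Tendsto (fun n : ℕ => (k : ℝ) * (R / (k + n : ℕ))) atTop (𝓝 (k * 0)) :=
      (Tendsto.div_atTop tendsto_const_nhds (tendsto_natCast_atTop_atTop.comp
        (tendsto_atTop_mono (fun n => Nat.le_add_left n k) tendsto_id))).const_mul _
    have h2 := (ENNReal.continuous_ofReal.comp Real.continuous_sqrt).tendsto ((k : ℝ) * 0)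
    simp only [Function.comp, mul_zero, Real.sqrt_zero, ENNReal.ofReal_zero] at h1 h2
    exact h2.comp h1
  exact tendsto_integral_map_of_tendsto_lintegral hU hV hlaw
    (tendsto_of_tendsto_of_tendsto_of_le_of_le tendsto_const_nhds hlim (fun _ => zero_le) hbound) φ

/-- Propagation of chaos. -/
theorem propagationOfChaos_of_lintegral_sqNorm_le (hα : 0 ≤ α) (hβ : 0 ≤ β) (hlam : 0 ≤ lam)
    (hA : LipschitzWith C_A A) (hB : LipschitzWith C_B B) {W : ℕ → ℝ≥0 → Ω → Space d}
    {X₀ : ℕ → Ω → State d} (h : IsDrivingData P ρ₀ W X₀) (hX₀ : ∀ i, Integrable (X₀ i) P)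
    {X : (N : ℕ) → Fin N → ℝ≥0 → Ω → State d} {Y : ℕ → ℝ≥0 → Ω → State d}
    (hX : ∀ N i t, Measurable (X N i t))
    (hY : ∀ i, IsMcKeanVlasov α β lam A B P (W i) (X₀ i) (Y i)) {R : ℝ} (hR : 0 ≤ R)
    (hXY : ∀ (N : ℕ) (i : Fin N) t, ∫⁻ ω, ENNReal.ofReal (sqNorm (X N i t ω - Y i t ω)) ∂P
      ≤ ENNReal.ofReal (R / N)) (j : ℕ) :
    PropagationOfChaos P X fun t => P.map (Y j t) := by
  intro t k _ i φ
  have hprob : IsProbabilityMeasure (P.map (Y j t)) := (hY j).isProbabilityMeasure_map t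
  have hmarg : ∀ n, marginal (jointLaw P (X (k + n)) t) (i n)
      = P.map fun ω a => X (k + n) (i n a) t ω := fun n =>
    Measure.map_map (measurable_pi_lambda _ fun _ => measurable_pi_apply _)
      (measurable_pi_lambda _ fun _ => hX _ _ t)
  simp_rw [hmarg]
  refine tendsto_integral_map_of_lintegral_sqNorm_le (V := fun n ω a => Y (i n a) t ω)
    (fun n => measurable_pi_lambda _ fun a => hX _ _ t)
    (fun n => measurable_pi_lambda _ fun a => (hY _).2.measurable t) (fun n => ?_) hR
    (fun n a => hXY (k + n) (i n a) t) φ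
  -- Distinct particles carry distinct inputs, so the `k` mean-field copies have the fixed joint law
  -- `μ_t^{⊗k}` however the choice varies with `n`.
  have hinj : Function.Injective fun a : Fin k => ((i n a : Fin (k + n)) : ℕ) :=
    Fin.val_injective.comp (i n).injective
  have hind := (h.comp hinj).iIndepFun_mcKeanVlasov hα hβ hlam hA hB (fun a => hX₀ _)
    (fun a => hY (i n a)) t
  rw [(iIndepFun_iff_map_fun_eq_pi_map fun a => ((hY _).2.measurable t).aemeasurable).1 hind]
  congr 1
  funext a
  exact h.map_mcKeanVlasov_eq hα hβ hlam hA hB hX₀ hY t _ j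

end Chaos

end GenVlasov

theorem theorem2 (α β lam : ℝ) (hα : 0 < α) (hβ : 0 < β) (hlam : 0 < lam) :
    ∃ η₀ : ℝ, 0 < η₀ ∧
      ∀ (d : ℕ) (A B : GenVlasov.Space d → GenVlasov.Space d) (C_A C_B : ℝ≥0),
        LipschitzWith C_A A → LipschitzWith C_B B → (∀ q, B (-q) = -B q) →
        (C_A : ℝ) + C_B < η₀ →
        ∀ K : ℝ≥0, ∃ C : ℝ, 0 < C ∧
          ∀ ρ₀ : Measure (GenVlasov.State d), IsProbabilityMeasure ρ₀ →
            GenVlasov.secondMoment ρ₀ ≤ K →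
            -- bounds for a system of `N` particles
            (∀ (Ω : Type*) [MeasurableSpace Ω] (P : Measure Ω) [IsProbabilityMeasure P] (N : ℕ)
                (W : Fin N → ℝ≥0 → Ω → GenVlasov.Space d) (X₀ : Fin N → Ω → GenVlasov.State d)
                (X Y : Fin N → ℝ≥0 → Ω → GenVlasov.State d),
                GenVlasov.IsDrivingData P ρ₀ W X₀ →
                GenVlasov.IsParticleSystem α β lam A B P W X₀ X →
                (∀ i, GenVlasov.IsMcKeanVlasov α β lam A B P (W i) (X₀ i) (Y i)) →
                (∀ i, (⨆ t : ℝ≥0, ∫⁻ ω, ENNReal.ofReal (GenVlasov.sqNorm (X i t ω - Y i t ω)) ∂P)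
                  ≤ ENNReal.ofReal (C / N)) ∧
                (∀ i j, (⨆ t : ℝ≥0, GenVlasov.W₂ (P.map (X i t)) (P.map (Y j t)) ^ 2)
                  ≤ ENNReal.ofReal (C / N))) ∧
            -- propagation of chaos as the number of particles tends to infinity
            (∀ (Ω : Type*) [MeasurableSpace Ω] (P : Measure Ω) [IsProbabilityMeasure P]
                (W : ℕ → ℝ≥0 → Ω → GenVlasov.Space d) (X₀ : ℕ → Ω → GenVlasov.State d)
                (X : (N : ℕ) → Fin N → ℝ≥0 → Ω → GenVlasov.State d)
                (Y : ℕ → ℝ≥0 → Ω → GenVlasov.State d),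
                GenVlasov.IsDrivingData P ρ₀ W X₀ →
                (∀ N, GenVlasov.IsParticleSystem α β lam A B P
                  (fun i : Fin N => W i) (fun i : Fin N => X₀ i) (X N)) →
                (∀ i, GenVlasov.IsMcKeanVlasov α β lam A B P (W i) (X₀ i) (Y i)) →
                ∀ j, GenVlasov.PropagationOfChaos P X (fun t => P.map (Y j t))) := by
  obtain ⟨ε, c, C, κ, K, hL⟩ := GenVlasov.exists_isLyapunov hα hβ hlam
  have hc := hL.c_pos
  have hC := hL.C_pos
  have hκ := hL.κ_pos
  have hK := hL.K_pos
  -- The second and third bounds serve the coupling and the second moment estimate. These need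
  -- smallness of the square of `C_A + C_B`; the bound by `1` makes the square at most `C_A + C_B`
  -- itself.
  refine ⟨min 1 (min (κ / (12 * K)) (c * κ / (16 * K * C))), by positivity, ?_⟩
  intro d A B C_A C_B hA hB hodd hη M₀
  obtain ⟨h1, h2, h3⟩ : (C_A : ℝ) + C_B < 1 ∧ (C_A : ℝ) + C_B < κ / (12 * K) ∧
      (C_A : ℝ) + C_B < c * κ / (16 * K * C) := by
    simpa only [lt_min_iff] using hη
  have hsq : (C_A + C_B : ℝ) ^ 2 ≤ C_A + C_B :=
    pow_le_of_le_one (by positivity) h1.le two_ne_zero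
  have hsmall : 12 * K * (C_A + C_B : ℝ) ^ 2 ≤ κ := by
    rw [← le_div_iff₀' (by positivity)]
    exact hsq.trans h2.le
  have hsmall' : 16 * K * C * (C_A + C_B : ℝ) ^ 2 ≤ c * κ := by
    rw [← le_div_iff₀' (by positivity)]
    exact hsq.trans h3.le
  -- Oddness of `B` is used through this value: it lets moments of the position control the
  -- interaction force.
  have hB0 : B 0 = 0 := by
    have h0 : B 0 = -B 0 := by simpa using hodd 0
    have h2 : (2 : ℝ) • B 0 = 0 := by
      rw [two_smul, ← eq_neg_iff_add_eq_zero]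
      exact h0
    exact (smul_eq_zero.1 h2).resolve_left two_ne_zero
  have hR := hL.chaosConst_nonneg A C_A C_B M₀
  -- `chaosConst` may vanish, for instance when `B` is constant and `C_B = 0`; the `+ 1` makes the
  -- constant positive.
  refine ⟨GenVlasov.chaosConst α lam c C κ K A C_A C_B M₀ + 1, by positivity, fun ρ₀ _ hρ₀ => ?_⟩
  have hfin := (hρ₀.trans_lt ENNReal.coe_lt_top).ne
  refine ⟨?_, ?_⟩
  · intro Ω _ P _ N W X₀ X Y h hX hY
    have key : ∀ i t, ∫⁻ ω, ENNReal.ofReal (GenVlasov.sqNorm (X i t ω - Y i t ω)) ∂P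
        ≤ ENNReal.ofReal ((GenVlasov.chaosConst α lam c C κ K A C_A C_B M₀ + 1) / N) := by
      intro i t
      refine (hX.lintegral_sqNorm_sub_le_chaosConst hL hα.le hβ.le hlam.le hA hB hB0 hsmall hsmall'
        hρ₀ h hY i t).trans (ENNReal.ofReal_le_ofReal ?_)
      rw [Fintype.card_fin]
      gcongr
      simp
    refine ⟨fun i => iSup_le (key i), fun i j => iSup_le fun t => ?_⟩
    -- The law of `Y j t` is that of `Y i t`, and the latter is coupled to `X i t`.
    rw [h.map_mcKeanVlasov_eq hα.le hβ.le hlam.le hA hB (h.integrable_init hfin) hY t j i]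
    exact (GenVlasov.W₂_map_sq_le ((hX i).measurable t) ((hY i).2.measurable t)).trans (key i t)
  · intro Ω _ P _ W X₀ X Y h hX hY j
    refine GenVlasov.propagationOfChaos_of_lintegral_sqNorm_le hα.le hβ.le hlam.le hA hB h
      (h.integrable_init hfin) (fun N i t => (hX N i).measurable t) hY hR (fun N i t => ?_) j
    have := (hX N).lintegral_sqNorm_sub_le_chaosConst hL hα.le hβ.le hlam.le hA hB hB0 hsmall
      hsmall' hρ₀ (h.comp Fin.val_injective) (fun i : Fin N => hY i) i t
    rwa [Fintype.card_fin] at this
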